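/- A highway instance consists of $n$ items $1,\dots,n$ in a row, item $e$ being available in $c_e\in\mathbb N$ identical copies, and of $m$ single-minded agents; agent $i$ is given by a nonempty interval $S_i\subseteq\{1,\dots,n\}$ of consecutive items and a valuation $v_i\in\mathbb N$. She values a set $S$ of items at $v_i(S)=v_i$ if $S_i\subseteq S$, and at $v_i(S)=0$ otherwise. An allocation/pricing $(a,p)$ assigns to each agent $i$ a set $a_i$ of items, such that every item $e$ lies in at most $c_e$ of the sets $a_i$, and to each set $S$ of items a real price $p(S)$. With $z_i=\max_S(v_i(S)-p(S))$ and $\mathcal S_i=\{S: v_i(S)-p(S)=z_i\}$, it is envy free if for every agent $i$: $a_i\in\mathcal S_i$ if $z_i>0$; $a_i\in\mathcal S_i$ or $a_i=\emptyset$ if $z_i=0$; and $a_i=\emptyset$ if $z_i<0$. The pricing is monotone if $p(S)\le\sum_{T\in\mathcal T}p(T)$ for every set $S$ and every collection $\mathcal T$ of sets with $S\subseteq\bigcup_{T\in\mathcal T}T$. The allocation/pricing is multi envy free if it is envy free and its pricing is monotone. Its revenue is $\sum_{i:\,a_i\neq\emptyset}p(a_i)$. Theorem. There are a program for a random access machine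 (unit cost; addition, truncated subtraction, comparison and indirect addressing on natural numbers) and an absolute constant $K$ such that, for all integers $m,B,C\ge 1$ and every highway instance with $n$ items, $m$ agents, all valuations $v_i\le B$ and all capacities $c_e\le C$, the program halts on this instance after at most $K\,m^{2C}B^{2C^2}n$ steps and outputs a set $W$ of winners and a price for the interval of each winner that are those of a multi envy free allocation/pricing $(a,p)$, with $a_i=S_i$ for $i\in W$ and $a_i=\emptyset$ for $i\notin W$, whose revenue is the largest among all multi envy free allocation/pricings of the instance. -/

import Mathlib

namespace HighwayPricing

/-! ### Allocations, payment functions and envy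

`ι` is the set of agents, `α` the set of items, `v i S` the value of agent `i` for the set `S`,
`a i` the set allocated to agent `i`, and `p S` the payment required for the set `S`. -/

section Auction

variable {ι α : Type*} [Fintype α] [DecidableEq α]

/-- The best utility `max_S (v_i(S) - p(S))` of agent `i`, over all sets of items `S`. -/
noncomputable def bestUtility (v : ι → Finset α → ℝ) (p : Finset α → ℝ) (i : ι) : ℝ :=
  (Finset.univ : Finset (Finset α)).sup' Finset.univ_nonempty (fun S => v i S - p S)

/-- The collection of the sets at which agent `i` attains her best utility. -/
def demand (v : ι → Finset α → ℝ) (p : Finset α → ℝ) (i : ι) : Set (Finset α) :=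
  {S | v i S - p S = bestUtility v p i}

/-- The allocation/pricing `(a, p)` is envy free. -/
def EnvyFree (v : ι → Finset α → ℝ) (a : ι → Finset α) (p : Finset α → ℝ) : Prop :=
  ∀ i, (0 < bestUtility v p i → a i ∈ demand v p i) ∧
    (bestUtility v p i = 0 → a i ∈ demand v p i ∨ a i = ∅) ∧
    (bestUtility v p i < 0 → a i = ∅)

/-- The pricing `p` is monotone: a set costs at most as much as any collection covering it.
(If there is at least one item, this forces `p ∅ = 0` and `0 ≤ p S` for all `S`.) -/
def MonotonePricing (p : Finset α → ℝ) : Prop :=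
  ∀ (S : Finset α) (T : Finset (Finset α)), S ⊆ T.biUnion id → p S ≤ ∑ U ∈ T, p U

/-- The allocation/pricing `(a, p)` is multi envy free. -/
def MultiEnvyFree (v : ι → Finset α → ℝ) (a : ι → Finset α) (p : Finset α → ℝ) : Prop :=
  EnvyFree v a p ∧ MonotonePricing p

variable [Fintype ι]

/-- The allocation sells at most `cap e` copies of each item `e`. -/
def RespectsCapacities (cap : α → ℕ) (a : ι → Finset α) : Prop :=
  ∀ e, (Finset.univ.filter (fun i => e ∈ a i)).card ≤ cap e

/-- The revenue: the total payment of the winners, i.e. of the agents with `a i ≠ ∅`. -/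
noncomputable def revenue (a : ι → Finset α) (p : Finset α → ℝ) : ℝ :=
  ∑ i ∈ Finset.univ.filter (fun i => a i ≠ ∅), p (a i)

/-- `(a, p)` is a multi envy free allocation/pricing that respects the capacities and has the
largest revenue among all of these. -/
def IsOptimalMultiEnvyFree (cap : α → ℕ) (v : ι → Finset α → ℝ)
    (a : ι → Finset α) (p : Finset α → ℝ) : Prop :=
  RespectsCapacities cap a ∧ MultiEnvyFree v a p ∧
    ∀ (a' : ι → Finset α) (p' : Finset α → ℝ),
      RespectsCapacities cap a' → MultiEnvyFree v a' p' → revenue a' p' ≤ revenue a p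

end Auction

/-! ### The highway problem -/

/-- An instance of the highway problem with `n` items in a row and `m` single-minded agents:
the capacity of each item, and for each agent the first and the last item of the interval she
is interested in and her valuation of it. -/
structure Highway (n m : ℕ) where
  cap : Fin n → ℕ
  first : Fin m → Fin n
  last : Fin m → Fin n
  first_le_last : ∀ i, first i ≤ last i
  val : Fin m → ℕ

namespace Highway

variable {n m : ℕ}

/-- The interval of items that agent `i` is interested in. -/
def bundle (I : Highway n m) (i : Fin m) : Finset (Fin n) :=
  Finset.Icc (I.first i) (I.last i)

/-- The single-minded valuation functions. -/
noncomputable def valuation (I : Highway n m) (i : Fin m) (S : Finset (Fin n)) : ℝ :=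
  if I.bundle i ⊆ S then (I.val i : ℝ) else 0

end Highway

/-! ### A random access machine with unit costs

Programs are written in a structured form. A state consists of registers `reg 0, reg 1, …` and
arrays `arr 0, arr 1, …`, all holding natural numbers; a program addresses a register or an array
by its number, so that it uses finitely many of them, and the entries of an array by a computed
index. The only arithmetic operations are addition and truncated subtraction; there is no
multiplication. Each operation, memory access, test and assignment takes one step. -/

structure State where
  reg : ℕ → ℕ
  arr : ℕ → ℕ → ℕ

inductive RExpr where
  | lit (k : ℕ) : RExpr
  | var (x : ℕ) : RExpr
  | get (b : ℕ) (j : RExpr) : RExpr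
  | plus (e f : RExpr) : RExpr
  | minus (e f : RExpr) : RExpr

namespace RExpr

/-- The value of an expression in a state. -/
def eval (s : State) : RExpr → ℕ
  | lit k => k
  | var x => s.reg x
  | get b j => s.arr b (j.eval s)
  | plus e f => e.eval s + f.eval s
  | minus e f => e.eval s - f.eval s

/-- The number of steps for evaluating an expression: one for each node. -/
def cost : RExpr → ℕ
  | lit _ => 1
  | var _ => 1
  | get _ j => j.cost + 1
  | plus e f => e.cost + f.cost + 1
  | minus e f => e.cost + f.cost + 1

end RExpr

/-- Programs: `skip`, `reg x := e`, `arr b [j] := e`, `c ; d`, `if e ≤ f then c else d`,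
`while e < f do c`. -/
inductive RProg where
  | skip : RProg
  | set (x : ℕ) (e : RExpr) : RProg
  | put (b : ℕ) (j e : RExpr) : RProg
  | seq (c d : RProg) : RProg
  | ifLe (e f : RExpr) (c d : RProg) : RProg
  | whileLt (e f : RExpr) (c : RProg) : RProg

/-- `reg x := k` -/
def State.setReg (s : State) (x k : ℕ) : State :=
  { s with reg := Function.update s.reg x k }

/-- `arr b [j] := k` -/
def State.putArr (s : State) (b j k : ℕ) : State :=
  { s with arr := Function.update s.arr b (Function.update (s.arr b) j k) }

/-- `Run c s t s'`: the program `c`, started in state `s`, halts after exactly `t` steps in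
state `s'`. -/
inductive Run : RProg → State → ℕ → State → Prop
  | skip (s : State) : Run RProg.skip s 1 s
  | set (s : State) (x : ℕ) (e : RExpr) :
      Run (RProg.set x e) s (e.cost + 1) (s.setReg x (e.eval s))
  | put (s : State) (b : ℕ) (j e : RExpr) :
      Run (RProg.put b j e) s (j.cost + e.cost + 1) (s.putArr b (j.eval s) (e.eval s))
  | seq {s s₁ s₂ : State} {t₁ t₂ : ℕ} {c d : RProg} :
      Run c s t₁ s₁ → Run d s₁ t₂ s₂ → Run (RProg.seq c d) s (t₁ + t₂) s₂
  | ifTrue {s s₁ : State} {t : ℕ} {e f : RExpr} {c d : RProg} :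
      e.eval s ≤ f.eval s → Run c s t s₁ →
      Run (RProg.ifLe e f c d) s (e.cost + f.cost + 1 + t) s₁
  | ifFalse {s s₁ : State} {t : ℕ} {e f : RExpr} {c d : RProg} :
      f.eval s < e.eval s → Run d s t s₁ →
      Run (RProg.ifLe e f c d) s (e.cost + f.cost + 1 + t) s₁
  | whileTrue {s s₁ s₂ : State} {t₁ t₂ : ℕ} {e f : RExpr} {c : RProg} :
      e.eval s < f.eval s → Run c s t₁ s₁ → Run (RProg.whileLt e f c) s₁ t₂ s₂ →
      Run (RProg.whileLt e f c) s (e.cost + f.cost + 1 + t₁ + t₂) s₂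
  | whileFalse {s : State} {e f : RExpr} {c : RProg} :
      f.eval s ≤ e.eval s → Run (RProg.whileLt e f c) s (e.cost + f.cost + 1) s

/-! ### Input and output -/

/-- The array with the entries `f 0, …, f (k - 1)`, followed by zeros. -/
def toArray {k : ℕ} (f : Fin k → ℕ) (j : ℕ) : ℕ :=
  if h : j < k then f ⟨j, h⟩ else 0

namespace Highway

variable {n m : ℕ}

/-- The initial state for an instance: registers `0` and `1` hold `n` and `m`, and the arrays
`0, 1, 2, 3` hold the capacities, the first items, the last items and the valuations (items and
agents are numbered from `0`). All other registers and array entries are `0`. -/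
def input (I : Highway n m) : State where
  reg := fun x => match x with
    | 0 => n
    | 1 => m
    | _ => 0
  arr := fun b => match b with
    | 0 => toArray I.cap
    | 1 => toArray (fun i => (I.first i : ℕ))
    | 2 => toArray (fun i => (I.last i : ℕ))
    | 3 => toArray I.val
    | _ => fun _ => 0

/-- The allocation that is read off from a final state: agent `i` gets her interval if
entry `i` of array `4` is nonzero, and nothing otherwise. -/
def outputAllocation (I : Highway n m) (s : State) (i : Fin m) : Finset (Fin n) :=
  if s.arr 4 i ≠ 0 then I.bundle i else ∅

/-- The final state `s` describes a revenue maximizing multi envy free allocation/pricing of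
the instance: array `4` marks the winners, and array `5` gives the payments for their
intervals. (A payment function is given by its values on the sets that are sold: if any payment
function with these values works, so does the one that charges for every other set the
total payment of a cheapest collection of sold intervals covering it, or a prohibitive amount
if there is none.) -/
def OutputOptimal (I : Highway n m) (s : State) : Prop :=
  ∃ p : Finset (Fin n) → ℝ,
    (∀ i : Fin m, s.arr 4 i ≠ 0 → p (I.bundle i) = (s.arr 5 i : ℝ)) ∧
    IsOptimalMultiEnvyFree I.cap I.valuation (I.outputAllocation s) p

end Highway

end HighwayPricing

/-! The problem is first reduced to the choice of the winners. Under a monotone envy free pricing a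
winner pays at most her valuation, so the price of an interval is at most the total valuation of any
winners who cover it. Hence the revenue is at most what the same winners pay under the prices
`Road.price` of cheapest covers (`exists_feasible_revenue_le`). Conversely, cover prices are
subadditive, hence monotone, and no winner pays more than her valuation, so only a loser can be
envious. If a loser `j` values her interval above a cheapest cover `T` of it, replace `T` by `j`:
the capacities still hold, no price drops (`price_exchange_le`), the revenue does not drop, and the
total valuation of the winners rises. So a set that maximizes the revenue, with ties broken in
favour of the total valuation, leaves no envy (`Feasible.val_le_price`). Both criteria are packed
into the single number `Road.worth`, and `outputOptimal_of_worth_max` concludes that a set of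
largest worth is optimal.

The worth is maximized by a dynamic program that sweeps the items. A cheapest cover of the items of
`i` up to item `e` contains some winner `j` who wants `e`, and its other members cover the items of
`i` before the first item of `j` (`price_Ico_succ_cases`). All candidates `j` are among the few
winners who want `e`. It therefore suffices to store, for each winner `i` who wants the current
item, the price of her items before it, and, for each pair `i`, `j` of them, the price of her items
when `j` comes last in the cover. Agents decided later start too late to affect these numbers.
Truncating them at the valuation of `i` loses nothing, because `i` never pays more, and it bounds
them by `B`. `describes_run` and `run_snd` show that the records have this meaning and that their
values add up to the worth.

Equal records have equal futures, so one copy with the best value suffices. The invariant `Level`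
says that a list of records is sound, complete for all feasible sets and free of repetitions. Adding
an agent is injective on records (`agree_of_add_agree`), so repetitions arise only on passing to the
next item. There they are detected by a table indexed with the record read as a number in base `M`;
the multiples of the powers of `M` are tabulated beforehand, since the machine cannot multiply. At
item `n` no agent is left, so a single record remains, and its value is the largest worth
(`Level.exists_max`). The pointers to predecessors (`Chain`) are then followed backwards to read off
the winners and their prices (`walkP_spec`).

For the running time, freedom from repetitions bounds a list by `(m + 1) ^ c * B ^ (c + c * c)`
records (`Level.card_le`), where the number `c` of slots is at most `C` and at most `m`. Each record
costs a multiple of `c * c` steps per agent, and `mul_card_records_le` compares the product with the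
required bound. -/

namespace HighwayPricing

/-! ### Weakest preconditions for the random access machine -/

section Machine

@[simp] theorem State.setReg_reg (s : State) (x k y : ℕ) :
    (s.setReg x k).reg y = if y = x then k else s.reg y := by
  simp [State.setReg, Function.update_apply]

@[simp] theorem State.setReg_arr (s : State) (x k : ℕ) : (s.setReg x k).arr = s.arr := rfl

@[simp] theorem State.putArr_reg (s : State) (b j k : ℕ) : (s.putArr b j k).reg = s.reg := rfl

@[simp] theorem State.putArr_arr (s : State) (b j k b' : ℕ) :
    (s.putArr b j k).arr b' = if b' = b then Function.update (s.arr b) j k else s.arr b' := by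
  simp [State.putArr, Function.update_apply]

/-- The program halts, with a running time and a final state that satisfy `Q`. -/
def Wp (c : RProg) (s : State) (Q : ℕ → State → Prop) : Prop :=
  ∃ t s', Run c s t s' ∧ Q t s'

/-- The registers a program may write. -/
def RProg.wregs : RProg → List ℕ
  | .skip => []
  | .set x _ => [x]
  | .put _ _ _ => []
  | .seq c d => c.wregs ++ d.wregs
  | .ifLe _ _ c d => c.wregs ++ d.wregs
  | .whileLt _ _ c => c.wregs

/-- The arrays a program may write. -/
def RProg.warrs : RProg → List ℕ
  | .skip => []
  | .set _ _ => []
  | .put b _ _ => [b]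
  | .seq c d => c.warrs ++ d.warrs
  | .ifLe _ _ c d => c.warrs ++ d.warrs
  | .whileLt _ _ c => c.warrs

/-- The states agree outside of the registers in `R` and the arrays in `A`. -/
def Same (R A : List ℕ) (s s' : State) : Prop :=
  (∀ x, x ∉ R → s'.reg x = s.reg x) ∧ ∀ b, b ∉ A → s'.arr b = s.arr b

theorem Same.refl (R A : List ℕ) (s : State) : Same R A s s :=
  ⟨fun _ _ => rfl, fun _ _ => rfl⟩

theorem Same.trans {R A : List ℕ} {s s' s'' : State} (h : Same R A s s') (h' : Same R A s' s'') :
    Same R A s s'' :=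
  ⟨fun x hx => (h'.1 x hx).trans (h.1 x hx), fun b hb => (h'.2 b hb).trans (h.2 b hb)⟩

theorem Same.mono {R A R' A' : List ℕ} {s s' : State} (h : Same R A s s') (hR : R ⊆ R')
    (hA : A ⊆ A') : Same R' A' s s' :=
  ⟨fun x hx => h.1 x fun h => hx (hR h), fun b hb => h.2 b fun h => hb (hA h)⟩

/-- This is the frame rule: what the program text never writes keeps its value. -/
theorem Run.same {c : RProg} {s s' : State} {t : ℕ} (h : Run c s t s') :
    Same c.wregs c.warrs s s' := by
  induction h with
  | skip s => exact Same.refl _ _ _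
  | set s x e =>
    refine ⟨fun y hy => ?_, fun _ _ => rfl⟩
    simp [RProg.wregs] at hy
    simp [hy]
  | put s b j e =>
    refine ⟨fun _ _ => rfl, fun y hy => ?_⟩
    simp [RProg.warrs] at hy
    simp [hy]
  | seq _ _ h₁ h₂ =>
    exact (h₁.mono (List.subset_append_left _ _) (List.subset_append_left _ _)).trans
      (h₂.mono (List.subset_append_right _ _) (List.subset_append_right _ _))
  | ifTrue _ _ h => exact h.mono (List.subset_append_left _ _) (List.subset_append_left _ _)
  | ifFalse _ _ h => exact h.mono (List.subset_append_right _ _) (List.subset_append_right _ _)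
  | whileTrue _ _ _ h₁ h₂ => exact Same.trans h₁ h₂
  | whileFalse _ => exact Same.refl _ _ _

theorem wp_skip (s : State) (Q : ℕ → State → Prop) : Wp .skip s Q ↔ Q 1 s := by
  constructor
  · rintro ⟨t, s', h, hQ⟩
    cases h
    exact hQ
  · exact fun h => ⟨_, _, .skip s, h⟩

theorem wp_set (s : State) (x : ℕ) (e : RExpr) (Q : ℕ → State → Prop) :
    Wp (.set x e) s Q ↔ Q (e.cost + 1) (s.setReg x (e.eval s)) := by
  constructor
  · rintro ⟨t, s', h, hQ⟩
    cases h
    exact hQ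
  · exact fun h => ⟨_, _, .set s x e, h⟩

theorem wp_put (s : State) (b : ℕ) (j e : RExpr) (Q : ℕ → State → Prop) :
    Wp (.put b j e) s Q ↔ Q (j.cost + e.cost + 1) (s.putArr b (j.eval s) (e.eval s)) := by
  constructor
  · rintro ⟨t, s', h, hQ⟩
    cases h
    exact hQ
  · exact fun h => ⟨_, _, .put s b j e, h⟩

theorem wp_seq (c d : RProg) (s : State) (Q : ℕ → State → Prop) :
    Wp (.seq c d) s Q ↔ Wp c s fun t₁ s₁ => Wp d s₁ fun t₂ s₂ => Q (t₁ + t₂) s₂ := by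
  constructor
  · rintro ⟨t, s', h, hQ⟩
    cases h with
    | seq h₁ h₂ => exact ⟨_, _, h₁, _, _, h₂, hQ⟩
  · rintro ⟨t₁, s₁, h₁, t₂, s₂, h₂, hQ⟩
    exact ⟨_, _, .seq h₁ h₂, hQ⟩

theorem wp_ifLe (e f : RExpr) (c d : RProg) (s : State) (Q : ℕ → State → Prop) :
    Wp (.ifLe e f c d) s Q ↔
      (e.eval s ≤ f.eval s → Wp c s fun t s' => Q (e.cost + f.cost + 1 + t) s') ∧
        (f.eval s < e.eval s → Wp d s fun t s' => Q (e.cost + f.cost + 1 + t) s') := by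
  constructor
  · rintro ⟨t, s', h, hQ⟩
    cases h with
    | ifTrue h₁ h₂ => exact ⟨fun _ => ⟨_, _, h₂, hQ⟩, fun h => absurd h₁ (not_le.2 h)⟩
    | ifFalse h₁ h₂ => exact ⟨fun h => absurd h₁ (not_lt.2 h), fun _ => ⟨_, _, h₂, hQ⟩⟩
  · rintro ⟨h₁, h₂⟩
    rcases le_or_gt (e.eval s) (f.eval s) with h | h
    · obtain ⟨t, s', hr, hQ⟩ := h₁ h
      exact ⟨_, _, .ifTrue h hr, hQ⟩
    · obtain ⟨t, s', hr, hQ⟩ := h₂ h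
      exact ⟨_, _, .ifFalse h hr, hQ⟩

/-- The consequence rule comes with the frame condition, so that specifications and loop invariants
need to mention only what changes. -/
theorem Wp.imp {c : RProg} {s : State} {Q Q' : ℕ → State → Prop} (h : Wp c s Q)
    (hQ : ∀ t s', Same c.wregs c.warrs s s' → Q t s' → Q' t s') : Wp c s Q' := by
  obtain ⟨t, s', hr, hq⟩ := h
  exact ⟨t, s', hr, hQ t s' hr.same hq⟩

/-- The rule for a loop with `N` iterations, each of which takes at most `T` steps. -/
theorem wp_while {e f : RExpr} {c : RProg} {s : State} (I : ℕ → State → Prop) (N T : ℕ)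
    (h0 : I 0 s)
    (hstep : ∀ i s', i < N → Same c.wregs c.warrs s s' → I i s' →
      e.eval s' < f.eval s' ∧ Wp c s' fun t s'' => t ≤ T ∧ I (i + 1) s'')
    (hend : ∀ s', Same c.wregs c.warrs s s' → I N s' → f.eval s' ≤ e.eval s') :
    Wp (.whileLt e f c) s fun t s' => t ≤ (N + 1) * (T + e.cost + f.cost + 1) ∧ I N s' := by
  -- Induction on the number `k` of iterations that remain; the summand 1 in `k + 1` pays for the
  -- final test.
  have key : ∀ k i s', i + k = N → Same c.wregs c.warrs s s' → I i s' →
      Wp (.whileLt e f c) s' fun t s'' => t ≤ (k + 1) * (T + e.cost + f.cost + 1) ∧ I N s'' := by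
    intro k
    induction k with
    | zero =>
      intro i s' hi hs hI
      obtain rfl : i = N := by omega
      exact ⟨_, _, .whileFalse (hend s' hs hI), by ring_nf; omega, hI⟩
    | succ k ih =>
      intro i s' hi hs hI
      obtain ⟨hlt, t₁, s₁, hr, ht, hI'⟩ := hstep i s' (by omega) hs hI
      obtain ⟨t₂, s₂, hr₂, ht₂, hI₂⟩ := ih (i + 1) s₁ (by omega) (hs.trans hr.same) hI'
      refine ⟨_, _, .whileTrue hlt hr hr₂, ?_, hI₂⟩
      have : (k + 1 + 1) * (T + e.cost + f.cost + 1) =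
        (k + 1) * (T + e.cost + f.cost + 1) + (T + e.cost + f.cost + 1) := by ring
      omega
  exact key N 0 s (by omega) (Same.refl _ _ _) h0

end Machine

/-! ### Prices from cheapest covers -/

/-- The data of an instance as functions on natural numbers, the number `C` of slots of a record,
and a number `M` that exceeds the sum of all valuations. -/
structure Road where
  n : ℕ
  m : ℕ
  C : ℕ
  M : ℕ
  cap : ℕ → ℕ
  fst : ℕ → ℕ
  lst : ℕ → ℕ
  val : ℕ → ℕ

namespace Road

variable (X : Road)

/-- The agents in `T` cover the items in `S`. -/
def Covers (T S : Finset ℕ) : Prop := ∀ z ∈ S, ∃ i ∈ T, X.fst i ≤ z ∧ z ≤ X.lst i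

open Classical in
/-- The least total valuation of agents in `W` who cover `S`, or `M` if there is no cover. -/
noncomputable def price (W S : Finset ℕ) : ℕ :=
  W.powerset.inf' ⟨∅, Finset.empty_mem_powerset W⟩
    fun T => if X.Covers T S then ∑ i ∈ T, X.val i else X.M

/-- The items of agent `i`. -/
def seg (i : ℕ) : Finset ℕ := Finset.Icc (X.fst i) (X.lst i)

variable {X}

open Classical in
theorem price_le_sum {W S T : Finset ℕ} (hT : T ⊆ W) (h : X.Covers T S) :
    X.price W S ≤ ∑ i ∈ T, X.val i := by
  have := Finset.inf'_le (fun T => if X.Covers T S then ∑ i ∈ T, X.val i else X.M)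
    (Finset.mem_powerset.2 hT)
  simpa [price, h] using this

open Classical in
theorem price_le_base (W S : Finset ℕ) : X.price W S ≤ X.M := by
  by_cases h : X.Covers ∅ S
  · exact (price_le_sum (Finset.empty_subset W) h).trans (by simp)
  · have := Finset.inf'_le (fun T => if X.Covers T S then ∑ i ∈ T, X.val i else X.M)
      (Finset.empty_mem_powerset W)
    simpa [price, h] using this

open Classical in
theorem price_cases (W S : Finset ℕ) : X.price W S = X.M ∨
    ∃ T ⊆ W, X.Covers T S ∧ X.price W S = ∑ i ∈ T, X.val i := by
  obtain ⟨T, hT, h⟩ := Finset.exists_mem_eq_inf' ⟨∅, Finset.empty_mem_powerset W⟩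
    (fun T => if X.Covers T S then ∑ i ∈ T, X.val i else X.M)
  by_cases hc : X.Covers T S
  · exact Or.inr ⟨T, Finset.mem_powerset.1 hT, hc, h.trans (if_pos hc)⟩
  · exact Or.inl (h.trans (if_neg hc))

theorem price_empty (W : Finset ℕ) : X.price W ∅ = 0 := by
  have := price_le_sum (X := X) (Finset.empty_subset W) (S := ∅) (by simp [Covers])
  simpa using this

theorem price_mono (W : Finset ℕ) {S S' : Finset ℕ} (h : S ⊆ S') :
    X.price W S ≤ X.price W S' := by
  obtain hS | ⟨T, hT, hc, hS⟩ := price_cases (X := X) W S'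
  · rw [hS]
    exact price_le_base W S
  · rw [hS]
    exact price_le_sum hT fun z hz => hc z (h hz)

/-- Merge two cheapest covers; agents in both are paid once. If one of the sets has price `M`, the
bound is trivial because no price exceeds `M`. This is the source of the monotonicity of the
pricing. -/
theorem price_union_le (W S S' : Finset ℕ) :
    X.price W (S ∪ S') ≤ X.price W S + X.price W S' := by
  obtain hS | ⟨T, hT, hc, hS⟩ := price_cases (X := X) W S
  · rw [hS]
    exact (price_le_base W _).trans (Nat.le_add_right _ _)
  obtain hS' | ⟨T', hT', hc', hS'⟩ := price_cases (X := X) W S'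
  · rw [hS']
    exact (price_le_base W _).trans (Nat.le_add_left _ _)
  rw [hS, hS']
  refine (price_le_sum (Finset.union_subset hT hT') fun z hz => ?_).trans
    (Finset.sum_union_inter (f := X.val) (s₁ := T) (s₂ := T') ▸ Nat.le_add_right _ _)
  rcases Finset.mem_union.1 hz with hz | hz
  · obtain ⟨i, hi, h⟩ := hc z hz
    exact ⟨i, Finset.mem_union_left _ hi, h⟩
  · obtain ⟨i, hi, h⟩ := hc' z hz
    exact ⟨i, Finset.mem_union_right _ hi, h⟩

theorem price_biUnion_le {β : Type*} [DecidableEq β] (W : Finset ℕ) (T : Finset β)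
    (f : β → Finset ℕ) :
    X.price W (T.biUnion f) ≤ ∑ U ∈ T, X.price W (f U) := by
  induction T using Finset.induction_on with
  | empty => simp [price_empty]
  | insert U T hU ih =>
    rw [Finset.biUnion_insert, Finset.sum_insert hU]
    exact (price_union_le W _ _).trans (Nat.add_le_add_left ih _)

theorem price_seg_le {W : Finset ℕ} {i : ℕ} (hi : i ∈ W) : X.price W (X.seg i) ≤ X.val i := by
  have := price_le_sum (X := X) (T := {i}) (S := X.seg i) (Finset.singleton_subset_iff.2 hi)
    fun z hz => ⟨i, by simp, by simpa [seg] using hz⟩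
  simpa using this

/-! ### Sets of winners of largest value -/

variable (X) in
/-- Sets of winners with positive valuations that respect the capacities. -/
structure Feasible (W : Finset ℕ) : Prop where
  lt : ∀ i ∈ W, i < X.m
  pos : ∀ i ∈ W, 1 ≤ X.val i
  card_le : ∀ e < X.n, (W.filter fun i => X.fst i ≤ e ∧ e ≤ X.lst i).card ≤ X.cap e

variable (X) in
/-- The revenue, with ties broken by the total valuation of the winners. -/
noncomputable def worth (W : Finset ℕ) : ℕ :=
  X.M * ∑ i ∈ W, X.price W (X.seg i) + ∑ i ∈ W, X.val i

/-- A cover by the new winners that uses `j` becomes a cover by the old ones, at no greater cost,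
when `j` is replaced by `T`. -/
theorem price_exchange_le {W T : Finset ℕ} {j : ℕ} (hT : T ⊆ W)
    (hc : X.Covers T (X.seg j)) (hlt : ∑ i ∈ T, X.val i ≤ X.val j) (S : Finset ℕ) :
    X.price W S ≤ X.price (insert j (W \ T)) S := by
  obtain hS | ⟨T', hT', hc', hS⟩ := price_cases (X := X) (insert j (W \ T)) S
  · rw [hS]
    exact price_le_base W S
  rw [hS]
  by_cases hj : j ∈ T'
  · have h1 : T'.erase j ∪ T ⊆ W := by
      refine Finset.union_subset (fun i hi => ?_) hT
      have := hT' (Finset.mem_of_mem_erase hi)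
      rcases Finset.mem_insert.1 this with h | h
      · exact absurd h (Finset.ne_of_mem_erase hi)
      · exact (Finset.mem_sdiff.1 h).1
    refine (price_le_sum h1 fun z hz => ?_).trans ?_
    · obtain ⟨i, hi, h⟩ := hc' z hz
      by_cases hij : i = j
      · subst hij
        obtain ⟨i', hi', h'⟩ := hc z (by simpa [seg] using h)
        exact ⟨i', Finset.mem_union_right _ hi', h'⟩
      · exact ⟨i, Finset.mem_union_left _ (Finset.mem_erase.2 ⟨hij, hi⟩), h⟩
    · have h2 := Finset.sum_union_inter (f := X.val) (s₁ := T'.erase j) (s₂ := T)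
      have h3 := Finset.sum_erase_add T' X.val hj
      omega
  · refine price_le_sum (fun i hi => ?_) hc'
    rcases Finset.mem_insert.1 (hT' hi) with h | h
    · exact absurd (h ▸ hi) hj
    · exact (Finset.mem_sdiff.1 h).1

/-- In a set of winners of largest worth no loser would buy a cover of her interval. -/
theorem Feasible.val_le_price {W : Finset ℕ} (hW : X.Feasible W)
    (hM : ∑ i ∈ Finset.range X.m, X.val i < X.M)
    (hmax : ∀ W', X.Feasible W' → X.worth W' ≤ X.worth W) {j : ℕ} (hj : j < X.m) (hjW : j ∉ W) :
    X.val j ≤ X.price W (X.seg j) := by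
  by_contra! hlt
  have hvM : X.val j < X.M :=
    (Finset.single_le_sum (f := X.val) (fun _ _ => Nat.zero_le _) (Finset.mem_range.2 hj)).trans_lt
      hM
  obtain hS | ⟨T, hT, hc, hS⟩ := price_cases (X := X) W (X.seg j)
  · omega
  have hjT : j ∉ W \ T := fun h => hjW (Finset.mem_sdiff.1 h).1
  have hfeas : X.Feasible (insert j (W \ T)) := by
    refine ⟨fun i hi => ?_, fun i hi => ?_, fun e he => ?_⟩
    · rcases Finset.mem_insert.1 hi with rfl | h
      · exact hj
      · exact hW.lt i (Finset.mem_sdiff.1 h).1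
    · rcases Finset.mem_insert.1 hi with rfl | h
      · omega
      · exact hW.pos i (Finset.mem_sdiff.1 h).1
    · refine le_trans ?_ (hW.card_le e he)
      by_cases hje : X.fst j ≤ e ∧ e ≤ X.lst j
      -- Some member of `T` wants `e`, so the removal of `T` frees the copy that `j` takes.
      · obtain ⟨i, hi, hie⟩ := hc e (by simpa [seg] using hje)
        rw [Finset.filter_insert, if_pos hje]
        have h1 := Finset.card_insert_le j ((W \ T).filter fun i => X.fst i ≤ e ∧ e ≤ X.lst i)
        have h2 : ((W \ T).filter fun i => X.fst i ≤ e ∧ e ≤ X.lst i).card <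
            (W.filter fun i => X.fst i ≤ e ∧ e ≤ X.lst i).card := by
          refine Finset.card_lt_card (Finset.ssubset_iff_of_subset
            (Finset.filter_subset_filter _ Finset.sdiff_subset) |>.2 ⟨i, ?_, ?_⟩)
          · exact Finset.mem_filter.2 ⟨hT hi, hie⟩
          · simp [hi]
        omega
      · rw [Finset.filter_insert, if_neg hje]
        exact Finset.card_le_card (Finset.filter_subset_filter _ Finset.sdiff_subset)
  have hle := hmax _ hfeas
  have hprice := price_exchange_le hT hc (by omega : ∑ i ∈ T, X.val i ≤ X.val j)
  have h1 : ∑ i ∈ T, X.price W (X.seg i) ≤ ∑ i ∈ T, X.val i :=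
    Finset.sum_le_sum fun i hi => price_seg_le (hT hi)
  -- The members of `T` together paid at most their total valuation, which is the old price of the
  -- interval of `j`; she now pays at least that, and the others pay no less than before.
  have h2 : ∑ i ∈ W, X.price W (X.seg i) ≤
      ∑ i ∈ insert j (W \ T), X.price (insert j (W \ T)) (X.seg i) := by
    rw [Finset.sum_insert hjT, ← Finset.sum_sdiff hT, add_comm]
    exact add_le_add (h1.trans (hS ▸ hprice _)) (Finset.sum_le_sum fun i _ => hprice _)
  -- Here the tie-breaking term gives the strict increase that contradicts maximality.
  have h3 : ∑ i ∈ W, X.val i < ∑ i ∈ insert j (W \ T), X.val i := by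
    rw [Finset.sum_insert hjT, ← Finset.sum_sdiff hT]
    omega
  have := Nat.mul_le_mul_left X.M h2
  unfold worth at hle
  omega

/-- A set of winners of largest worth has the largest revenue. -/
theorem Feasible.sum_price_le {W W' : Finset ℕ} (hW : X.Feasible W)
    (hM : ∑ i ∈ Finset.range X.m, X.val i < X.M)
    (hmax : ∀ W', X.Feasible W' → X.worth W' ≤ X.worth W) (hW' : X.Feasible W') :
    ∑ i ∈ W', X.price W' (X.seg i) ≤ ∑ i ∈ W, X.price W (X.seg i) := by
  by_contra! hlt
  have h1 := hmax W' hW'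
  have h2 : ∑ i ∈ W, X.val i ≤ ∑ i ∈ Finset.range X.m, X.val i :=
    Finset.sum_le_sum_of_subset fun i hi => Finset.mem_range.2 (hW.lt i hi)
  -- One more unit of revenue adds `M` to the worth, which outweighs the total valuation of `W`.
  have h3 := Nat.mul_le_mul_left X.M (Nat.succ_le_of_lt hlt)
  unfold worth at h1
  rw [Nat.succ_eq_add_one, Nat.mul_add] at h3
  omega

end Road

/-! ### Optimality of cover prices among all multi envy free pricings -/

namespace Highway

variable {n m : ℕ}

/-- The road of an instance. -/
def road (I : Highway n m) (C M : ℕ) : Road where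
  n := n
  m := m
  C := C
  M := M
  cap := toArray I.cap
  fst := toArray fun i => (I.first i : ℕ)
  lst := toArray fun i => (I.last i : ℕ)
  val := toArray I.val

end Highway

@[simp] theorem toArray_coe {k : ℕ} (f : Fin k → ℕ) (j : Fin k) : toArray f j = f j := by
  simp [toArray]

namespace Highway

variable {n m : ℕ} (I : Highway n m) (C M : ℕ)

theorem map_bundle (i : Fin m) :
    (I.bundle i).map Fin.valEmbedding = (I.road C M).seg i := by
  simp [bundle, Road.seg, road]

theorem bundle_nonempty (i : Fin m) : (I.bundle i).Nonempty :=
  ⟨I.first i, Finset.mem_Icc.2 ⟨le_rfl, I.first_le_last i⟩⟩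

variable {I}

theorem valuation_le (i : Fin m) (S : Finset (Fin n)) : I.valuation i S ≤ I.val i := by
  unfold valuation
  split_ifs
  · exact le_rfl
  · positivity

theorem valuation_empty (i : Fin m) : I.valuation i ∅ = 0 := by
  have := (I.bundle_nonempty i).ne_empty
  simp [valuation, this]

theorem valuation_bundle (i : Fin m) : I.valuation i (I.bundle i) = I.val i := by
  simp [valuation]

theorem le_bestUtility (p : Finset (Fin n) → ℝ) (i : Fin m) (S : Finset (Fin n)) :
    I.valuation i S - p S ≤ bestUtility I.valuation p i :=
  Finset.le_sup' (fun S => I.valuation i S - p S) (Finset.mem_univ S)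

end Highway

theorem MonotonePricing.empty_nonpos {α : Type*} [DecidableEq α] {p : Finset α → ℝ}
    (hp : MonotonePricing p) : p ∅ ≤ 0 := by
  simpa using hp ∅ ∅ (by simp)

theorem MonotonePricing.mono {α : Type*} [DecidableEq α] {p : Finset α → ℝ}
    (hp : MonotonePricing p) {S S' : Finset α} (h : S ⊆ S') : p S ≤ p S' := by
  simpa using hp S {S'} (by simpa using h)

/-- The collection consisting of `∅` and `S` covers `∅`, so `p ∅ ≤ p ∅ + p S`. -/
theorem MonotonePricing.nonneg {α : Type*} [DecidableEq α] {p : Finset α → ℝ}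
    (hp : MonotonePricing p) {S : Finset α} (h : S.Nonempty) : 0 ≤ p S := by
  have h1 := hp S {∅, S} (by simp)
  have h2 : (∅ : Finset α) ≠ S := h.ne_empty.symm
  rw [Finset.sum_pair h2] at h1
  have h3 := hp ∅ {∅, S} (by simp)
  rw [Finset.sum_pair h2] at h3
  linarith

namespace Highway

variable {n m : ℕ} {I : Highway n m}

/-- The revenue of a multi envy free allocation/pricing is at most that of the prices that come
from its winners. -/
theorem exists_feasible_revenue_le (C M : ℕ) (hM : ∀ i, I.val i ≤ M)
    {a : Fin m → Finset (Fin n)} {p : Finset (Fin n) → ℝ} (hcap : RespectsCapacities I.cap a)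
    (h : MultiEnvyFree I.valuation a p) :
    ∃ W, (I.road C M).Feasible W ∧
      revenue a p ≤ (∑ i ∈ W, (I.road C M).price W ((I.road C M).seg i) : ℕ) := by
  obtain ⟨hef, hp⟩ := h
  have hz (i : Fin m) : 0 ≤ bestUtility I.valuation p i := by
    have := I.le_bestUtility p i ∅
    rw [valuation_empty] at this
    linarith [hp.empty_nonpos]
  have hbuy (i : Fin m) (hi : a i ≠ ∅) :
      I.valuation i (a i) - p (a i) = bestUtility I.valuation p i := by
    rcases (hz i).lt_or_eq with h | h
    · exact (hef i).1 h
    · exact ((hef i).2.1 h.symm).resolve_right hi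
  -- The winners who count. Any other agent with a nonempty set receives something of no value to
  -- her.
  set V : Finset (Fin m) := Finset.univ.filter fun i => I.bundle i ⊆ a i ∧ 1 ≤ I.val i with hV
  have hne {i : Fin m} (hi : i ∈ V) : a i ≠ ∅ := by
    have h1 := (Finset.mem_filter.1 hi).2.1
    exact ((I.bundle_nonempty i).mono h1).ne_empty
  have hprice {i : Fin m} (hi : i ∈ V) : p (I.bundle i) ≤ I.val i := by
    have h1 := hbuy i (hne hi)
    have h2 := hz i
    have h3 := I.valuation_le i (a i)
    have h4 := hp.mono (Finset.mem_filter.1 hi).2.1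
    linarith
  refine ⟨V.map Fin.valEmbedding, ⟨?_, ?_, ?_⟩, ?_⟩
  · intro i hi
    obtain ⟨i, -, rfl⟩ := Finset.mem_map.1 hi
    exact i.2
  · intro i hi
    obtain ⟨j, hj, rfl⟩ := Finset.mem_map.1 hi
    simpa [road] using (Finset.mem_filter.1 hj).2.2
  · intro e he
    refine le_trans ?_ ((hcap ⟨e, he⟩).trans_eq (by simp [road, toArray, show e < n from he]))
    rw [Finset.filter_map, Finset.card_map]
    refine Finset.card_le_card fun i hi => ?_
    simp only [road, Finset.mem_filter, Function.comp, Fin.valEmbedding_apply, toArray_coe] at hi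
    refine Finset.mem_filter.2 ⟨Finset.mem_univ _, ?_⟩
    exact (Finset.mem_filter.1 hi.1).2.1 (Finset.mem_Icc.2 ⟨hi.2.1, hi.2.2⟩)
  · have h1 : revenue a p ≤ ∑ i ∈ V, p (a i) := by
      have hVs : V ⊆ Finset.univ.filter fun i => a i ≠ ∅ := fun i hi =>
        Finset.mem_filter.2 ⟨Finset.mem_univ _, hne hi⟩
      rw [revenue, ← Finset.sum_sdiff hVs]
      -- A set of value 0 that yields a nonnegative utility has a nonpositive payment.
      have : ∑ i ∈ (Finset.univ.filter fun i => a i ≠ ∅) \ V, p (a i) ≤ 0 := by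
        refine Finset.sum_nonpos fun i hi => ?_
        obtain ⟨hi1, hi2⟩ := Finset.mem_sdiff.1 hi
        have hi3 := hbuy i (Finset.mem_filter.1 hi1).2
        have hi4 := hz i
        have : I.valuation i (a i) = 0 := by
          unfold valuation
          split_ifs with hb
          · have : ¬ 1 ≤ I.val i := fun hv => hi2 (Finset.mem_filter.2 ⟨Finset.mem_univ _, hb, hv⟩)
            have : I.val i = 0 := by omega
            simp [this]
          · rfl
        linarith
      linarith
    refine h1.trans ?_
    rw [Finset.sum_map]
    push_cast
    refine Finset.sum_le_sum fun i hi => ?_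
    -- Buying exactly the bundle would give the full valuation, so the set she prefers cannot cost
    -- more than the bundle.
    have h2 : p (a i) ≤ p (I.bundle i) := by
      have h3 := hbuy i (hne hi)
      have h4 := I.le_bestUtility p i (I.bundle i)
      rw [valuation_bundle] at h4
      linarith [I.valuation_le i (a i)]
    refine h2.trans ?_
    obtain hS | ⟨T, hT, hc, hS⟩ := Road.price_cases (X := I.road C M) (V.map Fin.valEmbedding)
      ((I.road C M).seg (Fin.valEmbedding i))
    · rw [hS]
      exact (hprice hi).trans (by exact_mod_cast hM i)
    · rw [hS]
      obtain ⟨T, hT', rfl⟩ := Finset.subset_map_iff.1 hT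
      have h5 : I.bundle i ⊆ (T.image I.bundle).biUnion id := by
        intro z hz
        obtain ⟨j, hj, hjz⟩ := hc z (by
          rw [Fin.valEmbedding_apply, ← map_bundle]
          exact Finset.mem_map_of_mem Fin.valEmbedding hz)
        obtain ⟨j, hjT, rfl⟩ := Finset.mem_map.1 hj
        simp only [road, Fin.valEmbedding_apply, toArray_coe] at hjz
        simp only [Finset.mem_biUnion, Finset.mem_image, id]
        exact ⟨_, ⟨j, hjT, rfl⟩, Finset.mem_Icc.2 hjz⟩
      -- Agents with the same interval are merged in the image; counting them separately only adds
      -- nonnegative prices.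
      have h6 : ∑ U ∈ T.image I.bundle, p U ≤ ∑ j ∈ T, p (I.bundle j) := by
        refine Finset.sum_image_le_of_nonneg fun U hU => ?_
        obtain ⟨j, -, rfl⟩ := Finset.mem_image.1 hU
        exact hp.nonneg (I.bundle_nonempty j)
      refine (hp _ _ h5).trans (h6.trans ?_)
      rw [Finset.sum_map]
      push_cast
      refine Finset.sum_le_sum fun j hj => ?_
      simpa [road] using hprice (hT' hj)

/-- A set of winners of largest worth, with the prices of the cheapest covers, is optimal. -/
theorem outputOptimal_of_worth_max {C M : ℕ} (hM : ∑ i ∈ Finset.range m, toArray I.val i < M)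
    {W : Finset ℕ} (hW : (I.road C M).Feasible W)
    (hmax : ∀ W', (I.road C M).Feasible W' → (I.road C M).worth W' ≤ (I.road C M).worth W)
    {s : State} (h4 : ∀ i < m, s.arr 4 i ≠ 0 ↔ i ∈ W)
    (h5 : ∀ i ∈ W, s.arr 5 i = (I.road C M).price W ((I.road C M).seg i)) :
    I.OutputOptimal s := by
  have hvM (i : Fin m) : I.val i ≤ M := by
    have := Finset.single_le_sum (f := toArray I.val) (fun _ _ => Nat.zero_le _)
      (Finset.mem_range.2 i.2)
    rw [toArray_coe] at this
    omega
  set p : Finset (Fin n) → ℝ := fun S => (I.road C M).price W (S.map Fin.valEmbedding) with hp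
  have hpb (i : Fin m) : p (I.bundle i) = (I.road C M).price W ((I.road C M).seg i) := by
    simp only [hp, map_bundle I C M]
  have hmono : MonotonePricing p := by
    intro S T hST
    simp only [hp]
    rw [← Nat.cast_sum, Nat.cast_le]
    refine le_trans (Road.price_mono W ?_) (Road.price_biUnion_le W T _)
    intro z hz
    obtain ⟨y, hy, rfl⟩ := Finset.mem_map.1 hz
    obtain ⟨U, hU, hzU⟩ := Finset.mem_biUnion.1 (hST hy)
    exact Finset.mem_biUnion.2 ⟨U, hU, Finset.mem_map_of_mem _ hzU⟩
  have ha (i : Fin m) : I.outputAllocation s i = if (i : ℕ) ∈ W then I.bundle i else ∅ := by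
    simp only [outputAllocation, h4 i i.2]
  have hne (i : Fin m) : I.outputAllocation s i ≠ ∅ ↔ (i : ℕ) ∈ W := by
    rw [ha]
    split_ifs with h
    · simp [h, (I.bundle_nonempty i).ne_empty]
    · simp [h]
  -- A set that contains the bundle costs at least as much as the bundle; any other set has no value
  -- to her and a nonnegative price.
  have hz (i : Fin m) : bestUtility I.valuation p i ≤ max 0 (I.val i - p (I.bundle i)) := by
    refine Finset.sup'_le _ _ fun S _ => ?_
    unfold valuation
    split_ifs with h
    · exact le_max_of_le_right (sub_le_sub_left (hmono.mono h) _)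
    · refine le_max_of_le_left ?_
      simp [hp]
  have hz0 (i : Fin m) : 0 ≤ bestUtility I.valuation p i := by
    have := I.le_bestUtility p i ∅
    rw [valuation_empty] at this
    linarith [hmono.empty_nonpos]
  have hrev : revenue (I.outputAllocation s) p =
      (∑ i ∈ W, (I.road C M).price W ((I.road C M).seg i) : ℕ) := by
    rw [revenue]
    simp only [hne]
    have : W = (Finset.univ.filter fun i : Fin m => (i : ℕ) ∈ W).map Fin.valEmbedding := by
      ext i
      simp only [Finset.mem_map, Finset.mem_filter, Finset.mem_univ, true_and,
        Fin.valEmbedding_apply]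
      exact ⟨fun h => ⟨⟨i, hW.lt i h⟩, h, rfl⟩, fun ⟨j, hj, hji⟩ => hji ▸ hj⟩
    conv_rhs => rw [this]
    rw [Finset.sum_map]
    push_cast
    refine Finset.sum_congr rfl fun i hi => ?_
    rw [ha, if_pos (Finset.mem_filter.1 hi).2, hpb, ← this]
    rfl
  refine ⟨p, fun i hi => ?_, ?_, ⟨fun i => ?_, hmono⟩, fun a' p' hcap' hmef' => ?_⟩
  · rw [hpb, h5 i ((h4 i i.2).1 hi)]
  · intro e
    refine le_trans (Finset.card_le_card_of_injOn (t := W.filter fun i =>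
      (I.road C M).fst i ≤ e ∧ e ≤ (I.road C M).lst i) (fun i => (i : ℕ)) ?_ ?_)
      ((hW.card_le e e.2).trans_eq (by simp [road]))
    · intro i hi
      have hi := (Finset.mem_filter.1 hi).2
      rw [ha] at hi
      split_ifs at hi with h
      · refine Finset.mem_coe.2 (Finset.mem_filter.2 ⟨h, ?_⟩)
        simpa [road] using Finset.mem_Icc.1 hi
      · simp at hi
    · intro i _ j _ hij
      exact Fin.ext hij
  · by_cases hi : (i : ℕ) ∈ W
    · have hle : p (I.bundle i) ≤ I.val i := by
        rw [hpb]
        have := Road.price_seg_le (X := I.road C M) hi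
        simp only [road, toArray_coe] at this ⊢
        exact_mod_cast this
      have hd : I.outputAllocation s i ∈ demand I.valuation p i := by
        rw [ha, if_pos hi]
        have h1 := hz i
        rw [max_eq_right (by linarith)] at h1
        have h2 := I.le_bestUtility p i (I.bundle i)
        rw [valuation_bundle] at h2
        show I.valuation i (I.bundle i) - p (I.bundle i) = _
        rw [valuation_bundle]
        linarith
      exact ⟨fun _ => hd, fun _ => Or.inl hd, fun h => absurd (hz0 i) (not_le.2 h)⟩
    · have hle : (I.val i : ℝ) ≤ p (I.bundle i) := by
        rw [hpb]
        have := hW.val_le_price hM hmax i.2 hi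
        simp only [road, toArray_coe] at this ⊢
        exact_mod_cast this
      have h1 := hz i
      rw [max_eq_left (by linarith)] at h1
      have : I.outputAllocation s i = ∅ := by rw [ha, if_neg hi]
      exact ⟨fun h => absurd h1 (not_le.2 h), fun _ => Or.inr this, fun _ => this⟩
  · obtain ⟨W', hW', hle⟩ := exists_feasible_revenue_le C M hvM hcap' hmef'
    rw [hrev]
    exact hle.trans (by exact_mod_cast hW.sum_price_le hM hmax hW')

end Highway

/-! ### Prices of prefixes of intervals -/

namespace Road

variable {X : Road}

theorem price_Ico_succ_le {W : Finset ℕ} {x e j : ℕ} (hj : j ∈ W)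
    (h2 : e ≤ X.lst j) :
    X.price W (Finset.Ico x (e + 1)) ≤ X.val j + X.price W (Finset.Ico x (X.fst j)) := by
  have h : Finset.Ico x (e + 1) ⊆ X.seg j ∪ Finset.Ico x (X.fst j) := by
    intro z hz
    simp only [seg, Finset.mem_union, Finset.mem_Icc, Finset.mem_Ico] at *
    omega
  exact (price_mono W h).trans
    ((price_union_le W _ _).trans (Nat.add_le_add_right (price_seg_le hj) _))

/-- Take from a cheapest cover a member `j` that contains `e`. The items before the first item of
`j` are covered by the others. Together with `price_Ico_succ_le` this is the recurrence behind the
dynamic program. -/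
theorem price_Ico_succ_cases (W : Finset ℕ) {x e : ℕ} (hx : x ≤ e) :
    X.price W (Finset.Ico x (e + 1)) = X.M ∨ ∃ j ∈ W, X.fst j ≤ e ∧ e ≤ X.lst j ∧
      X.val j + X.price W (Finset.Ico x (X.fst j)) ≤ X.price W (Finset.Ico x (e + 1)) := by
  obtain h | ⟨T, hT, hc, h⟩ := price_cases (X := X) W (Finset.Ico x (e + 1))
  · exact Or.inl h
  obtain ⟨j, hj, h1, h2⟩ := hc e (by simp [hx])
  refine Or.inr ⟨j, hT hj, h1, h2, ?_⟩
  rw [h, ← Finset.add_sum_erase T X.val hj]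
  refine Nat.add_le_add_left
    (price_le_sum ((Finset.erase_subset j T).trans hT) fun z hz => ?_) _
  have hz := Finset.mem_Ico.1 hz
  obtain ⟨i, hi, h3⟩ := hc z (Finset.mem_Ico.2 ⟨hz.1, by omega⟩)
  refine ⟨i, Finset.mem_erase.2 ⟨?_, hi⟩, h3⟩
  rintro rfl
  omega

/-- Positivity saves one possible value per entry when records are counted: `B` values instead of `B
+ 1`. -/
theorem one_le_price_Ico {W : Finset ℕ} (hM : 1 ≤ X.M) (hW : ∀ i ∈ W, 1 ≤ X.val i) {x e : ℕ}
    (hx : x < e) : 1 ≤ X.price W (Finset.Ico x e) := by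
  obtain ⟨e, rfl⟩ : ∃ y, e = y + 1 := ⟨e - 1, by omega⟩
  obtain h | ⟨j, hj, -, -, h⟩ := price_Ico_succ_cases (X := X) W (Nat.lt_succ_iff.1 hx)
  · omega
  · have := hW j hj
    omega

end Road

/-! ### Records -/

/-- The least of `v` and of the first entries of a row. -/
def rowMin (v : ℕ) (f : ℕ → ℕ) : ℕ → ℕ
  | 0 => v
  | t + 1 => min (rowMin v f t) (f t)

theorem le_rowMin_iff {v : ℕ} {f : ℕ → ℕ} {k x : ℕ} :
    x ≤ rowMin v f k ↔ x ≤ v ∧ ∀ t < k, x ≤ f t := by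
  induction k with
  | zero => simp [rowMin]
  | succ k ih =>
    rw [rowMin, le_min_iff, ih, and_assoc, Nat.forall_lt_succ_right]

theorem rowMin_congr {v : ℕ} {f g : ℕ → ℕ} {k : ℕ} (h : ∀ t < k, f t = g t) :
    rowMin v f k = rowMin v g k :=
  le_antisymm
    (le_rowMin_iff.2 ⟨(le_rowMin_iff.1 le_rfl).1,
      fun t ht => h t ht ▸ (le_rowMin_iff.1 le_rfl).2 t ht⟩)
    (le_rowMin_iff.2 ⟨(le_rowMin_iff.1 le_rfl).1,
      fun t ht => h t ht ▸ (le_rowMin_iff.1 le_rfl).2 t ht⟩)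

/-- The last of the first entries that is zero. -/
def lastZero (a : ℕ → ℕ) : ℕ → ℕ
  | 0 => 0
  | s + 1 => if a s = 0 then s else lastZero a s

theorem lastZero_spec {a : ℕ → ℕ} {k : ℕ} (h : ∃ s < k, a s = 0) :
    lastZero a k < k ∧ a (lastZero a k) = 0 := by
  induction k with
  | zero => simp at h
  | succ k ih =>
    rw [lastZero]
    split_ifs with hk
    · exact ⟨Nat.lt_succ_self k, hk⟩
    · obtain ⟨s, hs, hs0⟩ := h
      have : s ≠ k := fun h => hk (h ▸ hs0)
      have := ih ⟨s, by omega, hs0⟩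
      exact ⟨by omega, this.2⟩

/-- The number of the first entries that are nonzero. -/
def numPos (a : ℕ → ℕ) (k : ℕ) : ℕ := ∑ s ∈ Finset.range k, if a s = 0 then 0 else 1

theorem exists_eq_zero_of_numPos_lt {a : ℕ → ℕ} {k : ℕ} (h : numPos a k < k) :
    ∃ s < k, a s = 0 := by
  by_contra! hne
  have : numPos a k = k := by
    rw [numPos, Finset.sum_congr rfl fun s hs => if_neg (hne s (Finset.mem_range.1 hs))]
    simp
  omega

/-- A record: the agents (plus one) in the slots, for each of them the price of the items before
the current one, and for each two of them the price of the items up to the current one when the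
second of them comes last in the cover. All prices are truncated at the valuation of the agent. -/
structure Rec where
  ag : ℕ → ℕ
  g : ℕ → ℕ
  f : ℕ → ℕ → ℕ

namespace Road

variable (X : Road)

/-- The price of the items of the agent in slot `s` up to the current one. -/
def slotPrice (σ : Rec) (s : ℕ) : ℕ := rowMin (X.val (σ.ag s - 1)) (σ.f s) X.C

/-- The agent in slot `s` wants item `e`. -/
def Live (e : ℕ) (σ : Rec) (s : ℕ) : Prop := σ.ag s ≠ 0 ∧ e ≤ X.lst (σ.ag s - 1)

instance (e : ℕ) (σ : Rec) (s : ℕ) : Decidable (X.Live e σ s) :=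
  inferInstanceAs (Decidable (_ ∧ _))

/-- Proceed to item `e`. -/
def adv (e : ℕ) (σ : Rec) : Rec where
  ag s := if X.Live e σ s then σ.ag s else 0
  g s := if X.Live e σ s then X.slotPrice σ s else 0
  f s t := if X.Live e σ s then
    (if X.Live e σ t then σ.f s t else X.val (σ.ag s - 1)) else 0

/-- The agents that do not want item `e` pay. -/
def gain (e : ℕ) (σ : Rec) : ℕ :=
  ∑ s ∈ Finset.range X.C,
    if σ.ag s = 0 then 0 else if X.lst (σ.ag s - 1) < e then X.M * X.slotPrice σ s else 0

/-- Add agent `k` at her first item. -/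
def add (k : ℕ) (σ : Rec) : Rec where
  ag := Function.update σ.ag (lastZero σ.ag X.C) (k + 1)
  g := Function.update σ.g (lastZero σ.ag X.C) 0
  f s t :=
    if s = lastZero σ.ag X.C then
      (if σ.ag t = 0 then X.val k else min (X.val k) (X.val (σ.ag t - 1)))
    else if σ.ag s = 0 then 0
    else if t = lastZero σ.ag X.C then min (X.val (σ.ag s - 1)) (X.val k + σ.g s)
    else σ.f s t

/-- Decide on the agents below `k` with first item `e`; the second component is the value. -/
def addTo (W : Finset ℕ) (e : ℕ) (σ : Rec × ℕ) : ℕ → Rec × ℕ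
  | 0 => σ
  | k + 1 => if X.fst k = e ∧ k ∈ W then (X.add k (addTo W e σ k).1, (addTo W e σ k).2 + X.val k)
      else addTo W e σ k

/-- The record and the value of `W` at item `e` before the decisions at `e`. -/
def start (W : Finset ℕ) : ℕ → Rec × ℕ
  | 0 => (⟨fun _ => 0, fun _ => 0, fun _ _ => 0⟩, 0)
  | e + 1 => (X.adv (e + 1) (X.addTo W e (start W e) X.m).1,
      (X.addTo W e (start W e) X.m).2 + X.gain (e + 1) (X.addTo W e (start W e) X.m).1)

/-- The record and the value of `W` at item `e` when the agents below `k` are decided. -/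
def run (W : Finset ℕ) (e k : ℕ) : Rec × ℕ := X.addTo W e (X.start W e) k

/-- Agent `i` has been decided. -/
def Decided (e k i : ℕ) : Prop := X.fst i < e ∨ X.fst i = e ∧ i < k

instance (e k i : ℕ) : Decidable (X.Decided e k i) := inferInstanceAs (Decidable (_ ∨ _))

theorem run_succ (W : Finset ℕ) (e k : ℕ) : X.run W e (k + 1) =
    if X.fst k = e ∧ k ∈ W then (X.add k (X.run W e k).1, (X.run W e k).2 + X.val k)
      else X.run W e k := rfl

theorem run_zero (W : Finset ℕ) (e : ℕ) : X.run W (e + 1) 0 =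
    (X.adv (e + 1) (X.run W e X.m).1, (X.run W e X.m).2 + X.gain (e + 1) (X.run W e X.m).1) := rfl

/-- The sweep consults agents in the order of their first items, ties by number, so undecided agents
have had no influence yet. -/
theorem run_congr {W W' : Finset ℕ} {e k : ℕ} (h : ∀ i, X.Decided e k i → (i ∈ W ↔ i ∈ W')) :
    X.run W e k = X.run W' e k := by
  induction e generalizing k with
  | zero =>
    induction k with
    | zero => rfl
    | succ k ih =>
      have ih := ih fun i hi => h i (hi.imp_right fun hi => ⟨hi.1, by omega⟩)
      rw [run_succ, run_succ, ih]
      by_cases hk : X.fst k = 0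
      · simp [hk, h k (Or.inr ⟨hk, by omega⟩)]
      · simp [hk]
  | succ e ihe =>
    induction k with
    | zero =>
      rw [run_zero, run_zero, ihe fun i hi => h i (Or.inl (by rcases hi with hi | hi <;> omega))]
    | succ k ih =>
      have ih := ih fun i hi => h i (hi.imp_right fun hi => ⟨hi.1, by omega⟩)
      rw [run_succ, run_succ, ih]
      by_cases hk : X.fst k = e + 1
      · simp [hk, h k (Or.inr ⟨hk, by omega⟩)]
      · simp [hk]

/-- The winners that want item `e` and have been decided. -/
def active (W : Finset ℕ) (e k : ℕ) : Finset ℕ :=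
  W.filter fun i => X.Decided e k i ∧ e ≤ X.lst i

/-- The instance is sound. -/
structure Valid : Prop where
  le : ∀ i < X.m, X.fst i ≤ X.lst i
  lt : ∀ i < X.m, X.lst i < X.n
  sum_lt : X.m + ∑ i ∈ Finset.range X.m, X.val i < X.M

/-- The records describe the decided part of `W`. -/
structure Describes (W : Finset ℕ) (e k : ℕ) (σ : Rec) : Prop where
  inj : ∀ s < X.C, ∀ t < X.C, σ.ag s = σ.ag t → σ.ag s ≠ 0 → s = t
  surj : ∀ i ∈ X.active W e k, ∃ s < X.C, σ.ag s = i + 1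
  mem : ∀ s < X.C, ∀ i, σ.ag s = i + 1 → i ∈ X.active W e k
  g_zero : ∀ s < X.C, σ.ag s = 0 → σ.g s = 0
  f_zero : ∀ s < X.C, σ.ag s = 0 → ∀ t < X.C, σ.f s t = 0
  g_eq : ∀ s < X.C, ∀ i, σ.ag s = i + 1 →
    σ.g s = min (X.val i) (X.price W (Finset.Ico (X.fst i) e))
  f_empty : ∀ s < X.C, ∀ i, σ.ag s = i + 1 → ∀ t < X.C, σ.ag t = 0 → σ.f s t = X.val i
  f_eq : ∀ s < X.C, ∀ i, σ.ag s = i + 1 → ∀ t < X.C, ∀ j, σ.ag t = j + 1 →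
    σ.f s t = min (X.val i) (X.val j + X.price W (Finset.Ico (X.fst i) (X.fst j)))

/-- Winners with positive valuations, at most `C` of which want any of the items up to `e`. -/
structure Fits (W : Finset ℕ) (e : ℕ) : Prop where
  lt : ∀ i ∈ W, i < X.m
  pos : ∀ i ∈ W, 1 ≤ X.val i
  card_le : ∀ x ≤ e, (W.filter fun i => X.fst i ≤ x ∧ x ≤ X.lst i).card ≤ X.C

/-! ### Correctness of the records and of their values -/

variable {X}

theorem Fits.mono {W : Finset ℕ} {e e' : ℕ} (h : X.Fits W e) (he : e' ≤ e) : X.Fits W e' :=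
  ⟨h.lt, h.pos, fun x hx => h.card_le x (hx.trans he)⟩

theorem Valid.val_lt (hX : X.Valid) {i : ℕ} (hi : i < X.m) : X.val i < X.M := by
  have := Finset.single_le_sum (f := X.val) (fun _ _ => Nat.zero_le _) (Finset.mem_range.2 hi)
  have := hX.sum_lt
  omega

/-- The occupied slots are in bijection with the active winners. -/
theorem Describes.sum_eq {W : Finset ℕ} {e k : ℕ} {σ : Rec} (h : X.Describes W e k σ)
    (φ : ℕ → ℕ) :
    ∑ s ∈ Finset.range X.C, (if σ.ag s = 0 then 0 else φ (σ.ag s - 1)) =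
      ∑ i ∈ X.active W e k, φ i := by
  rw [← Finset.sum_filter_of_ne (p := fun s => σ.ag s ≠ 0)
    (fun s _ hs h0 => hs (by simp [h0]))]
  refine Finset.sum_nbij (fun s => σ.ag s - 1) ?_ ?_ ?_ ?_
  · intro s hs
    obtain ⟨h1, h2⟩ := Finset.mem_filter.1 hs
    exact h.mem s (Finset.mem_range.1 h1) _ (by omega)
  · intro s hs t ht hst
    obtain ⟨h1, h2⟩ := Finset.mem_filter.1 hs
    obtain ⟨h3, h4⟩ := Finset.mem_filter.1 ht
    exact h.inj s (Finset.mem_range.1 h1) t (Finset.mem_range.1 h3)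
      (by simp only at hst; omega) h2
  · intro i hi
    obtain ⟨s, hs, hsi⟩ := h.surj i hi
    exact ⟨s, by simp [hs, hsi], by simp [hsi]⟩
  · intro s hs
    rw [if_neg (Finset.mem_filter.1 hs).2]

theorem Describes.numPos_eq {W : Finset ℕ} {e k : ℕ} {σ : Rec} (h : X.Describes W e k σ) :
    numPos σ.ag X.C = (X.active W e k).card := by
  rw [numPos, h.sum_eq fun _ => 1, Finset.card_eq_sum_ones]

/-- Every winner who can be last in a cover up to `e` wants `e`, is decided by now, and so occupies
a slot; the row minimum thus runs over all candidates of the recurrence. If there is no cover the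
price `M` exceeds the valuation and the truncation hides it. -/
theorem Describes.slotPrice_eq {W : Finset ℕ} {e : ℕ} {σ : Rec} (h : X.Describes W e X.m σ)
    (hX : X.Valid) (hW : ∀ i ∈ W, i < X.m) {s : ℕ} (hs : s < X.C) {i : ℕ} (hi : σ.ag s = i + 1) :
    X.slotPrice σ s = min (X.val i) (X.price W (Finset.Ico (X.fst i) (e + 1))) := by
  have hact := Finset.mem_filter.1 (h.mem s hs i hi)
  have hfst : X.fst i ≤ e := by
    rcases hact.2.1 with h | h <;> omega
  have hle := le_rowMin_iff.1 (le_refl (X.slotPrice σ s))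
  simp only [hi, Nat.add_sub_cancel] at hle
  refine le_antisymm (le_min hle.1 ?_) ?_
  · obtain hp | ⟨j, hj, h1, h2, h3⟩ := price_Ico_succ_cases (X := X) W hfst
    · rw [hp]
      exact hle.1.trans (hX.val_lt (hW i hact.1)).le
    · refine le_trans ?_ h3
      obtain ⟨t, ht, htj⟩ := h.surj j (Finset.mem_filter.2
        ⟨hj, h1.lt_or_eq.imp_right fun h => ⟨h, hW j hj⟩, h2⟩)
      have := hle.2 t ht
      rw [h.f_eq s hs i hi t ht j htj] at this
      exact this.trans (min_le_right _ _)
  · rw [slotPrice, le_rowMin_iff, hi, Nat.add_sub_cancel]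
    refine ⟨min_le_left _ _, fun t ht => ?_⟩
    rcases Nat.eq_zero_or_eq_succ_pred (σ.ag t) with h0 | h0
    · rw [h.f_empty s hs i hi t ht h0]
      exact min_le_left _ _
    · rw [h.f_eq s hs i hi t ht _ h0]
      have hj := Finset.mem_filter.1 (h.mem t ht _ h0)
      exact min_le_min_left _ (price_Ico_succ_le hj.1 hj.2.2)

theorem describes_start (W : Finset ℕ) : X.Describes W 0 0 (X.run W 0 0).1 := by
  constructor <;> simp [run, addTo, start, active, Decided]

/-- A matrix entry concerns the items between two first items and does not depend on the current
item, so it survives. Columns of agents who leave are reset to the valuation, which is neutral in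
the row minimum. -/
theorem Describes.adv {W : Finset ℕ} {e : ℕ} {σ : Rec} (h : X.Describes W e X.m σ)
    (hX : X.Valid) (hW : ∀ i ∈ W, i < X.m) :
    X.Describes W (e + 1) 0 (X.adv (e + 1) σ) := by
  have hag {s i : ℕ} : (X.adv (e + 1) σ).ag s = i + 1 ↔
      X.Live (e + 1) σ s ∧ σ.ag s = i + 1 := by
    simp only [Road.adv]
    split_ifs with hl <;> simp [hl]
  have hag0 {s : ℕ} : (X.adv (e + 1) σ).ag s = 0 ↔ ¬ X.Live (e + 1) σ s := by
    simp only [Road.adv]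
    split_ifs with hl
    · simp [hl, hl.1]
    · simp [hl]
  refine ⟨?_, ?_, ?_, ?_, ?_, ?_, ?_, ?_⟩
  · intro s hs t ht hst h0
    obtain ⟨i, hi⟩ := Nat.exists_eq_succ_of_ne_zero h0
    have h1 := hag.1 hi
    have h2 := hag.1 (hst ▸ hi)
    exact h.inj s hs t ht (h1.2.trans h2.2.symm) (by simp [h1.2])
  · intro i hi
    have hi := Finset.mem_filter.1 hi
    have h1 : X.Decided e X.m i := by
      rcases hi.2.1 with h | h
      · exact (Nat.lt_succ_iff.1 h).lt_or_eq.imp_right fun h => ⟨h, hW i hi.1⟩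
      · omega
    obtain ⟨s, hs, hsi⟩ := h.surj i (Finset.mem_filter.2 ⟨hi.1, h1, by omega⟩)
    exact ⟨s, hs, hag.2 ⟨⟨by omega, by simpa [hsi] using hi.2.2⟩, hsi⟩⟩
  · intro s hs i hi
    obtain ⟨h1, h2⟩ := hag.1 hi
    have h3 := Finset.mem_filter.1 (h.mem s hs i h2)
    refine Finset.mem_filter.2 ⟨h3.1, Or.inl ?_, by simpa [h2] using h1.2⟩
    rcases h3.2.1 with h | h <;> omega
  · intro s _ h0
    simp [Road.adv, hag0.1 h0]
  · intro s _ h0 t _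
    simp [Road.adv, hag0.1 h0]
  · intro s hs i hi
    obtain ⟨h1, h2⟩ := hag.1 hi
    simp only [Road.adv, if_pos h1]
    exact h.slotPrice_eq hX hW hs h2
  · intro s _ i hi t _ h0
    obtain ⟨h1, h2⟩ := hag.1 hi
    simp [Road.adv, if_pos h1, hag0.1 h0, h2]
  · intro s hs i hi t ht j hj
    obtain ⟨h1, h2⟩ := hag.1 hi
    obtain ⟨h3, h4⟩ := hag.1 hj
    simp only [Road.adv, if_pos h1, if_pos h3]
    exact h.f_eq s hs i h2 t ht j h4

theorem active_succ (hX : X.Valid) {W : Finset ℕ} {e k : ℕ} (hk : X.fst k = e) (hkW : k ∈ W)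
    (hkm : k < X.m) : X.active W e (k + 1) = insert k (X.active W e k) := by
  have := hX.le k hkm
  ext i
  simp only [active, Finset.mem_filter, Finset.mem_insert]
  unfold Decided
  constructor
  · rintro ⟨h1, h2, h3⟩
    by_cases hik : i = k
    · exact Or.inl hik
    · exact Or.inr ⟨h1, h2.imp_right fun h => ⟨h.1, by omega⟩, h3⟩
  · rintro (rfl | ⟨h1, h2, h3⟩)
    · exact ⟨hkW, Or.inr ⟨hk, by omega⟩, by omega⟩
    · exact ⟨h1, h2.imp_right fun h => ⟨h.1, by omega⟩, h3⟩

theorem active_succ_of_not {W : Finset ℕ} {e k : ℕ} (hk : ¬ (X.fst k = e ∧ k ∈ W)) :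
    X.active W e (k + 1) = X.active W e k := by
  ext i
  simp only [active, Finset.mem_filter]
  unfold Decided
  refine and_congr_right fun hi => and_congr_left fun _ => or_congr_right <|
    and_congr_right fun hie => ⟨fun h => ?_, fun h => by omega⟩
  have : i ≠ k := by
    rintro rfl
    exact hk ⟨hie, hi⟩
  omega

theorem Describes.of_not {W : Finset ℕ} {e k : ℕ} {σ : Rec} (h : X.Describes W e k σ)
    (hk : ¬ (X.fst k = e ∧ k ∈ W)) : X.Describes W e (k + 1) σ := by
  have ha := active_succ_of_not hk
  exact ⟨h.inj, ha ▸ h.surj, ha ▸ h.mem, h.g_zero, h.f_zero, h.g_eq, h.f_empty, h.f_eq⟩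

theorem active_subset (W : Finset ℕ) (e k : ℕ) :
    X.active W e k ⊆ W.filter fun i => X.fst i ≤ e ∧ e ≤ X.lst i := by
  intro i hi
  simp only [active, Finset.mem_filter] at *
  unfold Decided at hi
  exact ⟨hi.1, by omega, by omega⟩

theorem not_mem_active (W : Finset ℕ) {e k : ℕ} (hk : X.fst k = e) : k ∉ X.active W e k := by
  simp only [active, Finset.mem_filter]
  unfold Decided
  omega

/-- Agent `k` wants `e` herself but is not yet decided, which leaves room for her. -/
theorem active_card_lt (hX : X.Valid) {W : Finset ℕ} {e k : ℕ} (hk : X.fst k = e) (hkW : k ∈ W)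
    (hkm : k < X.m) :
    (X.active W e k).card < (W.filter fun i => X.fst i ≤ e ∧ e ≤ X.lst i).card := by
  have h1 := Finset.card_le_card (active_subset (X := X) W e (k + 1))
  rw [active_succ hX hk hkW hkm, Finset.card_insert_of_notMem (not_mem_active W hk)] at h1
  omega

/-- At her first item `k` has no earlier items, so her own row needs only valuations. As last member
of a cover for another agent she costs her valuation plus the price `g` of that agent's items before
`e`. -/
theorem Describes.add {W : Finset ℕ} {e k : ℕ} {σ : Rec} (h : X.Describes W e k σ)
    (hX : X.Valid) (hW : X.Fits W e) (hk : X.fst k = e) (hkW : k ∈ W) :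
    X.Describes W e (k + 1) (X.add k σ) := by
  have hkm := hW.lt k hkW
  have hnum := active_card_lt hX hk hkW hkm
  have hcard := hW.card_le e le_rfl
  rw [← h.numPos_eq] at hnum
  obtain ⟨hu, hu0⟩ := lastZero_spec (exists_eq_zero_of_numPos_lt (hnum.trans_le hcard))
  have hact := active_succ hX hk hkW hkm
  set u := lastZero σ.ag X.C with hudef
  have hagu : (X.add k σ).ag u = k + 1 := by simp [Road.add, ← hudef]
  have hag {s : ℕ} (hs : s ≠ u) : (X.add k σ).ag s = σ.ag s := by
    simp [Road.add, ← hudef, hs]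
  have hg {s : ℕ} (hs : s ≠ u) : (X.add k σ).g s = σ.g s := by
    simp [Road.add, ← hudef, hs]
  have hne {s : ℕ} (hs : s < X.C) : σ.ag s ≠ k + 1 := fun h0 =>
    not_mem_active W hk (h.mem s hs k h0)
  have hfst {t j : ℕ} (ht : t < X.C) (hj : σ.ag t = j + 1) : X.fst j ≤ e := by
    have := (Finset.mem_filter.1 (active_subset W e k (h.mem t ht j hj))).2.1
    exact this
  refine ⟨?_, ?_, ?_, ?_, ?_, ?_, ?_, ?_⟩
  · intro s hs t ht hst h0
    by_cases hsu : s = u <;> by_cases htu : t = u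
    · rw [hsu, htu]
    · rw [hsu, hagu, hag htu] at hst
      exact absurd hst.symm (hne ht)
    · rw [htu, hagu, hag hsu] at hst
      exact absurd hst (hne hs)
    · rw [hag hsu, hag htu] at hst
      rw [hag hsu] at h0
      exact h.inj s hs t ht hst h0
  · intro i hi
    rw [hact] at hi
    rcases Finset.mem_insert.1 hi with rfl | hi
    · exact ⟨u, hu, hagu⟩
    · obtain ⟨s, hs, hsi⟩ := h.surj i hi
      have hsu : s ≠ u := by
        rintro rfl
        omega
      exact ⟨s, hs, by rw [hag hsu, hsi]⟩
  · intro s hs i hi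
    rw [hact]
    by_cases hsu : s = u
    · rw [hsu, hagu] at hi
      exact Finset.mem_insert.2 (Or.inl (by omega))
    · rw [hag hsu] at hi
      exact Finset.mem_insert.2 (Or.inr (h.mem s hs i hi))
  · intro s hs h0
    by_cases hsu : s = u
    · rw [hsu, hagu] at h0
      omega
    · rw [hag hsu] at h0
      rw [hg hsu, h.g_zero s hs h0]
  · intro s hs h0 t _
    by_cases hsu : s = u
    · rw [hsu, hagu] at h0
      omega
    · rw [hag hsu] at h0
      simp [Road.add, ← hudef, hsu, h0]
  · intro s hs i hi
    by_cases hsu : s = u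
    · subst hsu
      rw [hagu] at hi
      obtain rfl : k = i := by omega
      simp [Road.add, ← hudef, hk, price_empty]
    · rw [hag hsu] at hi
      rw [hg hsu, h.g_eq s hs i hi]
  · intro s hs i hi t ht h0
    by_cases htu : t = u
    · rw [htu, hagu] at h0
      omega
    rw [hag htu] at h0
    by_cases hsu : s = u
    · rw [hsu, hagu] at hi
      obtain rfl : k = i := by omega
      simp [Road.add, ← hudef, hsu, h0]
    · rw [hag hsu] at hi
      simp [Road.add, ← hudef, hsu, htu, hi, h.f_empty s hs i hi t ht h0]
  · intro s hs i hi t ht j hj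
    by_cases hsu : s = u
    · rw [hsu, hagu] at hi
      obtain rfl : k = i := by omega
      by_cases htu : t = u
      · rw [htu, hagu] at hj
        obtain rfl : k = j := by omega
        -- The diagonal entry falls under the branch for an empty slot, because slot `u` was empty
        -- before.
        simp [Road.add, ← hudef, hsu, htu, hu0]
      · rw [hag htu] at hj
        -- Agents decided earlier start no later than `k`.
        have : Finset.Ico (X.fst k) (X.fst j) = ∅ := Finset.Ico_eq_empty (by
          have := hfst ht hj
          omega)
        simp [Road.add, ← hudef, hsu, hj, this, price_empty]
    · rw [hag hsu] at hi
      by_cases htu : t = u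
      · rw [htu, hagu] at hj
        obtain rfl : k = j := by omega
        simp only [Road.add, ← hudef, hsu, htu, hi, if_true, if_false, Nat.add_sub_cancel,
          h.g_eq s hs i hi, hk, Nat.succ_ne_zero]
        -- The entry `g` is already truncated at the valuation of `i`; since the sum is truncated at
        -- the same number again, nothing is lost.
        rcases le_total (X.val i) (X.price W (Finset.Ico (X.fst i) e)) with h1 | h1
        · rw [min_eq_left h1, min_eq_left (by omega), min_eq_left (by omega)]
        · rw [min_eq_right h1]
      · rw [hag htu] at hj
        simp only [Road.add, ← hudef, hsu, htu, hi, if_false, Nat.succ_ne_zero]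
        exact h.f_eq s hs i hi t ht j hj

theorem describes_run (hX : X.Valid) {W : Finset ℕ} {e : ℕ} (hW : X.Fits W e) (k : ℕ) :
    X.Describes W e k (X.run W e k).1 := by
  have step {e : ℕ} (hW : X.Fits W e) (h0 : X.Describes W e 0 (X.run W e 0).1) (k : ℕ) :
      X.Describes W e k (X.run W e k).1 := by
    induction k with
    | zero => exact h0
    | succ k ih =>
      rw [run_succ]
      split_ifs with hk
      · exact ih.add hX hW hk.1 hk.2
      · exact ih.of_not hk
  induction e generalizing k with
  | zero => exact step hW (describes_start W) k
  | succ e ihe => exact step hW ((ihe (hW.mono (Nat.le_succ e)) X.m).adv hX hW.lt) k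

/-- The agents who leave after item `e` are those with last item `e`; for them the prefix up to `e`
is the whole interval, and truncation is void because a winner's price is at most her valuation. -/
theorem gain_eq (hX : X.Valid) {W : Finset ℕ} {e : ℕ} (hW : X.Fits W e) :
    X.gain (e + 1) (X.run W e X.m).1 =
      X.M * ∑ i ∈ W.filter fun i => X.lst i = e, X.price W (X.seg i) := by
  have h := describes_run hX hW X.m
  set σ := (X.run W e X.m).1
  have h1 : X.gain (e + 1) σ = ∑ s ∈ Finset.range X.C, (if σ.ag s = 0 then 0 else
      (fun i => if X.lst i < e + 1 then
        X.M * min (X.val i) (X.price W (Finset.Ico (X.fst i) (e + 1))) else 0) (σ.ag s - 1)) := by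
    refine Finset.sum_congr rfl fun s hs => ?_
    split_ifs with h0 h1
    · rfl
    · simp only [if_pos h1]
      rw [h.slotPrice_eq hX hW.lt (Finset.mem_range.1 hs) (i := σ.ag s - 1) (by omega)]
    · simp only [if_neg h1]
  rw [h1, h.sum_eq fun i => if X.lst i < e + 1 then
    X.M * min (X.val i) (X.price W (Finset.Ico (X.fst i) (e + 1))) else 0,
    ← Finset.sum_filter, Finset.mul_sum]
  refine Finset.sum_congr ?_ fun i hi => ?_
  · ext i
    simp only [active, Finset.mem_filter]
    unfold Decided
    constructor
    · rintro ⟨⟨h1, h2, h3⟩, h4⟩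
      exact ⟨h1, by omega⟩
    · rintro ⟨h1, h2⟩
      have := hX.le i (hW.lt i h1)
      have := hW.lt i h1
      exact ⟨⟨h1, by omega, by omega⟩, by omega⟩
  · obtain ⟨hi, hie⟩ := Finset.mem_filter.1 hi
    have h2 : Finset.Ico (X.fst i) (e + 1) = X.seg i := by
      ext z
      simp only [seg, Finset.mem_Ico, Finset.mem_Icc]
      omega
    rw [h2, min_eq_right (price_seg_le hi)]

/-- Valuations are credited on entry and payments, weighted by `M`, on exit. Past the last item both
have been credited for every winner, which gives the worth. -/
theorem run_snd (hX : X.Valid) {W : Finset ℕ} {e : ℕ} (hW : X.Fits W e) (k : ℕ) :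
    (X.run W e k).2 = X.M * ∑ i ∈ W.filter fun i => X.lst i < e, X.price W (X.seg i) +
      ∑ i ∈ W.filter fun i => X.Decided e k i, X.val i := by
  have step {e : ℕ} (h0 : (X.run W e 0).2 =
      X.M * ∑ i ∈ W.filter fun i => X.lst i < e, X.price W (X.seg i) +
      ∑ i ∈ W.filter fun i => X.Decided e 0 i, X.val i) (k : ℕ) : (X.run W e k).2 =
      X.M * ∑ i ∈ W.filter fun i => X.lst i < e, X.price W (X.seg i) +
      ∑ i ∈ W.filter fun i => X.Decided e k i, X.val i := by
    induction k with
    | zero => exact h0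
    | succ k ih =>
      rw [run_succ]
      split_ifs with hk
      · have : (W.filter fun i => X.Decided e (k + 1) i) =
            insert k (W.filter fun i => X.Decided e k i) := by
          ext i
          simp only [Finset.mem_filter, Finset.mem_insert]
          unfold Decided
          constructor
          · rintro ⟨h1, h2⟩
            by_cases hik : i = k
            · exact Or.inl hik
            · exact Or.inr ⟨h1, by omega⟩
          · rintro (rfl | ⟨h1, h2⟩)
            · exact ⟨hk.2, by omega⟩
            · exact ⟨h1, by omega⟩
        rw [this, Finset.sum_insert (fun h => by
          have := (Finset.mem_filter.1 h).2
          unfold Decided at this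
          omega)]
        simp only [ih]
        ring
      · rw [ih]
        congr 2
        ext i
        simp only [Finset.mem_filter]
        unfold Decided
        refine and_congr_right fun hi => ⟨fun h => by omega, fun h => ?_⟩
        have : i = k → X.fst i ≠ e := by
          rintro rfl hie
          exact hk ⟨hie, hi⟩
        omega
  induction e generalizing k with
  | zero => exact step (by simp [run, addTo, start, Decided]) k
  | succ e ihe =>
    refine step ?_ k
    have hWe := hW.mono (Nat.le_succ e)
    rw [run_zero]
    simp only [ihe hWe X.m, gain_eq hX hWe]
    have h1 : (W.filter fun i => X.lst i < e + 1) =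
        (W.filter fun i => X.lst i < e) ∪ (W.filter fun i => X.lst i = e) := by
      ext i
      simp only [Finset.mem_filter, Finset.mem_union, ← and_or_left]
      exact and_congr_right fun _ => by omega
    have h2 : (W.filter fun i => X.Decided e X.m i) = W.filter fun i => X.Decided (e + 1) 0 i := by
      ext i
      simp only [Finset.mem_filter]
      unfold Decided
      refine and_congr_right fun hi => ?_
      have := hW.lt i hi
      omega
    rw [h1, h2, Finset.sum_union]
    · ring
    · refine Finset.disjoint_filter.2 fun i _ h => by omega

theorem run_snd_eq_worth (hX : X.Valid) {W : Finset ℕ} (hW : X.Fits W X.n) :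
    (X.run W X.n 0).2 = X.worth W := by
  rw [run_snd hX hW, worth, Finset.filter_true_of_mem, Finset.filter_true_of_mem]
  · intro i hi
    have h1 := hX.le i (hW.lt i hi)
    have h2 := hX.lt i (hW.lt i hi)
    exact Or.inl (by omega)
  · exact fun i hi => hX.lt i (hW.lt i hi)

end Road

open RExpr RProg

local infixl:65 " +ᵣ " => RExpr.plus
local infixl:65 " -ᵣ " => RExpr.minus
local infixr:50 " ;; " => RProg.seq
local infix:55 " ::= " => RProg.set

/-! ### The programs for a single record

Registers: `2` number of slots `C`, `3` base `M`, `4` size `C * C` of a record, `5` size of the key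
space, `6` offset of the keys, `7` item, `8` and `9` begin and end of the list of records, `10`
source record, `11` target record, `12` agent, `13`, `14` slots, `17`, `18` positions in the two
records, `19` gain and value, `20` number of agents, `21` key, `24` empty slot.
Arrays: `6`, `7`, `8` records, `9` values, `10` predecessors, `11` the products of digits with
powers of `M`, `12` records by key. -/

/-- The record at position `b`. -/
def recAt (C : ℕ) (s : State) (b : ℕ) : Rec where
  ag x := s.arr 6 (b + x)
  g x := s.arr 7 (b + x)
  f x y := s.arr 8 (b + (x * C + y))

/-- The records have the same entries in the first `C` slots. -/
structure Rec.Agree (C : ℕ) (σ τ : Rec) : Prop where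
  ag : ∀ x < C, σ.ag x = τ.ag x
  g : ∀ x < C, σ.g x = τ.g x
  f : ∀ x < C, ∀ y < C, σ.f x y = τ.f x y

/-- The data of the instance are in place. -/
structure Loaded (X : Road) (s : State) : Prop where
  n : s.reg 0 = X.n
  m : s.reg 1 = X.m
  C : s.reg 2 = X.C
  M : s.reg 3 = X.M
  D : s.reg 4 = X.C * X.C
  step : s.reg 5 = X.M ^ (X.C + X.C + X.C * X.C)
  cap : s.arr 0 = X.cap
  fst : s.arr 1 = X.fst
  lst : s.arr 2 = X.lst
  val : s.arr 3 = X.val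
  tab : ∀ q < X.C + X.C + X.C * X.C, ∀ d < X.M, s.arr 11 (q * X.M + d) = d * X.M ^ q

/-- Once prepared, the registers below 6, the input arrays and the table in array 11 are never
written again. -/
theorem Loaded.same {X : Road} {s s' : State} {R A : List ℕ} (h : Loaded X s)
    (hs : Same R A s s') (hR : ∀ x ∈ R, 6 ≤ x) (hA : ∀ b ∈ A, 4 ≤ b ∧ b ≠ 11) : Loaded X s' := by
  have hr {x : ℕ} (hx : x < 6) : s'.reg x = s.reg x := hs.1 x fun h => by
    have := hR x h
    omega
  have ha {b : ℕ} (hb : b < 4 ∨ b = 11) : s'.arr b = s.arr b := hs.2 b fun h => by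
    have := hA b h
    omega
  exact ⟨(hr (by omega)).trans h.n, (hr (by omega)).trans h.m, (hr (by omega)).trans h.C,
    (hr (by omega)).trans h.M, (hr (by omega)).trans h.D, (hr (by omega)).trans h.step,
    (ha (by omega)).trans h.cap, (ha (by omega)).trans h.fst, (ha (by omega)).trans h.lst,
    (ha (by omega)).trans h.val, fun q hq d hd => by rw [ha (by omega), h.tab q hq d hd]⟩

/-- Register `16` gets the price of the slot with agent `reg 15 - 1` and row `reg 17`. -/
def rowMinP : RProg :=
  16 ::= get 3 (var 15 -ᵣ lit 1) ;;
  14 ::= lit 0 ;;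
  whileLt (var 14) (var 2) (
    23 ::= get 8 (var 17 +ᵣ var 14) ;;
    ifLe (var 16) (var 23) skip (16 ::= var 23) ;;
    14 ::= var 14 +ᵣ lit 1)

theorem rowMinP_spec (s : State) : Wp rowMinP s fun t s' => t ≤ 30 * (s.reg 2 + 1) ∧
    s'.reg 16 = rowMin (s.arr 3 (s.reg 15 - 1)) (fun t => s.arr 8 (s.reg 17 + t)) (s.reg 2) := by
  simp only [rowMinP, wp_seq, wp_set]
  refine (wp_while (fun i s' => s'.reg 14 = i ∧ s'.reg 16 =
    rowMin (s.arr 3 (s.reg 15 - 1)) (fun t => s.arr 8 (s.reg 17 + t)) i) (s.reg 2) 20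
    ?_ ?_ ?_).imp ?_
  · simp [RExpr.eval, rowMin]
  · rintro i s' hi ⟨hr, ha⟩ ⟨h1, h2⟩
    simp [RProg.wregs, RProg.warrs] at hr ha
    simp [wp_seq, wp_set, wp_ifLe, wp_skip, RExpr.eval, RExpr.cost, hr, ha, h1, h2, hi, rowMin]
    omega
  · rintro s' ⟨hr, ha⟩ ⟨h1, h2⟩
    simp [RProg.wregs, RProg.warrs] at hr ha
    simp [RExpr.eval, hr, h1]
  · rintro t s' - ⟨ht, h1, h2⟩
    simp [RExpr.cost] at *
    exact ⟨by omega, h2⟩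

theorem rowMinP_wregs : rowMinP.wregs = [16, 14, 23, 16, 14] := rfl

theorem rowMinP_warrs : rowMinP.warrs = [] := rfl

/-- Proceed to item `reg 7`: agents, prices, gain and number of agents. -/
def advRowsP : RProg :=
  13 ::= lit 0 ;; 17 ::= var 10 ;; 19 ::= lit 0 ;; 20 ::= lit 0 ;;
  whileLt (var 13) (var 2) (
    15 ::= get 6 (var 10 +ᵣ var 13) ;;
    put 6 (var 11 +ᵣ var 13) (lit 0) ;;
    put 7 (var 11 +ᵣ var 13) (lit 0) ;;
    ifLe (lit 1) (var 15) (
      rowMinP ;;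
      ifLe (var 7) (get 2 (var 15 -ᵣ lit 1)) (
        put 6 (var 11 +ᵣ var 13) (var 15) ;;
        put 7 (var 11 +ᵣ var 13) (var 16) ;;
        20 ::= var 20 +ᵣ lit 1)
        (19 ::= var 19 +ᵣ get 11 (var 3 +ᵣ var 16)))
      skip ;;
    17 ::= var 17 +ᵣ var 2 ;;
    13 ::= var 13 +ᵣ lit 1)

theorem advRowsP_wregs : advRowsP.wregs =
    [13, 17, 19, 20, 15, 16, 14, 23, 16, 14, 20, 19, 17, 13] := rfl

theorem advRowsP_warrs : advRowsP.warrs = [6, 7, 6, 7] := rfl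

theorem forall_lt_update {a : ℕ → ℕ} {φ : ℕ → ℕ} {h i v : ℕ} (ha : ∀ x < i, a (h + x) = φ x)
    (hv : v = φ i) : ∀ x < i + 1, Function.update a (h + i) v (h + x) = φ x := by
  intro x hx
  by_cases hxi : x = i
  · rw [hxi, Function.update_self, hv]
  · rw [Function.update_of_ne (by omega)]
    exact ha x (by omega)

theorem forall_below_update {a a₀ : ℕ → ℕ} {h j v : ℕ} (ha : ∀ p < h, a p = a₀ p) (hj : h ≤ j) :
    ∀ p < h, Function.update a j v p = a₀ p := fun p hp => by
  rw [Function.update_of_ne (by omega)]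
  exact ha p hp

theorem advRowsP_spec {X : Road} {s : State} (hL : Loaded X s) (hC : 1 ≤ X.C)
    (hbh : s.reg 10 + X.C * X.C ≤ s.reg 11)
    (hval : ∀ x < X.C, s.arr 6 (s.reg 10 + x) ≠ 0 → X.val (s.arr 6 (s.reg 10 + x) - 1) < X.M) :
    Wp advRowsP s fun t s' => t ≤ 300 * (X.C * X.C) ∧
      s'.reg 19 = X.gain (s.reg 7) (recAt X.C s (s.reg 10)) ∧
      s'.reg 20 = numPos (X.adv (s.reg 7) (recAt X.C s (s.reg 10))).ag X.C ∧
      (∀ x < X.C, s'.arr 6 (s.reg 11 + x) = (X.adv (s.reg 7) (recAt X.C s (s.reg 10))).ag x) ∧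
      (∀ x < X.C, s'.arr 7 (s.reg 11 + x) = (X.adv (s.reg 7) (recAt X.C s (s.reg 10))).g x) ∧
      (∀ p < s.reg 11, s'.arr 6 p = s.arr 6 p) ∧ ∀ p < s.reg 11, s'.arr 7 p = s.arr 7 p := by
  have hCC : X.C ≤ X.C * X.C := Nat.le_mul_of_pos_left _ hC
  set σ := recAt X.C s (s.reg 10) with hσ
  set h := s.reg 11 with hh
  simp only [advRowsP, wp_seq, wp_set]
  refine (wp_while (fun i s' => s'.reg 13 = i ∧ s'.reg 17 = s.reg 10 + i * X.C ∧
    s'.reg 19 = (∑ s_1 ∈ Finset.range i,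
      if σ.ag s_1 = 0 then 0 else if X.lst (σ.ag s_1 - 1) < s.reg 7 then X.M * X.slotPrice σ s_1
        else 0) ∧
    s'.reg 20 = numPos (X.adv (s.reg 7) σ).ag i ∧
    (∀ x < i, s'.arr 6 (h + x) = (X.adv (s.reg 7) σ).ag x) ∧
    (∀ x < i, s'.arr 7 (h + x) = (X.adv (s.reg 7) σ).g x) ∧
    (∀ p < h, s'.arr 6 p = s.arr 6 p) ∧ ∀ p < h, s'.arr 7 p = s.arr 7 p)
    X.C (30 * (X.C + 1) + 60) ?_ ?_ ?_).imp ?_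
  · simp [RExpr.eval, numPos]
  · rintro i s' hi ⟨hr, ha⟩ ⟨h13, h17, h19, h20, h6, h7, h6b, h7b⟩
    simp [RProg.wregs, RProg.warrs, rowMinP_wregs, rowMinP_warrs] at hr ha
    have hag : s'.arr 6 (s.reg 10 + i) = σ.ag i := h6b _ (by omega)
    refine ⟨by simp [RExpr.eval, hr, h13, hL.C, hi], ?_⟩
    simp only [wp_seq, wp_set, wp_put, wp_ifLe, wp_skip]
    constructor
    · intro hpos
      simp [RExpr.eval, hr, h13, hag] at hpos
      refine (rowMinP_spec _).imp ?_
      rintro t s1 ⟨hr1, ha1⟩ ⟨ht, h16⟩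
      simp [rowMinP_wregs, rowMinP_warrs] at hr1 ha1
      have h16' : s1.reg 16 = X.slotPrice σ i := by
        rw [h16]
        simp [RExpr.eval, hr, h13, hag, ha, hL.val, h17, hL.C, Road.slotPrice]
        refine rowMin_congr fun t _ => ?_
        simp [hσ, recAt, add_assoc]
      simp [hr, hL.C] at ht
      have hlt : X.slotPrice σ i < X.M :=
        (le_rowMin_iff.1 (le_refl (X.slotPrice σ i))).1.trans_lt
          (hval i hi (by simp [hσ, recAt] at hpos; omega))
      constructor
      · intro hle
        simp [RExpr.eval, hr1, ha1, ha, hr, h13, hag, hL.lst] at hle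
        have hlive : X.Live (s.reg 7) σ i := ⟨by omega, hle⟩
        simp [RExpr.eval, RExpr.cost, hr1, ha1, hr, h13, hag, h16', h17, h19, h20, ← hh, hL.C]
        refine ⟨by omega, by ring, ?_, ?_, ?_, ?_, ?_, ?_⟩
        · rw [Finset.sum_range_succ, if_neg hlive.1, if_neg (by have := hlive.2; omega), add_zero]
        · simp only [numPos, Finset.sum_range_succ]
          simp [Road.adv, hlive, hlive.1]
        · exact fun x hx => forall_lt_update h6 (by simp [Road.adv, hlive]) x (by omega)
        · exact fun x hx => forall_lt_update h7 (by simp [Road.adv, hlive]) x (by omega)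
        · exact forall_below_update h6b (by omega)
        · exact forall_below_update h7b (by omega)
      · intro hlt'
        simp [RExpr.eval, hr1, ha1, ha, hr, h13, hag, hL.lst] at hlt'
        have hlive : ¬ X.Live (s.reg 7) σ i := fun h => by
          have := h.2
          omega
        -- Row 1 of the table replaces the multiplication by `M`; the price is a valid column
        -- because it is below `M`.
        have htab := hL.tab 1 (by omega) _ hlt
        rw [one_mul, pow_one] at htab
        simp [RExpr.eval, RExpr.cost, hr1, ha1, ha, hr, h13, h16', h17, h19, h20, ← hh, hL.C,
          hL.M, htab]
        refine ⟨by omega, by ring, ?_, ?_, ?_, ?_, ?_, ?_⟩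
        · rw [Finset.sum_range_succ, if_neg (by omega), if_pos hlt', mul_comm]
        · simp only [numPos, Finset.sum_range_succ]
          simp [Road.adv, hlive]
        · exact fun x hx => forall_lt_update h6 (by simp [Road.adv, hlive]) x (by omega)
        · exact fun x hx => forall_lt_update h7 (by simp [Road.adv, hlive]) x (by omega)
        · exact forall_below_update h6b (by omega)
        · exact forall_below_update h7b (by omega)
    · intro h0
      simp [RExpr.eval, hr, h13, hag] at h0
      have hlive : ¬ X.Live (s.reg 7) σ i := fun h => h.1 h0
      simp [RExpr.eval, RExpr.cost, hr, h13, h17, h19, h20, ← hh, hL.C]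
      refine ⟨by ring, ?_, ?_, ?_, ?_, ?_, ?_⟩
      · rw [Finset.sum_range_succ, if_pos h0, add_zero]
      · simp only [numPos, Finset.sum_range_succ]
        simp [Road.adv, hlive]
      · exact fun x hx => forall_lt_update h6 (by simp [Road.adv, hlive]) x (by omega)
      · exact fun x hx => forall_lt_update h7 (by simp [Road.adv, hlive]) x (by omega)
      · exact forall_below_update h6b (by omega)
      · exact forall_below_update h7b (by omega)
  · rintro s' ⟨hr, ha⟩ ⟨h13, -⟩
    simp [RProg.wregs, RProg.warrs, rowMinP_wregs, rowMinP_warrs] at hr ha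
    simp [RExpr.eval, hr, h13, hL.C]
  · rintro t s' - ⟨ht, -, -, h1, h2, h3, h4, h5, h6⟩
    refine ⟨?_, h1, h2, h3, h4, h5, h6⟩
    simp [RExpr.cost] at ht ⊢
    nlinarith

/-- Fill the matrix of the target record, where `cell` writes one entry. -/
def fillP (cell : RProg) : RProg :=
  13 ::= lit 0 ;; 17 ::= var 10 ;; 18 ::= var 11 ;;
  whileLt (var 13) (var 2) (
    14 ::= lit 0 ;;
    whileLt (var 14) (var 2) (
      cell ;;
      17 ::= var 17 +ᵣ lit 1 ;;
      18 ::= var 18 +ᵣ lit 1 ;;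
      14 ::= var 14 +ᵣ lit 1) ;;
    13 ::= var 13 +ᵣ lit 1)

theorem fillP_spec {X : Road} {s : State} {cell : RProg} {T : ℕ} {φ : ℕ → ℕ → ℕ} (hL : Loaded X s)
    (hC : 1 ≤ X.C) (hreg : cell.wregs ⊆ [15, 16]) (harr : cell.warrs ⊆ [8])
    (hcell : ∀ s' x y, x < X.C → y < X.C → Same [13, 14, 15, 16, 17, 18] [8] s s' →
      s'.reg 13 = x → s'.reg 14 = y → s'.reg 17 = s.reg 10 + (x * X.C + y) →
      (∀ p < s.reg 11, s'.arr 8 p = s.arr 8 p) →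
      Wp cell s' fun t s'' => t ≤ T ∧
        s''.arr 8 = Function.update (s'.arr 8) (s'.reg 18) (φ x y)) :
    Wp (fillP cell) s fun t s' => t ≤ (8 * T + 200) * (X.C * X.C) ∧
      (∀ x < X.C, ∀ y < X.C, s'.arr 8 (s.reg 11 + (x * X.C + y)) = φ x y) ∧
      ∀ p < s.reg 11, s'.arr 8 p = s.arr 8 p := by
  have hregm {x : ℕ} (h : x ∈ cell.wregs) : x = 15 ∨ x = 16 := by simpa using hreg h
  have harrm {x : ℕ} (h : x ∈ cell.warrs) : x = 8 := by simpa using harr h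
  set h := s.reg 11 with hh
  -- The matrix as one linear array, the order in which the two nested loops fill it.
  set ψ : ℕ → ℕ := fun q => φ (q / X.C) (q % X.C) with hψ
  have hψe {x y : ℕ} (hy : y < X.C) : ψ (x * X.C + y) = φ x y := by
    simp only [hψ]
    rw [mul_comm, Nat.mul_add_div (by omega), Nat.mul_add_mod, Nat.mod_eq_of_lt hy,
      Nat.div_eq_of_lt hy, add_zero]
  simp only [fillP, wp_seq, wp_set]
  refine (wp_while (fun i s' => s'.reg 13 = i ∧ s'.reg 17 = s.reg 10 + i * X.C ∧
    s'.reg 18 = h + i * X.C ∧ (∀ q < i * X.C, s'.arr 8 (h + q) = ψ q) ∧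
    (∀ p < h, s'.arr 8 p = s.arr 8 p)) X.C ((X.C + 1) * (T + 20) + 20) ?_ ?_ ?_).imp ?_
  · simp [RExpr.eval, hh]
  · rintro i s1 hi hs1 ⟨h13, h17, h18, h8, h8b⟩
    have hs1' : Same [13, 14, 15, 16, 17, 18] [8] s s1 := by
      refine ⟨fun x hx => ?_, fun b hb => ?_⟩
      · rw [hs1.1 x]
        · simp at hx ⊢
          simp [hx]
        · intro hm
          simp [RProg.wregs] at hm hx
          have := fun h => hregm (x := x) h
          tauto
      · rw [hs1.2 b]
        · rfl
        · intro hm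
          simp [RProg.warrs] at hm hb
          exact hb (harrm hm)
    refine ⟨by simp [RExpr.eval, hs1'.1, h13, hL.C, hi], ?_⟩
    simp only [wp_seq, wp_set]
    refine (wp_while (fun j s' => s'.reg 13 = i ∧ s'.reg 14 = j ∧
      s'.reg 17 = s.reg 10 + (i * X.C + j) ∧
      s'.reg 18 = h + (i * X.C + j) ∧ (∀ q < i * X.C + j, s'.arr 8 (h + q) = ψ q) ∧
      (∀ p < h, s'.arr 8 p = s.arr 8 p)) X.C (T + 12) ?_ ?_ ?_).imp ?_
    · simp [RExpr.eval, h13, h17, h18]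
      exact ⟨h8, h8b⟩
    · rintro j s2 hj hs2 ⟨k13, k14, k17, k18, k8, k8b⟩
      have hs2' : Same [13, 14, 15, 16, 17, 18] [8] s s2 := by
        refine hs1'.trans ⟨fun x hx => ?_, fun b hb => ?_⟩
        · rw [hs2.1 x]
          · simp at hx ⊢
            simp [hx]
          · intro hm
            simp [RProg.wregs] at hm hx
            have := fun h => hregm (x := x) h
            tauto
        · rw [hs2.2 b]
          · rfl
          · intro hm
            simp [RProg.warrs] at hm hb
            exact hb (harrm hm)
      refine ⟨by simp [RExpr.eval, hs2'.1, k14, hL.C, hj], ?_⟩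
      simp only [wp_seq, wp_set]
      refine (hcell s2 i j hi hj hs2' k13 k14 k17 k8b).imp ?_
      rintro t s3 ⟨hr3, ha3⟩ ⟨ht, l8⟩
      have e13 := hr3 13 fun h => by simpa using hregm h
      have e14 := hr3 14 fun h => by simpa using hregm h
      have e17 := hr3 17 fun h => by simpa using hregm h
      have e18 := hr3 18 fun h => by simpa using hregm h
      simp [RExpr.eval, RExpr.cost, e13, e14, e17, e18, k13, k14, k17, k18, l8]
      refine ⟨by omega, by omega, by omega, ?_, ?_⟩
      · have := forall_lt_update k8 (v := φ i j) (hψe hj).symm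
        exact fun x hx => this x (by omega)
      · exact forall_below_update k8b (by omega)
    · rintro s2 hs2 ⟨k13, k14, -⟩
      have : s2.reg 2 = X.C := by
        rw [hs2.1 2, State.setReg_reg, if_neg (by decide), hs1'.1 2 (by decide), hL.C]
        intro hm
        simp [RProg.wregs] at hm
        simpa using hregm hm
      simp [RExpr.eval, this, k14]
    · rintro t s2 - ⟨ht, k13, k14, k17, k18, k8, k8b⟩
      simp [RExpr.eval, RExpr.cost, k13, k17, k18] at ht ⊢
      refine ⟨?_, by ring, ?_, k8b⟩
      · have : (X.C + 1) * (T + 12 + 1 + 1 + 1) ≤ (X.C + 1) * (T + 20) :=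
          Nat.mul_le_mul_left _ (by omega)
        omega
      · rwa [show (i + 1) * X.C = i * X.C + X.C by ring]
  · rintro s1 hs1 ⟨h13, -⟩
    have : s1.reg 2 = X.C := by
      rw [hs1.1 2]
      · simp [hL.C]
      intro hm
      simp [RProg.wregs] at hm
      simpa using hregm hm
    simp [RExpr.eval, this, h13]
  · rintro t s1 - ⟨ht, h13, h17, h18, h8, h8b⟩
    refine ⟨?_, fun x hx y hy => ?_, h8b⟩
    · simp [RExpr.cost] at ht ⊢
      nlinarith [Nat.zero_le T, Nat.mul_le_mul hC hC, Nat.zero_le (T * X.C),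
        Nat.mul_le_mul_left T (Nat.mul_le_mul hC hC), Nat.mul_le_mul_left (T * X.C) hC]
    · have : x * X.C + y < X.C * X.C := by nlinarith
      rw [h8 _ this, hψe hy]

/-- Proceed to item `reg 7`: an entry of the matrix. -/
def advCellP : RProg :=
  15 ::= get 6 (var 11 +ᵣ var 13) ;;
  ifLe (var 15) (lit 0) (put 8 (var 18) (lit 0))
    (ifLe (get 6 (var 11 +ᵣ var 14)) (lit 0) (put 8 (var 18) (get 3 (var 15 -ᵣ lit 1)))
      (put 8 (var 18) (get 8 (var 17))))

/-- Proceed to item `reg 7`. -/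
def advP : RProg := advRowsP ;; fillP advCellP

theorem advP_wregs : advP.wregs =
    [13, 17, 19, 20, 15, 16, 14, 23, 16, 14, 20, 19, 17, 13] ++
      [13, 17, 18, 14, 15, 17, 18, 14, 13] := rfl

theorem advP_warrs : advP.warrs = [6, 7, 6, 7, 8, 8, 8] := rfl

/-- The agents of the target are written before its matrix, so a cell can read off from a nonzero
entry there that a slot survives. The source lies below the target and is left intact. -/
theorem advP_spec {X : Road} {s : State} (hL : Loaded X s) (hC : 1 ≤ X.C)
    (hbh : s.reg 10 + X.C * X.C ≤ s.reg 11)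
    (hval : ∀ x < X.C, s.arr 6 (s.reg 10 + x) ≠ 0 → X.val (s.arr 6 (s.reg 10 + x) - 1) < X.M) :
    Wp advP s fun t s' => t ≤ 1000 * (X.C * X.C) ∧
      s'.reg 19 = X.gain (s.reg 7) (recAt X.C s (s.reg 10)) ∧
      s'.reg 20 = numPos (X.adv (s.reg 7) (recAt X.C s (s.reg 10))).ag X.C ∧
      (recAt X.C s' (s.reg 11)).Agree X.C (X.adv (s.reg 7) (recAt X.C s (s.reg 10))) ∧
      (∀ p < s.reg 11, s'.arr 6 p = s.arr 6 p) ∧ (∀ p < s.reg 11, s'.arr 7 p = s.arr 7 p) ∧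
      ∀ p < s.reg 11, s'.arr 8 p = s.arr 8 p := by
  simp only [advP, wp_seq]
  refine (advRowsP_spec hL hC hbh hval).imp ?_
  rintro t1 s1 hs1 ⟨ht1, h19, h20, h6, h7, h6b, h7b⟩
  have hL1 := hL.same hs1 (by simp [advRowsP_wregs]) (by simp [advRowsP_warrs])
  obtain ⟨hr1, ha1⟩ := hs1
  simp [advRowsP_wregs, advRowsP_warrs] at hr1 ha1
  refine (fillP_spec (T := 30) (φ := (X.adv (s.reg 7) (recAt X.C s (s.reg 10))).f) hL1 hC
    (by simp [advCellP, RProg.wregs]) (by simp [advCellP, RProg.warrs]) ?_).imp ?_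
  · rintro s2 x y hx hy ⟨hr2, ha2⟩ h13 h14 h17 h8b
    simp at hr2 ha2
    have e17 : s2.arr 8 (s2.reg 17) = (recAt X.C s (s.reg 10)).f x y := by
      have : x * X.C + y < X.C * X.C := by nlinarith
      rw [h17, h8b _ (by simp [hr1]; omega)]
      simp [hr1, ha1, recAt]
    have ex : s2.arr 6 (s2.reg 11 + x) = (X.adv (s.reg 7) (recAt X.C s (s.reg 10))).ag x := by
      simp [ha2, hr2, hr1, h6 x hx]
    have ey : s2.arr 6 (s2.reg 11 + y) = (X.adv (s.reg 7) (recAt X.C s (s.reg 10))).ag y := by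
      simp [ha2, hr2, hr1, h6 y hy]
    simp [advCellP, wp_seq, wp_set, wp_ifLe, wp_put, RExpr.eval, RExpr.cost, h13, h14, ex, ey, e17,
      ha2, ha1, hL.val]
    generalize recAt X.C s (s.reg 10) = σ
    by_cases hlx : X.Live (s.reg 7) σ x <;> by_cases hly : X.Live (s.reg 7) σ y
    · simp [Road.adv, hlx, hly, hlx.1, hly.1]
    · simp [Road.adv, hlx, hly, hlx.1]
    · simp [Road.adv, hlx, hly]
    · simp [Road.adv, hlx, hly]
  · rintro t2 s2 ⟨hr2, ha2⟩ ⟨ht2, k8, k8b⟩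
    simp [fillP, advCellP, RProg.wregs, RProg.warrs] at hr2 ha2
    simp [hr1, ha1] at k8 k8b
    refine ⟨by omega, by simp [hr2, h19], by simp [hr2, h20], ⟨?_, ?_, k8⟩, ?_, ?_, k8b⟩
    · simpa [recAt, ha2] using h6
    · simpa [recAt, ha2] using h7
    · simpa [ha2] using h6b
    · simpa [ha2] using h7b

/-! ### Records in memory -/

namespace Rec.Agree

variable {C : ℕ} {σ τ υ : Rec}

theorem symm (h : σ.Agree C τ) : τ.Agree C σ :=
  ⟨fun x hx => (h.ag x hx).symm, fun x hx => (h.g x hx).symm, fun x hx y hy => (h.f x hx y hy).symm⟩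

theorem trans (h : σ.Agree C τ) (h' : τ.Agree C υ) : σ.Agree C υ :=
  ⟨fun x hx => (h.ag x hx).trans (h'.ag x hx), fun x hx => (h.g x hx).trans (h'.g x hx),
    fun x hx y hy => (h.f x hx y hy).trans (h'.f x hx y hy)⟩

theorem numPos_eq (h : σ.Agree C τ) : numPos σ.ag C = numPos τ.ag C :=
  Finset.sum_congr rfl fun s hs => by rw [h.ag s (Finset.mem_range.1 hs)]

theorem lastZero_eq (h : σ.Agree C τ) : lastZero σ.ag C = lastZero τ.ag C := by
  have : ∀ k ≤ C, lastZero σ.ag k = lastZero τ.ag k := by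
    intro k hk
    induction k with
    | zero => rfl
    | succ k ih => rw [lastZero, lastZero, h.ag k (by omega), ih (by omega)]
  exact this C le_rfl

variable {X : Road} (h : σ.Agree X.C τ)

include h

theorem slotPrice_eq {s : ℕ} (hs : s < X.C) : X.slotPrice σ s = X.slotPrice τ s := by
  rw [Road.slotPrice, Road.slotPrice, h.ag s hs]
  exact rowMin_congr fun t ht => h.f s hs t ht

theorem live_iff {s : ℕ} (e : ℕ) (hs : s < X.C) : X.Live e σ s ↔ X.Live e τ s := by
  rw [Road.Live, Road.Live, h.ag s hs]

/-- With `gain_eq` and `add` this is the optimality principle: agreeing records have the same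
future, so only the best value needs to be kept. -/
theorem adv (e : ℕ) : (X.adv e σ).Agree X.C (X.adv e τ) := by
  refine ⟨fun x hx => ?_, fun x hx => ?_, fun x hx y hy => ?_⟩
  · simp only [Road.adv, h.live_iff e hx, h.ag x hx]
  · simp only [Road.adv, h.live_iff e hx, h.slotPrice_eq hx]
  · simp only [Road.adv, h.live_iff e hx, h.live_iff e hy, h.f x hx y hy, h.ag x hx]

theorem gain_eq (e : ℕ) : X.gain e σ = X.gain e τ :=
  Finset.sum_congr rfl fun s hs => by
    rw [h.ag s (Finset.mem_range.1 hs), h.slotPrice_eq (Finset.mem_range.1 hs)]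

theorem add (k : ℕ) : (X.add k σ).Agree X.C (X.add k τ) := by
  refine ⟨fun x hx => ?_, fun x hx => ?_, fun x hx y hy => ?_⟩
  · simp only [Road.add, h.lastZero_eq, Function.update_apply, h.ag x hx]
  · simp only [Road.add, h.lastZero_eq, Function.update_apply, h.g x hx]
  · simp only [Road.add, h.lastZero_eq, h.ag x hx, h.ag y hy, h.g x hx, h.f x hx y hy]

end Rec.Agree

/-- The arrays that hold the records agree below `h`. -/
def Below (h : ℕ) (s s' : State) : Prop :=
  ∀ b, 6 ≤ b → b ≤ 10 → ∀ p < h, s'.arr b p = s.arr b p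

theorem Below.mono {h h' : ℕ} {s s' : State} (hb : Below h s s') (hh : h' ≤ h) : Below h' s s' :=
  fun b h1 h2 p hp => hb b h1 h2 p (by omega)

theorem Below.trans {h : ℕ} {s s' s'' : State} (hb : Below h s s') (hb' : Below h s' s'') :
    Below h s s'' :=
  fun b h1 h2 p hp => (hb' b h1 h2 p hp).trans (hb b h1 h2 p hp)

theorem Below.recAt {h C : ℕ} {s s' : State} (hb : Below h s s') {b : ℕ} (hbC : b + C * C ≤ h) :
    (recAt C s' b).Agree C (recAt C s b) := by
  have hx {x : ℕ} (hx : x < C) : b + x < h := by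
    have : C ≤ C * C := Nat.le_mul_of_pos_left _ (by omega)
    omega
  refine ⟨fun x h1 => hb 6 (by omega) (by omega) _ (hx h1),
    fun x h1 => hb 7 (by omega) (by omega) _ (hx h1), fun x h1 y h2 => ?_⟩
  have : x * C + y < C * C := by nlinarith
  exact hb 8 (by omega) (by omega) _ (by omega)

/-! ### Partial sets of winners and the soundness of a stored record -/

namespace Road

variable (X : Road)

/-- Winners with positive valuations that respect the capacities of the items up to `e`. -/
structure Partial (W : Finset ℕ) (e : ℕ) : Prop where
  lt : ∀ i ∈ W, i < X.m
  pos : ∀ i ∈ W, 1 ≤ X.val i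
  card_le : ∀ x ≤ e, (W.filter fun i => X.fst i ≤ x ∧ x ≤ X.lst i).card ≤ X.cap x

/-- There are enough slots. -/
structure Roomy : Prop extends X.Valid where
  one_le : 1 ≤ X.C
  cap_le : ∀ x < X.n, min (X.cap x) X.m ≤ X.C

variable {X}

/-- There are at most `m` winners, so `min (cap x) m` slots suffice even where the capacity is
larger; past the last item none are needed. -/
theorem Roomy.fits (hX : X.Roomy) {W : Finset ℕ} (h1 : ∀ i ∈ W, i < X.m)
    (h2 : ∀ i ∈ W, 1 ≤ X.val i) {e : ℕ}
    (h3 : ∀ x ≤ e, x < X.n → (W.filter fun i => X.fst i ≤ x ∧ x ≤ X.lst i).card ≤ X.cap x) :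
    X.Fits W e := by
  refine ⟨h1, h2, fun x hx => ?_⟩
  rcases lt_or_ge x X.n with hxn | hxn
  · refine (le_min (h3 x hx hxn) ?_).trans (hX.cap_le x hxn)
    have : (W.filter fun i => X.fst i ≤ x ∧ x ≤ X.lst i) ⊆ Finset.range X.m := fun i hi =>
      Finset.mem_range.2 (h1 i (Finset.mem_filter.1 hi).1)
    simpa using Finset.card_le_card this
  · rw [Finset.filter_false_of_mem]
    · simp
    · intro i hi h
      have := hX.lt i (h1 i hi)
      omega

theorem Partial.fits {W : Finset ℕ} {e : ℕ} (h : X.Partial W e) (hX : X.Roomy) : X.Fits W e :=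
  hX.fits h.lt h.pos fun x hx _ => h.card_le x hx

theorem Feasible.fits {W : Finset ℕ} (h : X.Feasible W) (hX : X.Roomy) (e : ℕ) : X.Fits W e :=
  hX.fits h.lt h.pos fun x _ hx => h.card_le x hx

theorem Partial.feasible {W : Finset ℕ} (h : X.Partial W X.n) : X.Feasible W :=
  ⟨h.lt, h.pos, fun x hx => h.card_le x hx.le⟩

theorem Describes.agree {W : Finset ℕ} {e k : ℕ} {σ τ : Rec} (h : X.Describes W e k τ)
    (hσ : σ.Agree X.C τ) : X.Describes W e k σ := by
  refine ⟨fun s hs t ht hst h0 => ?_, fun i hi => ?_, fun s hs i hi => ?_, fun s hs h0 => ?_,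
    fun s hs h0 t ht => ?_, fun s hs i hi => ?_, fun s hs i hi t ht h0 => ?_,
    fun s hs i hi t ht j hj => ?_⟩
  · rw [hσ.ag s hs, hσ.ag t ht] at hst
    rw [hσ.ag s hs] at h0
    exact h.inj s hs t ht hst h0
  · obtain ⟨s, hs, hsi⟩ := h.surj i hi
    exact ⟨s, hs, (hσ.ag s hs).trans hsi⟩
  · exact h.mem s hs i ((hσ.ag s hs).symm.trans hi)
  · rw [hσ.g s hs]
    exact h.g_zero s hs ((hσ.ag s hs).symm.trans h0)
  · rw [hσ.f s hs t ht]
    exact h.f_zero s hs ((hσ.ag s hs).symm.trans h0) t ht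
  · rw [hσ.g s hs]
    exact h.g_eq s hs i ((hσ.ag s hs).symm.trans hi)
  · rw [hσ.f s hs t ht]
    exact h.f_empty s hs i ((hσ.ag s hs).symm.trans hi) t ht ((hσ.ag t ht).symm.trans h0)
  · rw [hσ.f s hs t ht]
    exact h.f_eq s hs i ((hσ.ag s hs).symm.trans hi) t ht j ((hσ.ag t ht).symm.trans hj)

variable (X) in
/-- The following pointers to predecessors from position `b` gives the records of `W` at the items
below `e`, all of them below `h`. -/
def Chain (s : State) (W : Finset ℕ) (h : ℕ) : ℕ → ℕ → Prop
  | 0, _ => True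
  | e + 1, b => b + X.C * X.C ≤ h ∧ (recAt X.C s b).Agree X.C (X.run W e X.m).1 ∧
      Chain s W h e (s.arr 10 b)

theorem Chain.below {s s' : State} {W : Finset ℕ} {h h' e b : ℕ} (hc : X.Chain s W h e b)
    (hX : X.Roomy) (hh : h ≤ h') (hb : Below h s s') : X.Chain s' W h' e b := by
  induction e generalizing b with
  | zero => trivial
  | succ e ih =>
    obtain ⟨h1, h2, h3⟩ := hc
    have : 1 ≤ X.C * X.C := Nat.mul_le_mul hX.one_le hX.one_le
    refine ⟨h1.trans hh, (hb.recAt h1).trans h2, ?_⟩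
    rw [hb 10 (by omega) le_rfl b (by omega)]
    exact ih h3

/-- The records on the chain belong to items before `e`, where agents with first item `e` are still
undecided. -/
theorem Chain.congr {s : State} {W W' : Finset ℕ} {h e b : ℕ} (hc : X.Chain s W h e b)
    (hW' : ∀ i, i ∈ W' → i ∈ W ∨ X.fst i = e) (hW : W ⊆ W') : X.Chain s W' h e b := by
  suffices ∀ e' ≤ e, ∀ b, X.Chain s W h e' b → X.Chain s W' h e' b from this e le_rfl b hc
  intro e' he'
  induction e' with
  | zero => exact fun _ _ => trivial
  | succ e' ih =>
    rintro b ⟨h1, h2, h3⟩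
    refine ⟨h1, ?_, ih (by omega) _ h3⟩
    rwa [X.run_congr (W' := W)]
    intro i hi
    refine ⟨fun h => (hW' i h).resolve_right fun h' => ?_, fun h => hW h⟩
    rcases hi with hi | hi <;> omega

variable (X) in
/-- The memory at position `b` is the record of a set of winners, when the agents below `k` have
been decided at item `e`. -/
def Good (s : State) (e k h b : ℕ) : Prop :=
  ∃ W, (∀ i ∈ W, X.Decided e k i) ∧ X.Partial W e ∧
    (recAt X.C s b).Agree X.C (X.run W e k).1 ∧ s.arr 9 b = (X.run W e k).2 ∧
    X.Chain s W h e (s.arr 10 b)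

theorem Good.below {s s' : State} {e k h b : ℕ} (hg : X.Good s e k h b) (hX : X.Roomy)
    {h' : ℕ} (hb : Below h' s s') (hbh : b + X.C * X.C ≤ h') (hh : h ≤ h') :
    X.Good s' e k h b := by
  obtain ⟨W, h1, h2, h3, h4, h5⟩ := hg
  have : 1 ≤ X.C * X.C := Nat.mul_le_mul hX.one_le hX.one_le
  refine ⟨W, h1, h2, (hb.recAt hbh).trans h3, ?_, ?_⟩
  · rw [hb 9 (by omega) (by omega) b (by omega), h4]
  · rw [hb 10 (by omega) le_rfl b (by omega)]
    exact h5.below hX le_rfl (hb.mono hh)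

theorem Good.describes {s : State} {e k h b : ℕ} (hg : X.Good s e k h b) (hX : X.Roomy) :
    ∃ W, X.Partial W e ∧ (∀ i ∈ W, X.Decided e k i) ∧ X.Describes W e k (recAt X.C s b) := by
  obtain ⟨W, h1, h2, h3, -⟩ := hg
  exact ⟨W, h2, h1, (describes_run hX.toValid (h2.fits hX) k).agree h3⟩

/-- The stored record also represents the decision that `k` loses. -/
theorem Good.succ {s : State} {e k h b : ℕ} (hg : X.Good s e k h b) :
    X.Good s e (k + 1) h b := by
  obtain ⟨W, h1, h2, h3, h4, h5⟩ := hg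
  have hk : ¬ (X.fst k = e ∧ k ∈ W) := fun ⟨hk, hkW⟩ => by
    rcases h1 k hkW with h | h <;> omega
  refine ⟨W, fun i hi => ?_, h2, ?_, ?_, h5⟩
  · exact (h1 i hi).imp_right fun h => ⟨h.1, by omega⟩
  · rwa [run_succ, if_neg hk]
  · rwa [run_succ, if_neg hk]

/-- The agents that want item `e + 1` are the slots that survive. -/
theorem numPos_adv_eq (hX : X.Roomy) {W : Finset ℕ} {e : ℕ} (hW : X.Fits W e) {σ : Rec}
    (hσ : σ.Agree X.C (X.run W e X.m).1) :
    numPos (X.adv (e + 1) σ).ag X.C = (X.active W (e + 1) 0).card := by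
  rw [(hσ.adv (e + 1)).numPos_eq]
  exact ((describes_run hX.toValid hW X.m).adv hX.toValid hW.lt).numPos_eq

theorem Good.adv {s s' : State} {e h b : ℕ} (hg : X.Good s e X.m h b) (hX : X.Roomy)
    {h' p : ℕ} (hb : Below h' s s') (hbh : b + X.C * X.C ≤ h') (hh : h ≤ h')
    (hcap : numPos (X.adv (e + 1) (recAt X.C s b)).ag X.C ≤ X.cap (e + 1))
    (hrec : (recAt X.C s' p).Agree X.C (X.adv (e + 1) (recAt X.C s b)))
    (hval : s'.arr 9 p = s.arr 9 b + X.gain (e + 1) (recAt X.C s b)) (hpre : s'.arr 10 p = b) :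
    X.Good s' (e + 1) 0 h' p := by
  obtain ⟨W, h1, h2, h3, h4, h5⟩ := hg
  have : 1 ≤ X.C * X.C := Nat.mul_le_mul hX.one_le hX.one_le
  have hdec : ∀ i ∈ W, X.Decided (e + 1) 0 i := fun i hi => by
    rcases h1 i hi with h | h
    · exact Or.inl (by omega)
    · exact Or.inl (by omega)
  refine ⟨W, hdec, ⟨h2.lt, h2.pos, fun x hx => ?_⟩, ?_, ?_, ?_⟩
  · rcases hx.lt_or_eq with hx | rfl
    · exact h2.card_le x (by omega)
    · rw [numPos_adv_eq hX (h2.fits hX) h3] at hcap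
      refine le_trans (Finset.card_le_card fun i hi => ?_) hcap
      obtain ⟨hi1, hi2⟩ := Finset.mem_filter.1 hi
      exact Finset.mem_filter.2 ⟨hi1, hdec i hi1, hi2.2⟩
  · exact hrec.trans (h3.adv (e + 1))
  · rw [hval, h4, h3.gain_eq, run_zero]
  · rw [hpre]
    refine ⟨hbh, (hb.recAt hbh).trans h3, ?_⟩
    rw [hb 10 (by omega) le_rfl b (by omega)]
    exact h5.below hX hh (hb.mono hh)

/-- Among the items up to `e` the new agent wants only `e`, so one capacity test suffices; later
items are tested when they are reached. -/
theorem Good.add {s s' : State} {e k h b : ℕ} (hg : X.Good s e k h b) (hX : X.Roomy)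
    (hk : X.fst k = e) (hkm : k < X.m) (hkv : 1 ≤ X.val k) {p : ℕ} (hb : Below h s s')
    (hcap : numPos (recAt X.C s b).ag X.C < X.cap e)
    (hrec : (recAt X.C s' p).Agree X.C (X.add k (recAt X.C s b)))
    (hval : s'.arr 9 p = s.arr 9 b + X.val k) (hpre : s'.arr 10 p = s.arr 10 b) :
    X.Good s' e (k + 1) h p := by
  obtain ⟨W, h1, h2, h3, h4, h5⟩ := hg
  have hkW : k ∉ W := fun hkW => by
    rcases h1 k hkW with h | h <;> omega
  have hrun : X.run (insert k W) e k = X.run W e k := by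
    refine X.run_congr fun i hi => ?_
    have : i ≠ k := by
      rintro rfl
      rcases hi with h | h <;> omega
    simp [this]
  have hrun' : X.run (insert k W) e (k + 1) =
      (X.add k (X.run W e k).1, (X.run W e k).2 + X.val k) := by
    rw [run_succ, if_pos ⟨hk, Finset.mem_insert_self k W⟩, hrun]
  have hnum : numPos (recAt X.C s b).ag X.C = (X.active W e k).card :=
    ((describes_run hX.toValid (h2.fits hX) k).agree h3).numPos_eq
  have hact : (W.filter fun i => X.fst i ≤ e ∧ e ≤ X.lst i) ⊆ X.active W e k := fun i hi => by
    obtain ⟨hi1, hi2⟩ := Finset.mem_filter.1 hi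
    exact Finset.mem_filter.2 ⟨hi1, h1 i hi1, hi2.2⟩
  refine ⟨insert k W, fun i hi => ?_, ⟨fun i hi => ?_, fun i hi => ?_, fun x hx => ?_⟩, ?_, ?_, ?_⟩
  · rcases Finset.mem_insert.1 hi with rfl | hi
    · exact Or.inr ⟨hk, by omega⟩
    · exact (h1 i hi).imp_right fun h => ⟨h.1, by omega⟩
  · rcases Finset.mem_insert.1 hi with rfl | hi
    · exact hkm
    · exact h2.lt i hi
  · rcases Finset.mem_insert.1 hi with rfl | hi
    · exact hkv
    · exact h2.pos i hi
  · rw [Finset.filter_insert]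
    split_ifs with hkx
    · obtain rfl : x = e := by omega
      have := Finset.card_insert_le k (W.filter fun i => X.fst i ≤ x ∧ x ≤ X.lst i)
      have := Finset.card_le_card hact
      omega
    · exact h2.card_le x hx
  · rw [hrun']
    exact hrec.trans (h3.add k)
  · rw [hrun', hval, h4]
  · rw [hpre]
    refine (h5.below hX le_rfl hb).congr (fun i hi => ?_) (Finset.subset_insert k W)
    rcases Finset.mem_insert.1 hi with rfl | hi
    · exact Or.inr hk
    · exact Or.inl hi

/-- Adding an agent is injective. -/
theorem agree_of_add_agree {W W' : Finset ℕ} {e k : ℕ} {σ τ : Rec} (hσ : X.Describes W e k σ)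
    (hτ : X.Describes W' e k τ) (hk : X.fst k = e) (hnσ : numPos σ.ag X.C < X.C)
    (hnτ : numPos τ.ag X.C < X.C) (h : (X.add k σ).Agree X.C (X.add k τ)) : σ.Agree X.C τ := by
  obtain ⟨hu, hu0⟩ := lastZero_spec (exists_eq_zero_of_numPos_lt hnσ)
  obtain ⟨hv, hv0⟩ := lastZero_spec (exists_eq_zero_of_numPos_lt hnτ)
  -- Otherwise `τ` would already hold the undecided agent `k`.
  have huv : lastZero τ.ag X.C = lastZero σ.ag X.C := by
    by_contra hne
    have := h.ag _ hu
    simp only [Road.add, Function.update_self, Function.update_of_ne (Ne.symm hne)] at this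
    exact not_mem_active W' hk (hτ.mem _ hu k this.symm)
  set u := lastZero σ.ag X.C with hudef
  rw [huv] at hv0
  have hag : ∀ x < X.C, σ.ag x = τ.ag x := fun x hx => by
    by_cases hxu : x = u
    · rw [hxu, hu0, hv0]
    · have := h.ag x hx
      simpa only [Road.add, ← hudef, huv, Function.update_of_ne hxu] using this
  -- The addition overwrites only entries of an empty slot, and these have prescribed default values
  -- in both records.
  refine ⟨hag, fun x hx => ?_, fun x hx y hy => ?_⟩
  · by_cases hxu : x = u
    · rw [hxu, hσ.g_zero u hu hu0, hτ.g_zero u hu hv0]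
    · have := h.g x hx
      simpa only [Road.add, ← hudef, huv, Function.update_of_ne hxu] using this
  · by_cases hx0 : σ.ag x = 0
    · rw [hσ.f_zero x hx hx0 y hy, hτ.f_zero x hx (hag x hx ▸ hx0) y hy]
    obtain ⟨i, hi⟩ := Nat.exists_eq_succ_of_ne_zero hx0
    by_cases hyu : y = u
    · rw [hyu, hσ.f_empty x hx i hi u hu hu0, hτ.f_empty x hx i (hag x hx ▸ hi) u hu hv0]
    · have hxu : x ≠ u := by
        rintro rfl
        exact hx0 hu0
      have := h.f x hx y hy
      simpa only [Road.add, ← hudef, huv, if_neg hxu, if_neg hyu, if_neg hx0,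
        ← hag x hx] using this

end Road

/-! ### Keys of records -/

theorem sum_digits_lt {M L : ℕ} {d : ℕ → ℕ} (h : ∀ q < L, d q < M) :
    ∑ q ∈ Finset.range L, d q * M ^ q < M ^ L := by
  induction L with
  | zero => simp
  | succ L ih =>
    have h1 := ih fun q hq => h q (by omega)
    have h2 : (d L + 1) * M ^ L ≤ M * M ^ L := Nat.mul_le_mul_right _ (h L (by omega))
    rw [Finset.sum_range_succ, pow_succ, mul_comm (M ^ L)]
    rw [add_mul, one_mul] at h2
    omega

theorem sum_digits_inj {M L : ℕ} {d d' : ℕ → ℕ} (h : ∀ q < L, d q < M) (h' : ∀ q < L, d' q < M)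
    (heq : ∑ q ∈ Finset.range L, d q * M ^ q = ∑ q ∈ Finset.range L, d' q * M ^ q) :
    ∀ q < L, d q = d' q := by
  induction L with
  | zero => simp
  | succ L ih =>
    have h1 := sum_digits_lt fun q (hq : q < L) => h q (by omega)
    have h2 := sum_digits_lt fun q (hq : q < L) => h' q (by omega)
    rw [Finset.sum_range_succ, Finset.sum_range_succ] at heq
    have hpos : 0 < M ^ L := by omega
    have hL : d L = d' L := by
      have h3 := congrArg (· / M ^ L) heq
      simpa [Nat.add_mul_div_right _ _ hpos, Nat.div_eq_of_lt h1, Nat.div_eq_of_lt h2] using h3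
    rw [hL] at heq
    intro q hq
    rcases (Nat.lt_succ_iff.1 hq).lt_or_eq with hq | rfl
    · exact ih (fun q hq => h q (by omega)) (fun q hq => h' q (by omega)) (by omega) q hq
    · exact hL

/-- The digits of the key of the record at position `b`. -/
def digitAt (C : ℕ) (s : State) (b q : ℕ) : ℕ :=
  if q < C then s.arr 6 (b + q) else if q < C + C then s.arr 7 (b + (q - C))
    else s.arr 8 (b + (q - (C + C)))

/-- The key of the record at position `b`. -/
def keyAt (C M : ℕ) (s : State) (b : ℕ) : ℕ :=
  ∑ q ∈ Finset.range (C + C + C * C), digitAt C s b q * M ^ q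

theorem keyAt_eq (C M : ℕ) (s : State) (b : ℕ) : keyAt C M s b =
    ∑ q ∈ Finset.range C, s.arr 6 (b + q) * M ^ q +
      ∑ q ∈ Finset.range C, s.arr 7 (b + q) * M ^ (C + q) +
      ∑ q ∈ Finset.range (C * C), s.arr 8 (b + q) * M ^ (C + C + q) := by
  rw [keyAt, Finset.sum_range_add, Finset.sum_range_add]
  congr 1
  · congr 1
    · refine Finset.sum_congr rfl fun q hq => ?_
      rw [digitAt, if_pos (Finset.mem_range.1 hq)]
    · refine Finset.sum_congr rfl fun q hq => ?_
      have := Finset.mem_range.1 hq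
      rw [digitAt, if_neg (by omega), if_pos (by omega), Nat.add_sub_cancel_left]
  · refine Finset.sum_congr rfl fun q hq => ?_
    rw [digitAt, if_neg (by omega), if_neg (by omega), Nat.add_sub_cancel_left]

theorem agree_iff_digitAt {C : ℕ} {s s' : State} {b b' : ℕ} :
    (recAt C s b).Agree C (recAt C s' b') ↔
      ∀ q < C + C + C * C, digitAt C s b q = digitAt C s' b' q := by
  constructor
  · intro h q hq
    unfold digitAt
    split_ifs with h1 h2
    · exact h.ag q h1
    · exact h.g (q - C) (by omega)
    · have hC : 0 < C := by
        rcases Nat.eq_zero_or_pos C with rfl | hC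
        · omega
        · exact hC
      have hq' : q - (C + C) < C * C := by omega
      have := h.f ((q - (C + C)) / C) (Nat.div_lt_of_lt_mul hq') ((q - (C + C)) % C)
        (Nat.mod_lt _ hC)
      simpa only [recAt, mul_comm _ C, Nat.div_add_mod] using this
  · intro h
    refine ⟨fun x hx => ?_, fun x hx => ?_, fun x hx y hy => ?_⟩
    · have := h x (by omega)
      simpa only [recAt, digitAt, if_pos hx] using this
    · have := h (C + x) (by omega)
      simpa only [recAt, digitAt, if_neg (show ¬ C + x < C by omega),
        if_pos (show C + x < C + C by omega), Nat.add_sub_cancel_left] using this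
    · have hxy : x * C + y < C * C := by nlinarith
      have := h (C + C + (x * C + y)) (by omega)
      simpa only [recAt, digitAt, if_neg (show ¬ C + C + (x * C + y) < C by omega),
        if_neg (show ¬ C + C + (x * C + y) < C + C by omega), Nat.add_sub_cancel_left] using this

theorem Rec.Agree.keyAt_eq {C : ℕ} (M : ℕ) {s s' : State} {b b' : ℕ}
    (h : (recAt C s b).Agree C (recAt C s' b')) : keyAt C M s b = keyAt C M s' b' :=
  Finset.sum_congr rfl fun q hq => by rw [agree_iff_digitAt.1 h q (Finset.mem_range.1 hq)]

/-- The entries of the record at position `b` are digits. -/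
def Small (C M : ℕ) (s : State) (b : ℕ) : Prop := ∀ q < C + C + C * C, digitAt C s b q < M

theorem Small.keyAt_lt {C M : ℕ} {s : State} {b : ℕ} (h : Small C M s b) :
    keyAt C M s b < M ^ (C + C + C * C) :=
  sum_digits_lt h

/-- Uniqueness of the expansion in base `M`. -/
theorem Small.agree {C M : ℕ} {s s' : State} {b b' : ℕ} (h : Small C M s b) (h' : Small C M s' b')
    (hk : keyAt C M s b = keyAt C M s' b') : (recAt C s b).Agree C (recAt C s' b') :=
  agree_iff_digitAt.2 (sum_digits_inj h h' hk)

theorem small_of {C M : ℕ} {s : State} {b : ℕ} (h1 : ∀ x < C, (recAt C s b).ag x < M)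
    (h2 : ∀ x < C, (recAt C s b).g x < M)
    (h3 : ∀ x < C, ∀ y < C, (recAt C s b).f x y < M) : Small C M s b := by
  intro q hq
  unfold digitAt
  split_ifs with hq1 hq2
  · exact h1 q hq1
  · exact h2 _ (by omega)
  · have hC : 0 < C := by
      rcases Nat.eq_zero_or_pos C with rfl | hC
      · omega
      · exact hC
    have hq' : q - (C + C) < C * C := by omega
    have := h3 ((q - (C + C)) / C) (Nat.div_lt_of_lt_mul hq') ((q - (C + C)) % C)
      (Nat.mod_lt _ hC)
    simpa only [recAt, mul_comm _ C, Nat.div_add_mod] using this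

namespace Road

variable {X : Road}

theorem Describes.f_le {W : Finset ℕ} {e k : ℕ} {σ : Rec} (h : X.Describes W e k σ)
    {x y i : ℕ} (hx : x < X.C) (hy : y < X.C) (hi : σ.ag x = i + 1) : σ.f x y ≤ X.val i := by
  rcases Nat.eq_zero_or_eq_succ_pred (σ.ag y) with h0 | h0
  · rw [h.f_empty x hx i hi y hy h0]
  · rw [h.f_eq x hx i hi y hy _ h0]
    exact min_le_left _ _

/-- Shifted agent numbers are at most `m`, and truncated prices are at most a valuation. This is why
`M` is chosen above `m` plus the sum of the valuations. -/
theorem Describes.small {W : Finset ℕ} {e k : ℕ} {s : State} {b : ℕ}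
    (h : X.Describes W e k (recAt X.C s b)) (hX : X.Valid) (hW : ∀ i ∈ W, i < X.m) :
    Small X.C X.M s b := by
  have hM := hX.sum_lt
  refine small_of (fun x hx => ?_) (fun x hx => ?_) (fun x hx y hy => ?_)
  all_goals rcases Nat.eq_zero_or_eq_succ_pred ((recAt X.C s b).ag x) with h0 | h0
  · omega
  · have := hW _ (Finset.mem_filter.1 (h.mem x hx _ h0)).1
    rw [h0]
    omega
  · rw [h.g_zero x hx h0]
    omega
  · have := hX.val_lt (hW _ (Finset.mem_filter.1 (h.mem x hx _ h0)).1)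
    rw [h.g_eq x hx _ h0]
    exact (min_le_left _ _).trans_lt this
  · rw [h.f_zero x hx h0 y hy]
    omega
  · exact (h.f_le hx hy h0).trans_lt
      (hX.val_lt (hW _ (Finset.mem_filter.1 (h.mem x hx _ h0)).1))

theorem Good.small {s : State} {e k h b : ℕ} (hg : X.Good s e k h b) (hX : X.Roomy) :
    Small X.C X.M s b := by
  obtain ⟨W, h1, -, h2⟩ := hg.describes hX
  exact h2.small hX.toValid h1.lt

end Road

/-! ### The programs for one step of a record -/

/-- Add to the key the first `reg r` digits of array `b` at the target record. -/
def digitsP (b r : ℕ) : RProg :=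
  13 ::= lit 0 ;;
  whileLt (var 13) (var r) (
    21 ::= var 21 +ᵣ get 11 (var 22 +ᵣ get b (var 11 +ᵣ var 13)) ;;
    22 ::= var 22 +ᵣ var 3 ;;
    13 ::= var 13 +ᵣ lit 1)

/-- Register `22` holds the start of the current row of the table. It grows by `M` per digit, so
each digit contributes by one lookup. -/
theorem digitsP_spec {X : Road} {s : State} (hL : Loaded X s) {b r a N : ℕ}
    (hr : r ≠ 13 ∧ r ≠ 21 ∧ r ≠ 22) (hN : s.reg r = N) (ha : s.reg 22 = a * X.M)
    (haN : a + N ≤ X.C + X.C + X.C * X.C) (hd : ∀ q < N, s.arr b (s.reg 11 + q) < X.M) :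
    Wp (digitsP b r) s fun t s' => t ≤ 25 * (N + 1) ∧
      s'.reg 21 = s.reg 21 + ∑ q ∈ Finset.range N, s.arr b (s.reg 11 + q) * X.M ^ (a + q) ∧
      s'.reg 22 = (a + N) * X.M := by
  obtain ⟨hr1, hr2, hr3⟩ := hr
  simp only [digitsP, wp_seq, wp_set]
  refine (wp_while (fun i s' => s'.reg 13 = i ∧ s'.reg 22 = (a + i) * X.M ∧
    s'.reg 21 = s.reg 21 + ∑ q ∈ Finset.range i, s.arr b (s.reg 11 + q) * X.M ^ (a + q)) N 18
    ?_ ?_ ?_).imp ?_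
  · simp [RExpr.eval, ha]
  · rintro i s' hi hs ⟨h13, h22, h21⟩
    have hL' := hL.same (R := [13, 21, 22]) (A := []) (s' := s')
      ⟨fun x hx => by
        simp at hx
        rw [hs.1 x (by simp [RProg.wregs, hx])]
        simp [hx], fun x _ => hs.2 x (by simp [RProg.warrs])⟩ (by simp) (by simp)
    obtain ⟨hr, ha⟩ := hs
    simp [RProg.wregs, RProg.warrs] at hr ha
    have htab := hL'.tab (a + i) (by omega) _ (hd i hi)
    have hrr : s'.reg r = N := by rw [hr r (by omega) (by omega) (by omega), if_neg hr1, hN]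
    simp [wp_seq, wp_set, RExpr.eval, RExpr.cost, hr, ha, h13, h22, h21, hi, hrr, hL.M]
    rw [ha] at htab
    rw [htab, Finset.sum_range_succ]
    exact ⟨by ring, by ring⟩
  · rintro s' ⟨hr, ha⟩ ⟨h1, -⟩
    simp [RProg.wregs, RProg.warrs] at hr ha
    have hrr : s'.reg r = N := by rw [hr r (by omega) (by omega) (by omega), if_neg hr1, hN]
    simp [RExpr.eval, h1, hrr]
  · rintro t s' - ⟨ht, -, h22, h21⟩
    simp [RExpr.cost] at ht ⊢
    exact ⟨by omega, h21, h22⟩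

/-- The key of the target record. -/
def keyP : RProg :=
  21 ::= var 6 ;; 22 ::= lit 0 ;; digitsP 6 2 ;; digitsP 7 2 ;; digitsP 8 4

theorem keyP_wregs : keyP.wregs = [21, 22, 13, 21, 22, 13, 13, 21, 22, 13, 13, 21, 22, 13] := rfl

theorem keyP_warrs : keyP.warrs = [] := rfl

theorem keyP_spec {X : Road} {s : State} (hL : Loaded X s) (hC : 1 ≤ X.C)
    (hd : Small X.C X.M s (s.reg 11)) :
    Wp keyP s fun t s' => t ≤ 200 * (X.C * X.C) ∧
      s'.reg 21 = s.reg 6 + keyAt X.C X.M s (s.reg 11) := by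
  have hCC : X.C ≤ X.C * X.C := Nat.le_mul_of_pos_left _ hC
  simp only [keyP, wp_seq, wp_set]
  set s0 := (s.setReg 21 (eval s (var 6))).setReg 22 (eval (s.setReg 21 (eval s (var 6))) (lit 0))
    with hs0
  have hL0 : Loaded X s0 := hL.same (R := [21, 22]) (A := [])
    ⟨fun x hx => by simp at hx; simp [hs0, hx], fun x _ => rfl⟩ (by simp) (by simp)
  refine (digitsP_spec (b := 6) (r := 2) (a := 0) hL0 (by simp) hL0.C
    (by simp [hs0, RExpr.eval]) (by omega) ?_).imp ?_
  · intro q hq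
    simpa [digitAt, hq, hs0] using hd q (by omega)
  rintro t1 s1 hs1 ⟨ht1, h21, h22⟩
  have hL1 := hL0.same hs1 (by simp [digitsP, RProg.wregs]) (by simp [digitsP, RProg.warrs])
  refine (digitsP_spec (b := 7) (r := 2) (a := 0 + X.C) hL1 (by simp) hL1.C h22
    (by omega) ?_).imp ?_
  · intro q hq
    have := hd (X.C + q) (by omega)
    rw [hs1.1 11 (by simp [digitsP, RProg.wregs]), hs1.2 7 (by simp [digitsP, RProg.warrs])]
    simpa [digitAt, hq, hs0] using this
  rintro t2 s2 hs2 ⟨ht2, k21, k22⟩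
  have hL2 := hL1.same hs2 (by simp [digitsP, RProg.wregs]) (by simp [digitsP, RProg.warrs])
  refine (digitsP_spec (b := 8) (r := 4) (a := 0 + X.C + X.C) hL2 (by simp) hL2.D k22
    (by omega) ?_).imp ?_
  · intro q hq
    have := hd (X.C + X.C + q) (by omega)
    rw [hs2.1 11 (by simp [digitsP, RProg.wregs]), hs2.2 8 (by simp [digitsP, RProg.warrs]),
      hs1.1 11 (by simp [digitsP, RProg.wregs]), hs1.2 8 (by simp [digitsP, RProg.warrs])]
    have h1 : ¬ X.C + X.C + q < X.C := by omega
    simpa [digitAt, h1, hs0] using this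
  rintro t3 s3 hs3 ⟨ht3, l21, -⟩
  refine ⟨by simp [RExpr.cost]; omega, ?_⟩
  rw [l21, k21, h21, keyAt_eq, hs2.1 11 (by simp [digitsP, RProg.wregs]),
    hs2.2 8 (by simp [digitsP, RProg.warrs]), hs1.1 11 (by simp [digitsP, RProg.wregs]),
    hs1.2 8 (by simp [digitsP, RProg.warrs]), hs1.2 7 (by simp [digitsP, RProg.warrs])]
  simp [hs0, RExpr.eval, add_assoc]

/-- Insert the target record, or improve an equal one. -/
def insertP : RProg :=
  ifLe (var 20) (get 0 (var 7)) (
    19 ::= get 9 (var 10) +ᵣ var 19 ;;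
    23 ::= get 12 (var 21) ;;
    ifLe (lit 1) (var 23)
      (ifLe (var 19) (get 9 (var 23)) skip (put 9 (var 23) (var 19) ;; put 10 (var 23) (var 10)))
      (put 12 (var 21) (var 11) ;; put 9 (var 11) (var 19) ;; put 10 (var 11) (var 10) ;;
        11 ::= var 11 +ᵣ var 4)) skip

/-- Proceed to item `reg 7` with the source record. -/
def advRecP : RProg := advP ;; keyP ;; insertP

theorem advRecP_wregs : advRecP.wregs = advP.wregs ++ (keyP.wregs ++ [19, 23, 11]) := rfl

theorem advRecP_warrs : advRecP.warrs = advP.warrs ++ [9, 10, 12, 9, 10] := rfl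

/-- The target is written before it is known whether it is admissible and new. If it is not,
register `11` stays put and the next target overwrites it. -/
theorem advRecP_spec {X : Road} {s : State} (hL : Loaded X s) (hC : 1 ≤ X.C)
    {b h v : ℕ} {τ : Rec} (hb : s.reg 10 = b) (hh : s.reg 11 = h)
    (hbh : b + X.C * X.C ≤ h)
    (hval : ∀ x < X.C, s.arr 6 (b + x) ≠ 0 → X.val (s.arr 6 (b + x) - 1) < X.M)
    (hτ : τ = X.adv (s.reg 7) (recAt X.C s b))
    (hv : v = s.arr 9 b + X.gain (s.reg 7) (recAt X.C s b))
    (hsmall : ∀ s', (recAt X.C s' h).Agree X.C τ → Small X.C X.M s' h) :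
    Wp advRecP s fun t s' => t ≤ 1300 * (X.C * X.C) ∧
      (recAt X.C s' h).Agree X.C τ ∧
      (∀ p < h, s'.arr 6 p = s.arr 6 p ∧ s'.arr 7 p = s.arr 7 p ∧ s'.arr 8 p = s.arr 8 p) ∧
      (X.cap (s.reg 7) < numPos τ.ag X.C → s'.reg 11 = h ∧
        s'.arr 9 = s.arr 9 ∧ s'.arr 10 = s.arr 10 ∧ s'.arr 12 = s.arr 12) ∧
      (numPos τ.ag X.C ≤ X.cap (s.reg 7) →
        (s.arr 12 (s.reg 6 + keyAt X.C X.M s' h) = 0 → s'.reg 11 = h + X.C * X.C ∧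
          s'.arr 9 = Function.update (s.arr 9) h v ∧
          s'.arr 10 = Function.update (s.arr 10) h b ∧
          s'.arr 12 = Function.update (s.arr 12) (s.reg 6 + keyAt X.C X.M s' h) h) ∧
        ∀ x, x ≠ 0 → s.arr 12 (s.reg 6 + keyAt X.C X.M s' h) = x → s'.reg 11 = h ∧
          s'.arr 12 = s.arr 12 ∧
          (v ≤ s.arr 9 x → s'.arr 9 = s.arr 9 ∧ s'.arr 10 = s.arr 10) ∧
          (s.arr 9 x < v → s'.arr 9 = Function.update (s.arr 9) x v ∧
            s'.arr 10 = Function.update (s.arr 10) x b)) := by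
  have hCC : X.C ≤ X.C * X.C := Nat.le_mul_of_pos_left _ hC
  subst hb hh hτ hv
  simp only [advRecP, wp_seq]
  refine (advP_spec hL hC hbh hval).imp ?_
  rintro t1 s1 hs1 ⟨ht1, h19, h20, hrec, h6, h7, h8⟩
  have hL1 := hL.same hs1 (by simp [advP_wregs]) (by simp [advP_warrs])
  obtain ⟨hr1, ha1⟩ := hs1
  simp [advP_wregs, advP_warrs] at hr1 ha1
  have e11 : s1.reg 11 = s.reg 11 := by simp [hr1]
  have hsm := hsmall s1 hrec
  refine (keyP_spec hL1 hC (by rwa [e11])).imp ?_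
  rintro t2 s2 hs2 ⟨ht2, h21⟩
  obtain ⟨hr2, ha2⟩ := hs2
  simp [keyP_wregs, keyP_warrs] at hr2 ha2
  have hkey {s' : State} (h6 : s'.arr 6 = s2.arr 6) (h7 : s'.arr 7 = s2.arr 7)
      (h8 : s'.arr 8 = s2.arr 8) : keyAt X.C X.M s' (s.reg 11) = keyAt X.C X.M s1 (s.reg 11) := by
    refine Rec.Agree.keyAt_eq _ ⟨?_, ?_, ?_⟩ <;> intros <;> simp [recAt, h6, h7, h8, ha2]
  have hrec' {s' : State} (h6 : s'.arr 6 = s2.arr 6) (h7 : s'.arr 7 = s2.arr 7)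
      (h8 : s'.arr 8 = s2.arr 8) : (recAt X.C s' (s.reg 11)).Agree X.C
        (X.adv (s.reg 7) (recAt X.C s (s.reg 10))) := by
    refine Rec.Agree.trans ⟨?_, ?_, ?_⟩ hrec <;> intros <;> simp [recAt, h6, h7, h8, ha2]
  have e21 : s2.reg 21 = s.reg 6 + keyAt X.C X.M s1 (s.reg 11) := by
    rw [h21, e11]
    simp [hr1]
  have e20 : s2.reg 20 = numPos (X.adv (s.reg 7) (recAt X.C s (s.reg 10))).ag X.C := by
    simp [hr2, h20]
  have e19 : s2.reg 19 = X.gain (s.reg 7) (recAt X.C s (s.reg 10)) := by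
    simp [hr2, h19]
  have e0 : s2.arr 0 = X.cap := by simp [ha2, ha1, hL.cap]
  simp only [insertP, wp_ifLe, wp_seq, wp_set, wp_put, wp_skip]
  set k := keyAt X.C X.M s1 (s.reg 11) with hk
  have hbelow : ∀ p < s.reg 11, s2.arr 6 p = s.arr 6 p ∧ s2.arr 7 p = s.arr 7 p ∧
      s2.arr 8 p = s.arr 8 p := fun p hp => by
    simp [ha2, h6 p hp, h7 p hp, h8 p hp]
  constructor
  · intro hle
    simp [RExpr.eval, e20, e0, hr1, hr2] at hle
    constructor
    · intro hx
      simp [RExpr.eval, e21, ha2, ha1] at hx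
      constructor
      · intro hv
        simp [RExpr.eval, e21, ha2, ha1, hr2, hr1, h19] at hv
        refine ⟨?_, hrec' rfl rfl rfl, hbelow, ?_, ?_⟩
        · simp [RExpr.cost]
          omega
        · intro h
          omega
        · intro _
          rw [hkey (by simp) (by simp) (by simp)]
          refine ⟨fun h => ?_, fun x hx0 hx => ⟨?_, ?_, fun _ => ?_, fun h => ?_⟩⟩
          · omega
          · simp [hr1, hr2]
          · simp [ha1, ha2]
          · simp [ha1, ha2]
          · rw [hx] at hv
            omega
      · intro hv
        simp [RExpr.eval, e21, ha2, ha1, hr2, hr1, h19] at hv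
        refine ⟨?_, hrec' (by simp) (by simp) (by simp), by simpa using hbelow, ?_, ?_⟩
        · simp [RExpr.cost]
          omega
        · intro h
          omega
        · intro _
          rw [hkey (by simp) (by simp) (by simp)]
          refine ⟨fun h => ?_, fun x hx0 hx => ⟨?_, ?_, fun h => ?_, fun h => ?_⟩⟩
          · omega
          · simp [hr1, hr2]
          · simp [ha1, ha2]
          · rw [hx] at hv
            omega
          · simp [ha1, ha2, RExpr.eval, e21, hx, e19, hr1, hr2]
    · intro hx
      simp [RExpr.eval, e21, ha2, ha1] at hx
      refine ⟨?_, hrec' (by simp) (by simp) (by simp), by simpa using hbelow, ?_, ?_⟩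
      · simp [RExpr.cost]
        omega
      · intro h
        omega
      · intro _
        rw [hkey (by simp) (by simp) (by simp)]
        refine ⟨fun _ => ⟨?_, ?_, ?_, ?_⟩, fun x hx0 hx' => ?_⟩
        · simp [RExpr.eval, hr1, hr2, hL.D]
        · simp [RExpr.eval, hr1, hr2, ha1, ha2, h19]
        · simp [RExpr.eval, hr1, hr2, ha1, ha2]
        · simp [RExpr.eval, hr1, hr2, ha1, ha2, e21]
        · omega
  · intro hlt
    simp [RExpr.eval, e20, e0, hr1, hr2] at hlt
    refine ⟨?_, hrec' rfl rfl rfl, hbelow, fun _ => ⟨?_, ?_, ?_, ?_⟩, fun h => ?_⟩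
    · simp [RExpr.cost]
      omega
    · simp [hr1, hr2]
    · simp [ha1, ha2]
    · simp [ha1, ha2]
    · simp [ha1, ha2]
    · omega

/-- The number of agents and an empty slot of the source record. -/
def countP : RProg :=
  13 ::= lit 0 ;; 20 ::= lit 0 ;; 24 ::= lit 0 ;;
  whileLt (var 13) (var 2) (
    ifLe (get 6 (var 10 +ᵣ var 13)) (lit 0) (24 ::= var 13) (20 ::= var 20 +ᵣ lit 1) ;;
    13 ::= var 13 +ᵣ lit 1)

theorem countP_spec {X : Road} {s : State} (hL : Loaded X s) :
    Wp countP s fun t s' => t ≤ 30 * (X.C + 1) ∧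
      s'.reg 20 = numPos (recAt X.C s (s.reg 10)).ag X.C ∧
      s'.reg 24 = lastZero (recAt X.C s (s.reg 10)).ag X.C := by
  simp only [countP, wp_seq, wp_set]
  refine (wp_while (fun i s' => s'.reg 13 = i ∧
    s'.reg 20 = numPos (recAt X.C s (s.reg 10)).ag i ∧
    s'.reg 24 = lastZero (recAt X.C s (s.reg 10)).ag i) X.C 18 ?_ ?_ ?_).imp ?_
  · simp [RExpr.eval, numPos, lastZero]
  · rintro i s' hi ⟨hr, ha⟩ ⟨h13, h20, h24⟩
    simp [RProg.wregs, RProg.warrs] at hr ha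
    have hnum : numPos (recAt X.C s (s.reg 10)).ag (i + 1) =
        numPos (recAt X.C s (s.reg 10)).ag i + if s.arr 6 (s.reg 10 + i) = 0 then 0 else 1 :=
      Finset.sum_range_succ _ _
    have hlast : lastZero (recAt X.C s (s.reg 10)).ag (i + 1) = if s.arr 6 (s.reg 10 + i) = 0
        then i else lastZero (recAt X.C s (s.reg 10)).ag i := rfl
    simp [wp_seq, wp_set, wp_ifLe, RExpr.eval, RExpr.cost, hr, ha, h13, h20, h24, hi, hL.C, hnum,
      hlast]
    constructor <;> intro h0
    · simp [h0]
    · simp [h0.ne']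
  · rintro s' ⟨hr, ha⟩ ⟨h13, -⟩
    simp [RProg.wregs, RProg.warrs] at hr ha
    simp [RExpr.eval, hr, h13, hL.C]
  · rintro t s' - ⟨ht, -, h20, h24⟩
    simp [RExpr.cost] at ht ⊢
    exact ⟨by omega, h20, h24⟩

/-- Copy the agents and prices of the source record, with agent `reg 12` in slot `reg 24`. -/
def addRowsP : RProg :=
  13 ::= lit 0 ;;
  whileLt (var 13) (var 2) (
    put 6 (var 11 +ᵣ var 13) (get 6 (var 10 +ᵣ var 13)) ;;
    put 7 (var 11 +ᵣ var 13) (get 7 (var 10 +ᵣ var 13)) ;;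
    13 ::= var 13 +ᵣ lit 1) ;;
  put 6 (var 11 +ᵣ var 24) (var 12 +ᵣ lit 1) ;;
  put 7 (var 11 +ᵣ var 24) (lit 0)

theorem addRowsP_spec {X : Road} {s : State} (hL : Loaded X s) (hC : 1 ≤ X.C)
    (hbh : s.reg 10 + X.C * X.C ≤ s.reg 11)
    (hu : s.reg 24 = lastZero (recAt X.C s (s.reg 10)).ag X.C) :
    Wp addRowsP s fun t s' => t ≤ 100 * X.C ∧
      (∀ x < X.C, s'.arr 6 (s.reg 11 + x) =
        (X.add (s.reg 12) (recAt X.C s (s.reg 10))).ag x) ∧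
      (∀ x < X.C, s'.arr 7 (s.reg 11 + x) =
        (X.add (s.reg 12) (recAt X.C s (s.reg 10))).g x) ∧
      (∀ p < s.reg 11, s'.arr 6 p = s.arr 6 p) ∧ ∀ p < s.reg 11, s'.arr 7 p = s.arr 7 p := by
  have hCC : X.C ≤ X.C * X.C := Nat.le_mul_of_pos_left _ hC
  set h := s.reg 11 with hh
  simp only [addRowsP, wp_seq, wp_set]
  refine (wp_while (fun i s' => s'.reg 13 = i ∧
    (∀ x < i, s'.arr 6 (h + x) = (recAt X.C s (s.reg 10)).ag x) ∧
    (∀ x < i, s'.arr 7 (h + x) = (recAt X.C s (s.reg 10)).g x) ∧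
    (∀ p < h, s'.arr 6 p = s.arr 6 p) ∧ ∀ p < h, s'.arr 7 p = s.arr 7 p) X.C 25 ?_ ?_ ?_).imp ?_
  · simp [RExpr.eval]
  · rintro i s' hi ⟨hr, ha⟩ ⟨h13, h6, h7, h6b, h7b⟩
    simp [RProg.wregs, RProg.warrs] at hr ha
    simp [wp_seq, wp_set, wp_put, RExpr.eval, RExpr.cost, hr, h13, hi, hL.C, ← hh]
    refine ⟨fun x hx => forall_lt_update h6 ?_ x (by omega),
      fun x hx => forall_lt_update h7 ?_ x (by omega), forall_below_update h6b (by omega),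
      forall_below_update h7b (by omega)⟩
    · exact h6b _ (by omega)
    · exact h7b _ (by omega)
  · rintro s' ⟨hr, ha⟩ ⟨h13, -⟩
    simp [RProg.wregs, RProg.warrs] at hr ha
    simp [RExpr.eval, hr, h13, hL.C]
  · rintro t s' ⟨hr, ha⟩ ⟨ht, h13, h6, h7, h6b, h7b⟩
    simp [RProg.wregs, RProg.warrs] at hr ha
    simp [wp_put, RExpr.eval, RExpr.cost, hr, ← hh] at ht ⊢
    refine ⟨by omega, fun x hx => ?_, fun x hx => ?_, forall_below_update h6b (by omega),
      forall_below_update h7b (by omega)⟩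
    · rw [hu]
      simp only [Road.add, Function.update_apply, add_right_inj, h6 x hx]
    · rw [hu]
      simp only [Road.add, Function.update_apply, add_right_inj, h7 x hx]

/-- Add agent `reg 12`: an entry of the matrix. -/
def addCellP : RProg :=
  15 ::= get 6 (var 10 +ᵣ var 13) ;;
  16 ::= get 6 (var 10 +ᵣ var 14) ;;
  ifLe ((var 13 -ᵣ var 24) +ᵣ (var 24 -ᵣ var 13)) (lit 0)
    (ifLe (var 16) (lit 0) (put 8 (var 18) (get 3 (var 12)))
      (put 8 (var 18)
        (get 3 (var 12) -ᵣ (get 3 (var 12) -ᵣ get 3 (var 16 -ᵣ lit 1)))))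
    (ifLe (var 15) (lit 0) (put 8 (var 18) (lit 0))
      (ifLe ((var 14 -ᵣ var 24) +ᵣ (var 24 -ᵣ var 14)) (lit 0)
        (put 8 (var 18) (get 3 (var 15 -ᵣ lit 1) -ᵣ
          (get 3 (var 15 -ᵣ lit 1) -ᵣ (get 3 (var 12) +ᵣ get 7 (var 10 +ᵣ var 13)))))
        (put 8 (var 18) (get 8 (var 17)))))

/-- Add agent `reg 12` to the source record, if possible. -/
def addRecP : RProg :=
  countP ;;
  ifLe (var 20 +ᵣ lit 1) (get 0 (var 7))
    (ifLe (var 20 +ᵣ lit 1) (var 2)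
      (addRowsP ;; fillP addCellP ;;
        put 9 (var 11) (get 9 (var 10) +ᵣ get 3 (var 12)) ;;
        put 10 (var 11) (get 10 (var 10)) ;;
        11 ::= var 11 +ᵣ var 4)
      skip)
    skip

theorem addRecP_wregs : addRecP.wregs =
    [13, 20, 24, 24, 20, 13, 13, 13, 13, 17, 18, 14, 15, 16, 17, 18, 14, 13, 11] := rfl

theorem addRecP_warrs : addRecP.warrs = [6, 7, 6, 7, 8, 8, 8, 8, 8, 9, 10] := rfl

/-- Besides the capacity the number of slots is tested, which guarantees an empty slot. In the
cells, slots are compared by `x - u + (u - x)`, and minima are formed as `a - (a - b)`. -/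
theorem addRecP_spec {X : Road} {s : State} (hL : Loaded X s) (hC : 1 ≤ X.C)
    {b h : ℕ} {σ : Rec} (hb : s.reg 10 = b) (hh : s.reg 11 = h) (hbh : b + X.C * X.C ≤ h)
    (hσ : σ = recAt X.C s b) :
    Wp addRecP s fun t s' => t ≤ 1300 * (X.C * X.C) ∧ Below h s s' ∧
      (numPos σ.ag X.C < X.cap (s.reg 7) ∧ numPos σ.ag X.C < X.C →
        s'.reg 11 = h + X.C * X.C ∧ (recAt X.C s' h).Agree X.C (X.add (s.reg 12) σ) ∧
        s'.arr 9 h = s.arr 9 b + X.val (s.reg 12) ∧ s'.arr 10 h = s.arr 10 b) ∧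
      (¬ (numPos σ.ag X.C < X.cap (s.reg 7) ∧ numPos σ.ag X.C < X.C) → s'.reg 11 = h) := by
  have hCC : X.C ≤ X.C * X.C := Nat.le_mul_of_pos_left _ hC
  subst hb hh hσ
  simp only [addRecP, wp_seq]
  refine (countP_spec hL).imp ?_
  rintro t1 s1 hs1 ⟨ht1, h20, h24⟩
  have hL1 := hL.same hs1 (by simp [countP, RProg.wregs]) (by simp [countP, RProg.warrs])
  obtain ⟨hr1, ha1⟩ := hs1
  simp [countP, RProg.wregs, RProg.warrs] at hr1 ha1
  have hrec1 (b : ℕ) : recAt X.C s1 b = recAt X.C s b := by simp [recAt, ha1]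
  set n := numPos (recAt X.C s (s.reg 10)).ag X.C with hn
  simp only [wp_ifLe, wp_seq, wp_skip, wp_put, wp_set]
  have hskip : Below (s.reg 11) s s1 := fun b _ _ p _ => by rw [ha1]
  constructor
  · intro hcap
    simp [RExpr.eval, h20, hL1.cap, hr1] at hcap
    constructor
    · intro hnC
      simp [RExpr.eval, h20, hL1.C] at hnC
      refine (addRowsP_spec hL1 hC (by simpa [hr1] using hbh) ?_).imp ?_
      · rw [h24, hrec1]
        simp [hr1]
      rintro t2 s2 hs2 ⟨ht2, h6, h7, h6b, h7b⟩
      have hL2 := hL1.same hs2 (by simp [addRowsP, RProg.wregs]) (by simp [addRowsP, RProg.warrs])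
      obtain ⟨hr2, ha2⟩ := hs2
      simp [addRowsP, RProg.wregs, RProg.warrs] at hr2 ha2
      simp [hrec1, hr1] at h6 h7 h6b h7b
      refine (fillP_spec (T := 60) (φ := (X.add (s.reg 12) (recAt X.C s (s.reg 10))).f) hL2 hC
        (by simp [addCellP, RProg.wregs]) (by simp [addCellP, RProg.warrs]) ?_).imp ?_
      · rintro s3 x y hx hy ⟨hr3, ha3⟩ h13 h14 h17 h8b
        simp at hr3 ha3
        have e17 : s3.arr 8 (s3.reg 17) = (recAt X.C s (s.reg 10)).f x y := by
          have : x * X.C + y < X.C * X.C := by nlinarith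
          rw [h17, h8b _ (by simp [hr2, hr1]; omega)]
          simp [hr1, ha1, hr2, ha2, recAt]
        have ex : s3.arr 6 (s3.reg 10 + x) = (recAt X.C s (s.reg 10)).ag x := by
          simp [ha3, hr3, hr2, hr1]
          rw [h6b _ (by omega), ha1]
          rfl
        have ey : s3.arr 6 (s3.reg 10 + y) = (recAt X.C s (s.reg 10)).ag y := by
          simp [ha3, hr3, hr2, hr1]
          rw [h6b _ (by omega), ha1]
          rfl
        have eg : s3.arr 7 (s3.reg 10 + x) = (recAt X.C s (s.reg 10)).g x := by
          simp [ha3, hr3, hr2, hr1]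
          rw [h7b _ (by omega), ha1]
          rfl
        have e24 : s3.reg 24 = lastZero (recAt X.C s (s.reg 10)).ag X.C := by
          simp [hr3, hr2, h24]
        have e12 : s3.reg 12 = s.reg 12 := by simp [hr3, hr2, hr1]
        have e3 : s3.arr 3 = X.val := by simp [ha3, hL2.val]
        generalize recAt X.C s (s.reg 10) = σ at e17 ex ey eg e24 ⊢
        set u := lastZero σ.ag X.C with hu
        have hsub (p q : ℕ) : p - q + (q - p) = 0 ↔ p = q := by omega
        simp [addCellP, wp_seq, wp_set, wp_ifLe, wp_put, RExpr.eval, RExpr.cost, h13, h14, ex, ey,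
          e17, eg, e24, e12, e3]
        by_cases hxu : x = u
        · by_cases hy0 : σ.ag y = 0
          · simp [Road.add, ← hu, hxu, hy0]
          · simp [Road.add, ← hu, hxu, hy0, Nat.sub_sub_eq_min]
        · have h1 : x - u = 0 → ¬ u - x = 0 := by omega
          have h2 : 0 < x - u ∨ 0 < u - x := by omega
          by_cases hx0 : σ.ag x = 0
          · simp [Road.add, ← hu, hxu, hx0]
            omega
          · have h3 : 0 < σ.ag x := by omega
            by_cases hyu : y = u
            · simp [Road.add, ← hu, hxu, hx0, hyu, Nat.sub_sub_eq_min]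
              omega
            · have h4 : y - u = 0 → ¬ u - y = 0 := by omega
              simp [Road.add, ← hu, hxu, hx0, hyu]
              omega
      · rintro t3 s3 ⟨hr3, ha3⟩ ⟨ht3, k8, k8b⟩
        simp [fillP, addCellP, RProg.wregs, RProg.warrs] at hr3 ha3
        simp [hr1, hr2, ha1, ha2] at k8 k8b
        refine ⟨?_, ?_, fun _ => ⟨?_, ⟨?_, ?_, ?_⟩, ?_, ?_⟩, fun h => absurd ⟨hcap, hnC⟩ h⟩
        · simp [RExpr.cost]
          omega
        · intro b hb1 hb2 p hp
          simp [RExpr.eval, hr3, hr2, hr1]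
          interval_cases b
          · simp [ha3, h6b p hp, ha1]
          · simp [ha3, h7b p hp, ha1]
          · simp [k8b p hp]
          · simp [ha3, ha2, ha1, Function.update_of_ne hp.ne]
          · simp [ha3, ha2, ha1, Function.update_of_ne hp.ne]
        · simp [RExpr.eval, hr3, hr2, hr1, hL.D]
        · intro x hx
          simpa [recAt, ha3] using h6 x hx
        · intro x hx
          simpa [recAt, ha3] using h7 x hx
        · intro x hx y hy
          simpa [recAt] using k8 x hx y hy
        · simp [RExpr.eval, hr3, hr2, hr1, ha3, ha2, ha1, hL.val]
        · simp [RExpr.eval, hr3, hr2, hr1, ha3, ha2, ha1]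
    · intro hnC
      simp [RExpr.eval, h20, hL1.C] at hnC
      refine ⟨?_, hskip, fun h => ?_, fun _ => by simp [hr1]⟩
      · simp [RExpr.cost]
        omega
      · omega
  · intro hcap
    simp [RExpr.eval, h20, hL1.cap, hr1] at hcap
    refine ⟨?_, hskip, fun h => ?_, fun _ => by simp [hr1]⟩
    · simp [RExpr.cost]
      omega
    · omega

/-! ### Lists of records -/

theorem recAt_agree {h C : ℕ} {s s' : State}
    (hs : ∀ p < h, s'.arr 6 p = s.arr 6 p ∧ s'.arr 7 p = s.arr 7 p ∧ s'.arr 8 p = s.arr 8 p)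
    {b : ℕ} (hb : b + C * C ≤ h) : (recAt C s' b).Agree C (recAt C s b) := by
  have hx {x : ℕ} (hx : x < C) : b + x < h := by
    have : C ≤ C * C := Nat.le_mul_of_pos_left _ (by omega)
    omega
  refine ⟨fun x h1 => (hs _ (hx h1)).1, fun x h1 => (hs _ (hx h1)).2.1, fun x h1 y h2 => ?_⟩
  have : x * C + y < C * C := by nlinarith
  exact (hs _ (by omega)).2.2

namespace Road

variable {X : Road}

theorem Good.transfer {s s' : State} {e k h b : ℕ} (hg : X.Good s e k h b) (hX : X.Roomy)
    (hb : Below h s s') (hrec : (recAt X.C s' b).Agree X.C (recAt X.C s b))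
    (h9 : s'.arr 9 b = s.arr 9 b) (h10 : s'.arr 10 b = s.arr 10 b) : X.Good s' e k h b := by
  obtain ⟨W, h1, h2, h3, h4, h5⟩ := hg
  exact ⟨W, h1, h2, hrec.trans h3, h9.trans h4, h10 ▸ h5.below hX le_rfl hb⟩

variable (X) in
/-- The `N` records from position `lo` describe the sets of winners, when the agents below `k` have
been decided at item `e`. -/
structure Level (s : State) (e k lo N : ℕ) : Prop where
  good : ∀ j < N, X.Good s e k lo (lo + j * (X.C * X.C))
  complete : ∀ W, X.Feasible W → ∃ j < N,
    (recAt X.C s (lo + j * (X.C * X.C))).Agree X.C (X.run W e k).1 ∧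
      (X.run W e k).2 ≤ s.arr 9 (lo + j * (X.C * X.C))
  inj : ∀ i < N, ∀ j < N, (recAt X.C s (lo + i * (X.C * X.C))).Agree X.C
    (recAt X.C s (lo + j * (X.C * X.C))) → i = j

theorem Chain.congr_arr {s s' : State} {W : Finset ℕ} {h e b : ℕ} (hc : X.Chain s W h e b)
    (ha : s'.arr = s.arr) : X.Chain s' W h e b := by
  cases s
  cases s'
  subst ha
  induction e generalizing b with
  | zero => trivial
  | succ e ih => exact ⟨hc.1, hc.2.1, ih hc.2.2⟩

theorem Good.congr_arr {s s' : State} {e k h b : ℕ} (hg : X.Good s e k h b)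
    (ha : s'.arr = s.arr) : X.Good s' e k h b := by
  obtain ⟨W, h1, h2, h3, h4, h5⟩ := hg
  refine ⟨W, h1, h2, ?_, ?_, ?_⟩
  · simpa only [recAt, ha] using h3
  · rw [ha, h4]
  · rw [ha]
    exact h5.congr_arr ha

theorem Level.congr_arr {s s' : State} {e k lo N : ℕ} (h : X.Level s e k lo N)
    (ha : s'.arr = s.arr) : X.Level s' e k lo N := by
  have hrec (b : ℕ) : recAt X.C s' b = recAt X.C s b := by simp only [recAt, ha]
  refine ⟨fun j hj => (h.good j hj).congr_arr ha, fun W hW => ?_, fun i hi j hj hij => ?_⟩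
  · rw [ha]
    simpa only [hrec] using h.complete W hW
  · rw [hrec, hrec] at hij
    exact h.inj i hi j hj hij

theorem feasible_empty : X.Feasible ∅ := ⟨by simp, by simp, by simp⟩

theorem Level.pos {s : State} {e k lo N : ℕ} (h : X.Level s e k lo N) : 1 ≤ N := by
  obtain ⟨j, hj, -⟩ := h.complete ∅ feasible_empty
  omega

/-- Subtracting 1 could only confuse 0 with 1. In an occupied slot `f` is positive, and whether `g`
is zero is decided by the first item of the agent; in an empty slot all entries vanish. -/
theorem Describes.agree_of_code {W W' : Finset ℕ} {e k : ℕ} {σ τ : Rec}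
    (hσ : X.Describes W e k σ) (hτ : X.Describes W' e k τ) (hM : 1 ≤ X.M)
    (hW : ∀ i ∈ W, 1 ≤ X.val i) (hW' : ∀ i ∈ W', 1 ≤ X.val i)
    (hag : ∀ x < X.C, σ.ag x = τ.ag x) (hg : ∀ x < X.C, σ.g x - 1 = τ.g x - 1)
    (hf : ∀ x < X.C, ∀ y < X.C, σ.f x y - 1 = τ.f x y - 1) : σ.Agree X.C τ := by
  have key {W : Finset ℕ} {σ : Rec} (hσ : X.Describes W e k σ) (hW : ∀ i ∈ W, 1 ≤ X.val i)
      {x i : ℕ} (hx : x < X.C) (hi : σ.ag x = i + 1) :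
      (X.fst i < e → 1 ≤ σ.g x) ∧ (¬ X.fst i < e → σ.g x = 0) ∧ ∀ y < X.C, 1 ≤ σ.f x y := by
    have hval := hW i (Finset.mem_filter.1 (hσ.mem x hx i hi)).1
    refine ⟨fun h => ?_, fun h => ?_, fun y hy => ?_⟩
    · rw [hσ.g_eq x hx i hi]
      exact le_min hval (one_le_price_Ico hM hW h)
    · rw [hσ.g_eq x hx i hi, Finset.Ico_eq_empty h, price_empty, Nat.min_zero]
    · rcases Nat.eq_zero_or_eq_succ_pred (σ.ag y) with h0 | h0
      · rw [hσ.f_empty x hx i hi y hy h0]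
        exact hval
      · rw [hσ.f_eq x hx i hi y hy _ h0]
        have := hW _ (Finset.mem_filter.1 (hσ.mem y hy _ h0)).1
        exact le_min hval (by omega)
  refine ⟨hag, fun x hx => ?_, fun x hx y hy => ?_⟩
  all_goals rcases Nat.eq_zero_or_eq_succ_pred (σ.ag x) with h0 | h0
  · rw [hσ.g_zero x hx h0, hτ.g_zero x hx (hag x hx ▸ h0)]
  · obtain ⟨h1, h2, -⟩ := key hσ hW hx h0
    obtain ⟨h3, h4, -⟩ := key hτ hW' hx ((hag x hx).symm.trans h0)
    have := hg x hx
    by_cases hlt : X.fst (σ.ag x).pred < e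
    · have := h1 hlt
      have := h3 hlt
      omega
    · rw [h2 hlt, h4 hlt]
  · rw [hσ.f_zero x hx h0 y hy, hτ.f_zero x hx (hag x hx ▸ h0) y hy]
  · have h1 := (key hσ hW hx h0).2.2 y hy
    have h2 := (key hτ hW' hx ((hag x hx).symm.trans h0)).2.2 y hy
    have := hf x hx y hy
    omega

/-- The number of records of a list. -/
theorem Level.card_le {s : State} {e k lo N : ℕ} (h : X.Level s e k lo N) (hX : X.Roomy)
    {B : ℕ} (hB : 1 ≤ B) (hval : ∀ i < X.m, X.val i ≤ B) :
    N ≤ (X.m + 1) ^ X.C * (B ^ X.C * (B ^ X.C) ^ X.C) := by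
  have hd (j : Fin N) := (h.good j j.2).describes hX
  choose W hW1 hW2 hW3 using hd
  have hag (j : Fin N) (x : Fin X.C) :
      (recAt X.C s (lo + j * (X.C * X.C))).ag x < X.m + 1 := by
    rcases Nat.eq_zero_or_eq_succ_pred ((recAt X.C s (lo + j * (X.C * X.C))).ag x) with h0 | h0
    · omega
    · have := (hW1 j).lt _ (Finset.mem_filter.1 ((hW3 j).mem x x.2 _ h0)).1
      omega
  have hg (j : Fin N) (x : Fin X.C) :
      (recAt X.C s (lo + j * (X.C * X.C))).g x - 1 < B := by
    rcases Nat.eq_zero_or_eq_succ_pred ((recAt X.C s (lo + j * (X.C * X.C))).ag x) with h0 | h0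
    · rw [(hW3 j).g_zero x x.2 h0]
      omega
    · have h1 := hval _ ((hW1 j).lt _ (Finset.mem_filter.1 ((hW3 j).mem x x.2 _ h0)).1)
      have h2 := (hW3 j).g_eq x x.2 _ h0
      have h3 := min_le_left (X.val ((recAt X.C s (lo + j * (X.C * X.C))).ag x).pred)
        (X.price (W j) (Finset.Ico (X.fst ((recAt X.C s (lo + j * (X.C * X.C))).ag x).pred) e))
      omega
  have hf (j : Fin N) (x y : Fin X.C) :
      (recAt X.C s (lo + j * (X.C * X.C))).f x y - 1 < B := by
    rcases Nat.eq_zero_or_eq_succ_pred ((recAt X.C s (lo + j * (X.C * X.C))).ag x) with h0 | h0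
    · rw [(hW3 j).f_zero x x.2 h0 y y.2]
      omega
    · have h1 := hval _ ((hW1 j).lt _ (Finset.mem_filter.1 ((hW3 j).mem x x.2 _ h0)).1)
      have h2 := (hW3 j).f_le x.2 y.2 h0
      omega
  -- The code of a record: `m + 1` possible entries per slot for the agent and `B` for each
  -- decremented price.
  have hinj : Function.Injective fun j : Fin N =>
      ((fun x => ⟨_, hag j x⟩, fun x => ⟨_, hg j x⟩, fun x y => ⟨_, hf j x y⟩) :
        (Fin X.C → Fin (X.m + 1)) × (Fin X.C → Fin B) × (Fin X.C → Fin X.C → Fin B)) := by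
    intro i j hij
    simp only [Prod.mk.injEq, funext_iff, Fin.mk.injEq] at hij
    obtain ⟨h1, h2, h3⟩ := hij
    refine Fin.ext (h.inj i i.2 j j.2 ((hW3 i).agree_of_code (hW3 j) ?_ (hW1 i).pos (hW1 j).pos
      (fun x hx => h1 ⟨x, hx⟩) (fun x hx => h2 ⟨x, hx⟩) fun x hx y hy => h3 ⟨x, hx⟩ ⟨y, hy⟩))
    have := hX.sum_lt
    omega
  simpa using Fintype.card_le_of_injective _ hinj

theorem Level.skip {s : State} {e k lo N : ℕ} (h : X.Level s e k lo N)
    (hk : ¬ (X.fst k = e ∧ 1 ≤ X.val k)) : X.Level s e (k + 1) lo N := by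
  refine ⟨fun j hj => (h.good j hj).succ, fun W hW => ?_, h.inj⟩
  rw [run_succ, if_neg fun h => hk ⟨h.1, hW.pos k h.2⟩]
  exact h.complete W hW

/-- Add agent `reg 12` to the records of the list. -/
def _root_.HighwayPricing.addAgentP : RProg :=
  25 ::= var 9 ;; 10 ::= var 8 ;; 11 ::= var 9 ;;
  whileLt (var 10) (var 25) (addRecP ;; 10 ::= var 10 +ᵣ var 4) ;;
  9 ::= var 11

theorem _root_.HighwayPricing.addAgentP_wregs : addAgentP.wregs =
    [25, 10, 11] ++ (addRecP.wregs ++ [10] ++ [9]) := rfl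

theorem _root_.HighwayPricing.addAgentP_warrs : addAgentP.warrs = addRecP.warrs ++ [] ++ [] := rfl

/-- The old records stay, for the sets without `k`, and the extended ones are appended. No search
for repetitions is needed because the addition is injective. -/
theorem addAgentP_spec {s : State} (hX : X.Roomy) (hL : Loaded X s) {e k lo N : ℕ}
    (h : X.Level s e k lo N) (hk : X.fst k = e) (hkm : k < X.m) (hkv : 1 ≤ X.val k)
    (h7 : s.reg 7 = e) (h8 : s.reg 8 = lo) (h9 : s.reg 9 = lo + N * (X.C * X.C))
    (h12 : s.reg 12 = k) :
    Wp addAgentP s fun t s' => t ≤ (N + 1) * (1320 * (X.C * X.C)) ∧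
      ∃ N', s'.reg 9 = lo + N' * (X.C * X.C) ∧ X.Level s' e (k + 1) lo N' := by
  have hD : 1 ≤ X.C * X.C := Nat.mul_le_mul hX.one_le hX.one_le
  set D := X.C * X.C with hDdef
  simp only [addAgentP, wp_seq, wp_set]
  have hL0 : Loaded X (((s.setReg 25 (eval s (var 9))).setReg 10
      (eval (s.setReg 25 (eval s (var 9))) (var 8))).setReg 11
      (eval ((s.setReg 25 (eval s (var 9))).setReg 10
        (eval (s.setReg 25 (eval s (var 9))) (var 8))) (var 9))) :=
    hL.same (R := [25, 10, 11]) (A := [])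
      ⟨fun x hx => by simp at hx; simp [hx], fun _ _ => rfl⟩ (by simp) (by simp)
  refine (wp_while (fun j s' => s'.reg 10 = lo + j * D ∧ Below (lo + N * D) s s' ∧
    ∃ N', s'.reg 11 = lo + (N + N') * D ∧
      (∀ i < N', X.Good s' e (k + 1) lo (lo + (N + i) * D)) ∧
      (∀ j' < j, numPos (recAt X.C s (lo + j' * D)).ag X.C < X.cap e ∧
        numPos (recAt X.C s (lo + j' * D)).ag X.C < X.C → ∃ i < N',
          (recAt X.C s' (lo + (N + i) * D)).Agree X.C (X.add k (recAt X.C s (lo + j' * D))) ∧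
          s'.arr 9 (lo + (N + i) * D) = s.arr 9 (lo + j' * D) + X.val k) ∧
      (∀ i < N', ∃ j' < j, numPos (recAt X.C s (lo + j' * D)).ag X.C < X.C ∧
        (recAt X.C s' (lo + (N + i) * D)).Agree X.C (X.add k (recAt X.C s (lo + j' * D)))) ∧
      ∀ i < N', ∀ i' < N', (recAt X.C s' (lo + (N + i) * D)).Agree X.C
        (recAt X.C s' (lo + (N + i') * D)) → i = i') N (1305 * D) ?_ ?_ ?_).imp ?_
  · refine ⟨by simp [RExpr.eval, h8], fun _ _ _ _ _ => rfl, 0, by simp [RExpr.eval, h9], ?_⟩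
    simp
  · rintro j s1 hj hs1 ⟨k10, hbel, N', k11, hgood, hcov, horig, hinj⟩
    have hL1 : Loaded X s1 := hL0.same hs1
      (by simp [RProg.wregs, addRecP_wregs]) (by simp [RProg.warrs, addRecP_warrs])
    obtain ⟨hr1, -⟩ := hs1
    simp [RProg.wregs, addRecP_wregs] at hr1
    have hjD : lo + j * D + D ≤ lo + N * D := by
      have := Nat.mul_le_mul_right D (Nat.succ_le_of_lt hj)
      rw [Nat.succ_mul] at this
      omega
    have hND : lo + N * D ≤ lo + (N + N') * D := by
      have := Nat.mul_le_mul_right D (Nat.le_add_right N N')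
      omega
    have e25 : s1.reg 25 = lo + N * D := by simp [hr1, RExpr.eval, h9]
    have hrec := hbel.recAt (C := X.C) hjD
    constructor
    · simp only [RExpr.eval, k10, e25]
      omega
    simp only [wp_seq, wp_set]
    refine (addRecP_spec hL1 hX.one_le k10 k11 (hjD.trans hND) rfl).imp ?_
    rintro t s2 ⟨hr2, -⟩ ⟨ht, hbel2, hyes, hno⟩
    simp [addRecP_wregs] at hr2
    have e7 : s1.reg 7 = e := by simp [hr1, h7]
    have e12 : s1.reg 12 = k := by simp [hr1, h12]
    rw [hrec.numPos_eq, e7, e12] at hyes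
    rw [hrec.numPos_eq, e7] at hno
    have hbel' := hbel.trans (hbel2.mono hND)
    refine ⟨by simp [RExpr.cost]; omega, ?_⟩
    simp only [State.setReg_reg, State.setReg_arr, if_true, RExpr.eval]
    refine ⟨by simp [hr2, k10, hL1.D]; ring, hbel', ?_⟩
    have hg1 : X.Good s1 e k lo (lo + j * D) :=
      (h.good j hj).below hX hbel (by omega) (by omega)
    have hiD {i : ℕ} (hi : i < N') : lo + (N + i) * D + D ≤ lo + (N + N') * D := by
      have := Nat.mul_le_mul_right D (Nat.succ_le_of_lt (Nat.add_lt_add_left hi N))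
      rw [Nat.succ_mul] at this
      omega
    have hrec2 {i : ℕ} (hi : i < N') : (recAt X.C s2 (lo + (N + i) * D)).Agree X.C
        (recAt X.C s1 (lo + (N + i) * D)) := hbel2.recAt (hiD hi)
    have hgood2 : ∀ i < N', X.Good s2 e (k + 1) lo (lo + (N + i) * D) := fun i hi =>
      (hgood i hi).below hX hbel2 (hiD hi) (by omega)
    have hval2 {i : ℕ} (hi : i < N') : s2.arr 9 (lo + (N + i) * D) = s1.arr 9 (lo + (N + i) * D) :=
      hbel2 9 (by omega) (by omega) _ (by have := hiD hi; omega)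
    have hcov2 : ∀ j' < j, numPos (recAt X.C s (lo + j' * D)).ag X.C < X.cap e ∧
        numPos (recAt X.C s (lo + j' * D)).ag X.C < X.C → ∃ i < N',
          (recAt X.C s2 (lo + (N + i) * D)).Agree X.C (X.add k (recAt X.C s (lo + j' * D))) ∧
          s2.arr 9 (lo + (N + i) * D) = s.arr 9 (lo + j' * D) + X.val k := by
      intro j' hj' hn
      obtain ⟨i, hi, h1, h2⟩ := hcov j' hj' hn
      exact ⟨i, hi, (hrec2 hi).trans h1, (hval2 hi).trans h2⟩
    have hinj2 : ∀ i < N', ∀ i' < N', (recAt X.C s2 (lo + (N + i) * D)).Agree X.C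
        (recAt X.C s2 (lo + (N + i') * D)) → i = i' := fun i hi i' hi' hii =>
      hinj i hi i' hi' ((hrec2 hi).symm.trans (hii.trans (hrec2 hi')))
    have h9j : s1.arr 9 (lo + j * D) = s.arr 9 (lo + j * D) :=
      hbel 9 (by omega) (by omega) _ (by omega)
    by_cases hn : numPos (recAt X.C s (lo + j * D)).ag X.C < X.cap e ∧
        numPos (recAt X.C s (lo + j * D)).ag X.C < X.C
    · obtain ⟨l11, lrec, l9, l10⟩ := hyes hn
      have hadd : (recAt X.C s2 (lo + (N + N') * D)).Agree X.C
          (X.add k (recAt X.C s (lo + j * D))) := lrec.trans (hrec.add k)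
      -- Agreeing extensions have agreeing sources, hence the same source in a list without
      -- repetitions.
      have hne : ∀ i < N', ¬ (recAt X.C s2 (lo + (N + i) * D)).Agree X.C
          (recAt X.C s2 (lo + (N + N') * D)) := by
        intro i hi hii
        obtain ⟨j', hj', hn', h1⟩ := horig i hi
        obtain ⟨W1, -, -, hd1⟩ := (h.good j' (by omega)).describes hX
        obtain ⟨W2, -, -, hd2⟩ := (h.good j hj).describes hX
        have := agree_of_add_agree hd1 hd2 hk hn' hn.2
          (h1.symm.trans ((hrec2 hi).symm.trans (hii.trans hadd)))
        have := h.inj j' (by omega) j hj this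
        omega
      refine ⟨N' + 1, ?_, fun i hi => ?_, fun j' hj' hn' => ?_, fun i hi => ?_,
        fun i hi i' hi' hii => ?_⟩
      · simp [l11]
        ring
      · rcases (Nat.lt_succ_iff.1 hi).lt_or_eq with hi | rfl
        · exact (hgood2 i hi).congr_arr rfl
        · exact hg1.add hX hk hkm hkv (hbel2.mono (by omega)) (by rw [hrec.numPos_eq]; exact hn.1)
            lrec l9 l10
      · rcases (Nat.lt_succ_iff.1 hj').lt_or_eq with hj' | rfl
        · obtain ⟨i, hi, h1⟩ := hcov2 j' hj' hn'
          exact ⟨i, by omega, h1⟩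
        · exact ⟨N', by omega, hadd, by rw [l9, h9j]⟩
      · rcases (Nat.lt_succ_iff.1 hi).lt_or_eq with hi | rfl
        · obtain ⟨j', hj', h1, h2⟩ := horig i hi
          exact ⟨j', by omega, h1, (hrec2 hi).trans h2⟩
        · exact ⟨j, by omega, hn.2, hadd⟩
      · rcases (Nat.lt_succ_iff.1 hi).lt_or_eq with hi | rfl <;>
          rcases (Nat.lt_succ_iff.1 hi').lt_or_eq with hi' | rfl
        · exact hinj2 i hi i' hi' hii
        · exact absurd hii (hne i hi)
        · exact absurd hii.symm (hne i' hi')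
        · rfl
    · refine ⟨N', by simp [hno hn], fun i hi => (hgood2 i hi).congr_arr rfl,
        fun j' hj' hn' => ?_, fun i hi => ?_, hinj2⟩
      · rcases (Nat.lt_succ_iff.1 hj').lt_or_eq with hj' | rfl
        · exact hcov2 j' hj' hn'
        · exact absurd hn' hn
      · obtain ⟨j', hj', h1, h2⟩ := horig i hi
        exact ⟨j', by omega, h1, (hrec2 hi).trans h2⟩
  · rintro s1 ⟨hr1, -⟩ ⟨k10, -⟩
    simp [RProg.wregs, addRecP_wregs] at hr1
    simp [RExpr.eval, k10, hr1, h9]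
  · rintro t s1 - ⟨ht, k10, hbel, N', k11, hgood, hcov, horig, hinj⟩
    constructor
    · simp [RExpr.cost] at ht ⊢
      have : (N + 1) * (1305 * D + 1 + 1 + 1) + 8 ≤ (N + 1) * (1320 * D) := by
        nlinarith [Nat.mul_le_mul_left (N + 1) hD]
      omega
    refine ⟨N + N', by simp [RExpr.eval, k11], Level.congr_arr (s := s1) ?_ rfl⟩
    have hjD {j : ℕ} (hj : j < N) : lo + j * D + D ≤ lo + N * D := by
      have := Nat.mul_le_mul_right D (Nat.succ_le_of_lt hj)
      rw [Nat.succ_mul] at this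
      omega
    have hrec {j : ℕ} (hj : j < N) := hbel.recAt (C := X.C) (hjD hj)
    -- An extended record holds `k`, an old one does not.
    have hne {i j : ℕ} (hi : i < N') (hj : j < N) : ¬ (recAt X.C s1 (lo + (N + i) * D)).Agree X.C
        (recAt X.C s1 (lo + j * D)) := by
      intro hij
      obtain ⟨j', hj', hn', h1⟩ := horig i hi
      obtain ⟨W, -, -, hd⟩ := (h.good j hj).describes hX
      have hu := (lastZero_spec (exists_eq_zero_of_numPos_lt hn')).1
      have h2 := ((hrec hj).symm.trans (hij.symm.trans h1)).ag _ hu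
      simp only [Road.add, Function.update_self] at h2
      exact not_mem_active W hk (hd.mem _ hu k h2)
    refine ⟨fun j hj => ?_, fun W hW => ?_, fun i hi j hj hij => ?_⟩
    · rcases lt_or_ge j N with hjN | hjN
      · exact ((h.good j hjN).below hX hbel (hjD hjN) (by omega)).succ
      · obtain ⟨i, rfl⟩ := Nat.exists_eq_add_of_le hjN
        exact hgood i (by omega)
    · obtain ⟨j, hj, h1, h2⟩ := h.complete W hW
      rw [run_succ]
      split_ifs with hkW
      · have hd := (describes_run hX.toValid (hW.fits hX e) k).agree h1
        -- For a feasible set that contains `k` both tests of the program succeed, since the set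
        -- leaves a copy and a slot for her.
        have hlt := active_card_lt hX.toValid hk hkW.2 hkm
        have hen : e < X.n := hk ▸ (hX.le k hkm).trans_lt (hX.lt k hkm)
        have hn := hd.numPos_eq
        obtain ⟨i, hi, h3, h4⟩ := hcov j hj ⟨hn.trans_lt (hlt.trans_le (hW.card_le e hen)),
          hn.trans_lt (hlt.trans_le ((hW.fits hX e).card_le e le_rfl))⟩
        exact ⟨N + i, by omega, h3.trans (h1.add k), (Nat.add_le_add_right h2 _).trans_eq h4.symm⟩
      · exact ⟨j, by omega, (hrec hj).trans h1, h2.trans_eq (hbel 9 (by omega) (by omega)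
          (lo + j * D) (by have := hjD hj; omega)).symm⟩
    · rcases lt_or_ge i N with hiN | hiN <;> rcases lt_or_ge j N with hjN | hjN
      · exact h.inj i hiN j hjN ((hrec hiN).symm.trans (hij.trans (hrec hjN)))
      · obtain ⟨j, rfl⟩ := Nat.exists_eq_add_of_le hjN
        exact absurd hij.symm (hne (by omega) hiN)
      · obtain ⟨i, rfl⟩ := Nat.exists_eq_add_of_le hiN
        exact absurd hij (hne (by omega) hjN)
      · obtain ⟨i, rfl⟩ := Nat.exists_eq_add_of_le hiN
        obtain ⟨j, rfl⟩ := Nat.exists_eq_add_of_le hjN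
        rw [hinj i (by omega) j (by omega) hij]

end Road

/-! ### Proceeding to the next item -/

theorem add_mul_add_le {D i N lo : ℕ} (hi : i < N) : lo + i * D + D ≤ lo + N * D := by
  have := Nat.mul_le_mul_right D (Nat.succ_le_of_lt hi)
  rw [Nat.succ_mul] at this
  omega

namespace Road

variable {X : Road}

variable (X) in
/-- The first `j` records of a list in state `s` have led to `N'` records in state `s'`, that are
stored behind the list. -/
structure Sieve (s s' : State) (e lo N j N' : ℕ) : Prop where
  below : Below (lo + N * (X.C * X.C)) s s'
  good : ∀ i < N', X.Good s' (e + 1) 0 (lo + N * (X.C * X.C))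
    (lo + N * (X.C * X.C) + i * (X.C * X.C))
  cover : ∀ j' < j, numPos (X.adv (e + 1) (recAt X.C s (lo + j' * (X.C * X.C)))).ag X.C ≤
    X.cap (e + 1) → ∃ i < N', (recAt X.C s' (lo + N * (X.C * X.C) + i * (X.C * X.C))).Agree X.C
      (X.adv (e + 1) (recAt X.C s (lo + j' * (X.C * X.C)))) ∧
      s.arr 9 (lo + j' * (X.C * X.C)) + X.gain (e + 1) (recAt X.C s (lo + j' * (X.C * X.C))) ≤
        s'.arr 9 (lo + N * (X.C * X.C) + i * (X.C * X.C))
  key : ∀ i < N', s'.arr 12 (s.reg 6 + keyAt X.C X.M s' (lo + N * (X.C * X.C) + i * (X.C * X.C))) =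
    lo + N * (X.C * X.C) + i * (X.C * X.C)
  of_ne_zero : ∀ p, s.reg 6 ≤ p → s'.arr 12 p ≠ 0 → ∃ i < N',
    p = s.reg 6 + keyAt X.C X.M s' (lo + N * (X.C * X.C) + i * (X.C * X.C))

namespace Sieve

variable {s s₁ s₂ : State} {e lo N j N' : ℕ}

theorem congr_arr (h : X.Sieve s s₁ e lo N j N') (ha : s₂.arr = s₁.arr) :
    X.Sieve s s₂ e lo N j N' := by
  have hk (b : ℕ) : keyAt X.C X.M s₂ b = keyAt X.C X.M s₁ b := by simp only [keyAt, digitAt, ha]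
  have hrec (b : ℕ) : recAt X.C s₂ b = recAt X.C s₁ b := by simp only [recAt, ha]
  refine ⟨?_, fun i hi => (h.good i hi).congr_arr ha, ?_, ?_, ?_⟩
  · simpa only [Below, ha] using h.below
  · simpa only [ha, hrec] using h.cover
  · simpa only [ha, hk] using h.key
  · simpa only [ha, hk] using h.of_ne_zero

theorem rec_agree (hlow : ∀ p < lo + N * (X.C * X.C) + N' * (X.C * X.C),
      s₂.arr 6 p = s₁.arr 6 p ∧ s₂.arr 7 p = s₁.arr 7 p ∧ s₂.arr 8 p = s₁.arr 8 p)
    {i : ℕ} (hi : i < N') : (recAt X.C s₂ (lo + N * (X.C * X.C) + i * (X.C * X.C))).Agree X.C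
      (recAt X.C s₁ (lo + N * (X.C * X.C) + i * (X.C * X.C))) :=
  recAt_agree hlow (add_mul_add_le hi)

/-- A record that is not possible at the next item is dropped. -/
theorem drop (h : X.Sieve s s₁ e lo N j N') (hX : X.Roomy)
    (hlow : ∀ p < lo + N * (X.C * X.C) + N' * (X.C * X.C),
      s₂.arr 6 p = s₁.arr 6 p ∧ s₂.arr 7 p = s₁.arr 7 p ∧ s₂.arr 8 p = s₁.arr 8 p)
    (h9 : s₂.arr 9 = s₁.arr 9) (h10 : s₂.arr 10 = s₁.arr 10) (h12 : s₂.arr 12 = s₁.arr 12)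
    (hcov : numPos (X.adv (e + 1) (recAt X.C s (lo + j * (X.C * X.C)))).ag X.C ≤ X.cap (e + 1) →
      ∃ i < N', (recAt X.C s₁ (lo + N * (X.C * X.C) + i * (X.C * X.C))).Agree X.C
        (X.adv (e + 1) (recAt X.C s (lo + j * (X.C * X.C)))) ∧
      s.arr 9 (lo + j * (X.C * X.C)) + X.gain (e + 1) (recAt X.C s (lo + j * (X.C * X.C))) ≤
        s₁.arr 9 (lo + N * (X.C * X.C) + i * (X.C * X.C))) :
    X.Sieve s s₂ e lo N (j + 1) N' := by
  have hb : Below (lo + N * (X.C * X.C) + N' * (X.C * X.C)) s₁ s₂ := by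
    intro b h1 h2 p hp
    have := hlow p hp
    interval_cases b
    · exact this.1
    · exact this.2.1
    · exact this.2.2
    · rw [h9]
    · rw [h10]
  have hrec {i : ℕ} (hi : i < N') := rec_agree hlow hi
  refine ⟨h.below.trans (hb.mono (by omega)), fun i hi => (h.good i hi).below hX hb
    (add_mul_add_le hi) (by omega), fun j' hj' hn => ?_, fun i hi => ?_, fun p hp hp0 => ?_⟩
  · rcases (Nat.lt_succ_iff.1 hj').lt_or_eq with hj' | rfl
    · obtain ⟨i, hi, h1, h2⟩ := h.cover j' hj' hn
      exact ⟨i, hi, (hrec hi).trans h1, by rwa [h9]⟩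
    · obtain ⟨i, hi, h1, h2⟩ := hcov hn
      exact ⟨i, hi, (hrec hi).trans h1, by rwa [h9]⟩
  · rw [(hrec hi).keyAt_eq, h12, h.key i hi]
  · rw [h12] at hp0
    obtain ⟨i, hi, hpi⟩ := h.of_ne_zero p hp hp0
    exact ⟨i, hi, by rwa [(hrec hi).keyAt_eq]⟩

/-- A record with a new key is appended. -/
theorem append (h : X.Sieve s s₁ e lo N j N') (hX : X.Roomy) (hL : X.Level s e X.m lo N)
    (hj : j < N) (hlow : ∀ p < lo + N * (X.C * X.C) + N' * (X.C * X.C),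
      s₂.arr 6 p = s₁.arr 6 p ∧ s₂.arr 7 p = s₁.arr 7 p ∧ s₂.arr 8 p = s₁.arr 8 p)
    (hcap : numPos (X.adv (e + 1) (recAt X.C s (lo + j * (X.C * X.C)))).ag X.C ≤ X.cap (e + 1))
    (hrec : (recAt X.C s₂ (lo + N * (X.C * X.C) + N' * (X.C * X.C))).Agree X.C
      (X.adv (e + 1) (recAt X.C s (lo + j * (X.C * X.C)))))
    (h9 : s₂.arr 9 = Function.update (s₁.arr 9) (lo + N * (X.C * X.C) + N' * (X.C * X.C))
      (s.arr 9 (lo + j * (X.C * X.C)) + X.gain (e + 1) (recAt X.C s (lo + j * (X.C * X.C)))))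
    (h10 : s₂.arr 10 = Function.update (s₁.arr 10) (lo + N * (X.C * X.C) + N' * (X.C * X.C))
      (lo + j * (X.C * X.C)))
    (h0 : s₁.arr 12 (s.reg 6 +
      keyAt X.C X.M s₂ (lo + N * (X.C * X.C) + N' * (X.C * X.C))) = 0)
    (h12 : s₂.arr 12 = Function.update (s₁.arr 12) (s.reg 6 +
      keyAt X.C X.M s₂ (lo + N * (X.C * X.C) + N' * (X.C * X.C)))
        (lo + N * (X.C * X.C) + N' * (X.C * X.C))) :
    X.Sieve s s₂ e lo N (j + 1) (N' + 1) := by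
  have hb : Below (lo + N * (X.C * X.C) + N' * (X.C * X.C)) s₁ s₂ := by
    intro b h1 h2 p hp
    have := hlow p hp
    interval_cases b
    · exact this.1
    · exact this.2.1
    · exact this.2.2
    · rw [h9, Function.update_of_ne hp.ne]
    · rw [h10, Function.update_of_ne hp.ne]
  have hra {i : ℕ} (hi : i < N') := rec_agree hlow hi
  have hD : 1 ≤ X.C * X.C := Nat.mul_le_mul hX.one_le hX.one_le
  have hbelow := h.below.trans (hb.mono (Nat.le_add_right _ (N' * (X.C * X.C))))
  -- New records have nonzero positions, so the entry 0 in the key table can mean that a key is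
  -- unused, and the new key differs from those present.
  have hpos : 1 ≤ lo + N * (X.C * X.C) := by
    have := Nat.mul_le_mul (Nat.succ_le_of_lt (Nat.zero_lt_of_lt hj)) hD
    omega
  refine ⟨hbelow, fun i hi => ?_, fun j' hj' hn => ?_, fun i hi => ?_, fun p hp hp0 => ?_⟩
  · rcases (Nat.lt_succ_iff.1 hi).lt_or_eq with hi | rfl
    · exact (h.good i hi).below hX hb (add_mul_add_le hi) (by omega)
    · exact (hL.good j hj).adv hX hbelow (add_mul_add_le hj) (by omega) hcap hrec
        (by rw [h9, Function.update_self]) (by rw [h10, Function.update_self])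
  · rcases (Nat.lt_succ_iff.1 hj').lt_or_eq with hj' | rfl
    · obtain ⟨i, hi, h1, h2⟩ := h.cover j' hj' hn
      refine ⟨i, by omega, (hra hi).trans h1, h2.trans_eq ?_⟩
      have := add_mul_add_le (D := X.C * X.C) (lo := lo + N * (X.C * X.C)) hi
      exact (hb 9 (by omega) (by omega) _ (by omega)).symm
    · exact ⟨N', by omega, hrec, by rw [h9, Function.update_self]⟩
  · rcases (Nat.lt_succ_iff.1 hi).lt_or_eq with hi | rfl
    · rw [(hra hi).keyAt_eq, h12, Function.update_of_ne, h.key i hi]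
      intro heq
      have := h.key i hi
      rw [heq, h0] at this
      omega
    · rw [h12, Function.update_self]
  · by_cases hpk : p = s.reg 6 + keyAt X.C X.M s₂ (lo + N * (X.C * X.C) + N' * (X.C * X.C))
    · exact ⟨N', by omega, hpk⟩
    · rw [h12, Function.update_of_ne hpk] at hp0
      obtain ⟨i, hi, hpi⟩ := h.of_ne_zero p hp hp0
      exact ⟨i, by omega, by rwa [(hra hi).keyAt_eq]⟩

/-- An equal record with a smaller value is improved. -/
theorem improve (h : X.Sieve s s₁ e lo N j N') (hX : X.Roomy) (hL : X.Level s e X.m lo N)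
    (hj : j < N) (hlow : ∀ p < lo + N * (X.C * X.C) + N' * (X.C * X.C),
      s₂.arr 6 p = s₁.arr 6 p ∧ s₂.arr 7 p = s₁.arr 7 p ∧ s₂.arr 8 p = s₁.arr 8 p)
    (hcap : numPos (X.adv (e + 1) (recAt X.C s (lo + j * (X.C * X.C)))).ag X.C ≤ X.cap (e + 1))
    {a : ℕ} (ha : a < N')
    (hrec : (recAt X.C s₁ (lo + N * (X.C * X.C) + a * (X.C * X.C))).Agree X.C
      (X.adv (e + 1) (recAt X.C s (lo + j * (X.C * X.C)))))
    (h9 : s₂.arr 9 = Function.update (s₁.arr 9) (lo + N * (X.C * X.C) + a * (X.C * X.C))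
      (s.arr 9 (lo + j * (X.C * X.C)) + X.gain (e + 1) (recAt X.C s (lo + j * (X.C * X.C)))))
    (h10 : s₂.arr 10 = Function.update (s₁.arr 10) (lo + N * (X.C * X.C) + a * (X.C * X.C))
      (lo + j * (X.C * X.C)))
    (hlt : s₁.arr 9 (lo + N * (X.C * X.C) + a * (X.C * X.C)) <
      s.arr 9 (lo + j * (X.C * X.C)) + X.gain (e + 1) (recAt X.C s (lo + j * (X.C * X.C))))
    (h12 : s₂.arr 12 = s₁.arr 12) :
    X.Sieve s s₂ e lo N (j + 1) N' := by
  have hb : Below (lo + N * (X.C * X.C)) s₁ s₂ := by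
    intro b h1 h2 p hp
    have := hlow p (by omega)
    interval_cases b
    · exact this.1
    · exact this.2.1
    · exact this.2.2
    · rw [h9, Function.update_of_ne (by omega)]
    · rw [h10, Function.update_of_ne (by omega)]
  have hra {i : ℕ} (hi : i < N') := rec_agree hlow hi
  have hD : 1 ≤ X.C * X.C := Nat.mul_le_mul hX.one_le hX.one_le
  have hbelow := h.below.trans hb
  have hne {i : ℕ} (hia : i ≠ a) :
      lo + N * (X.C * X.C) + i * (X.C * X.C) ≠ lo + N * (X.C * X.C) + a * (X.C * X.C) := by
    intro heq
    exact hia (Nat.eq_of_mul_eq_mul_right hD (Nat.add_left_cancel heq))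
  refine ⟨hbelow, fun i hi => ?_, fun j' hj' hn => ?_, fun i hi => ?_, fun p hp hp0 => ?_⟩
  · by_cases hia : i = a
    · rw [hia]
      -- With its new value and predecessor the record stands for another set of winners. No other
      -- chain is affected, since chains run only through positions below the new list.
      exact (hL.good j hj).adv hX hbelow (add_mul_add_le hj) (by omega) hcap
        ((hra ha).trans hrec) (by rw [h9, Function.update_self])
        (by rw [h10, Function.update_self])
    · exact (h.good i hi).transfer hX hb (hra hi) (by rw [h9, Function.update_of_ne (hne hia)])
        (by rw [h10, Function.update_of_ne (hne hia)])
  · rcases (Nat.lt_succ_iff.1 hj').lt_or_eq with hj' | rfl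
    · obtain ⟨i, hi, h1, h2⟩ := h.cover j' hj' hn
      refine ⟨i, hi, (hra hi).trans h1, h2.trans ?_⟩
      by_cases hia : i = a
      · rw [hia, h9, Function.update_self]
        exact hlt.le
      · rw [h9, Function.update_of_ne (hne hia)]
    · exact ⟨a, ha, (hra ha).trans hrec, by rw [h9, Function.update_self]⟩
  · rw [(hra hi).keyAt_eq, h12, h.key i hi]
  · rw [h12] at hp0
    obtain ⟨i, hi, hpi⟩ := h.of_ne_zero p hp hp0
    exact ⟨i, hi, by rwa [(hra hi).keyAt_eq]⟩

/-- The new list. -/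
theorem level (h : X.Sieve s s₁ e lo N N N') (hX : X.Roomy) (hL : X.Level s e X.m lo N)
    (hcapn : e + 1 < X.n ∨ e + 1 = X.n) :
    X.Level s₁ (e + 1) 0 (lo + N * (X.C * X.C)) N' := by
  have hD : 1 ≤ X.C * X.C := Nat.mul_le_mul hX.one_le hX.one_le
  refine ⟨h.good, fun W hW => ?_, fun i hi i' hi' hii => ?_⟩
  · obtain ⟨j, hj, h1, h2⟩ := hL.complete W hW
    have hfits := hW.fits hX e
    have hle : numPos (X.adv (e + 1) (recAt X.C s (lo + j * (X.C * X.C)))).ag X.C ≤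
        X.cap (e + 1) := by
      rw [numPos_adv_eq hX hfits h1]
      -- At item `n`, past the end of the road, no agent is active, so the capacity read there is
      -- irrelevant.
      rcases hcapn with hn | hn
      · refine (Finset.card_le_card fun i hi => ?_).trans (hW.card_le (e + 1) hn)
        obtain ⟨hi1, hi2, hi3⟩ := Finset.mem_filter.1 hi
        refine Finset.mem_filter.2 ⟨hi1, ?_, hi3⟩
        unfold Decided at hi2
        omega
      · refine (Finset.card_eq_zero.2 (Finset.filter_eq_empty_iff.2 fun i hi hi' => ?_)).trans_le
          (Nat.zero_le _)
        have := hX.lt i (hW.lt i hi)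
        omega
    obtain ⟨i, hi, h3, h4⟩ := h.cover j hj hle
    refine ⟨i, hi, ?_, ?_⟩
    · rw [run_zero]
      exact h3.trans (h1.adv (e + 1))
    · rw [run_zero]
      refine le_trans ?_ h4
      rw [h1.gain_eq]
      exact Nat.add_le_add_right h2 _
  -- The table recovers the position from the key, and agreeing records have the same key.
  · have h1 := h.key i hi
    have h2 := h.key i' hi'
    rw [hii.keyAt_eq, h2] at h1
    exact (Nat.eq_of_mul_eq_mul_right hD (Nat.add_left_cancel h1)).symm

end Sieve

/-- Proceed with all records of the list to item `reg 7`. -/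
def _root_.HighwayPricing.advLevelP : RProg :=
  25 ::= var 9 ;; 10 ::= var 8 ;; 11 ::= var 9 ;;
  whileLt (var 10) (var 25) (advRecP ;; 10 ::= var 10 +ᵣ var 4) ;;
  8 ::= var 25 ;; 9 ::= var 11 ;; 6 ::= var 6 +ᵣ var 5

theorem _root_.HighwayPricing.advLevelP_wregs : advLevelP.wregs =
    [25, 10, 11] ++ (advRecP.wregs ++ [10] ++ [8, 9, 6]) := rfl

theorem _root_.HighwayPricing.advLevelP_warrs :
    advLevelP.warrs = advRecP.warrs ++ [] ++ [] := rfl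

set_option maxHeartbeats 1000000 in
theorem advLevelP_spec {s : State} (hX : X.Roomy) (hL : Loaded X s) {e lo N : ℕ}
    (h : X.Level s e X.m lo N) (hen : e < X.n)
    (h7 : s.reg 7 = e + 1) (h8 : s.reg 8 = lo) (h9 : s.reg 9 = lo + N * (X.C * X.C))
    (h12 : ∀ p, s.reg 6 ≤ p → s.arr 12 p = 0) :
    Wp advLevelP s fun t s' => t ≤ (N + 1) * (1340 * (X.C * X.C)) ∧
      ∃ N', s'.reg 8 = lo + N * (X.C * X.C) ∧
        s'.reg 9 = lo + N * (X.C * X.C) + N' * (X.C * X.C) ∧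
        X.Level s' (e + 1) 0 (lo + N * (X.C * X.C)) N' ∧
        ∀ p, s'.reg 6 ≤ p → s'.arr 12 p = 0 := by
  have hD : 1 ≤ X.C * X.C := Nat.mul_le_mul hX.one_le hX.one_le
  simp only [advLevelP, wp_seq, wp_set]
  have hL0 : Loaded X (((s.setReg 25 (eval s (var 9))).setReg 10
      (eval (s.setReg 25 (eval s (var 9))) (var 8))).setReg 11
      (eval ((s.setReg 25 (eval s (var 9))).setReg 10
        (eval (s.setReg 25 (eval s (var 9))) (var 8))) (var 9))) :=
    hL.same (R := [25, 10, 11]) (A := [])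
      ⟨fun x hx => by simp at hx; simp [hx], fun _ _ => rfl⟩ (by simp) (by simp)
  refine (wp_while (fun j s' => s'.reg 10 = lo + j * (X.C * X.C) ∧
    ∃ N', s'.reg 11 = lo + N * (X.C * X.C) + N' * (X.C * X.C) ∧ X.Sieve s s' e lo N j N') N
    (1305 * (X.C * X.C)) ?_ ?_ ?_).imp ?_
  · refine ⟨by simp [RExpr.eval, h8], 0, by simp [RExpr.eval, h9], fun _ _ _ _ _ => rfl, by simp,
      by simp, by simp, fun p hp hp0 => ?_⟩
    exact absurd (h12 p hp) hp0
  · rintro j s1 hj hs1 ⟨k10, N', k11, hS⟩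
    have hL1 : Loaded X s1 := hL0.same hs1
      (by simp [RProg.wregs, advRecP_wregs, advP_wregs, keyP_wregs])
      (by simp [RProg.warrs, advRecP_warrs, advP_warrs])
    obtain ⟨hr1, -⟩ := hs1
    simp [RProg.wregs, advRecP_wregs, advP_wregs, keyP_wregs] at hr1
    have hjD := add_mul_add_le (D := X.C * X.C) (lo := lo) hj
    have e25 : s1.reg 25 = lo + N * (X.C * X.C) := by simp [hr1, RExpr.eval, h9]
    have e7 : s1.reg 7 = e + 1 := by simp [hr1, h7]
    have e6 : s1.reg 6 = s.reg 6 := by simp [hr1]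
    constructor
    · simp only [RExpr.eval, k10, e25]
      omega
    have hrec := hS.below.recAt (C := X.C) hjD
    have h9j : s1.arr 9 (lo + j * (X.C * X.C)) = s.arr 9 (lo + j * (X.C * X.C)) :=
      hS.below 9 (by omega) (by omega) _ (by omega)
    obtain ⟨W, hW1, -, hW2⟩ := (h.good j hj).describes hX
    have hW3 := hW2.agree hrec
    have hadv := (hrec.adv (e + 1))
    have hsm {s' : State} {b : ℕ} (h' : (recAt X.C s' b).Agree X.C
        (X.adv (e + 1) (recAt X.C s1 (lo + j * (X.C * X.C))))) : Small X.C X.M s' b :=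
      ((hW3.adv hX.toValid hW1.lt).agree h').small hX.toValid hW1.lt
    simp only [wp_seq, wp_set]
    refine (advRecP_spec hL1 hX.one_le k10 k11 (hjD.trans (Nat.le_add_right _ _))
      (fun x hx hx0 => ?_) rfl rfl (fun s' h' => hsm (by rwa [e7] at h'))).imp ?_
    · obtain ⟨i, hi⟩ := Nat.exists_eq_succ_of_ne_zero hx0
      rw [hi]
      exact hX.val_lt (hW1.lt _ (Finset.mem_filter.1 (hW3.mem x hx i hi)).1)
    rintro t s2 ⟨hr2, -⟩ ⟨ht, hrec2, hlow, hno, hyes⟩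
    simp [advRecP_wregs, advP_wregs, keyP_wregs] at hr2
    rw [e7] at hrec2 hno hyes
    rw [e6, hrec.gain_eq, h9j] at hyes
    rw [hadv.numPos_eq] at hno hyes
    refine ⟨by simp [RExpr.cost]; omega, ?_⟩
    simp only [State.setReg_reg, if_true, RExpr.eval]
    refine ⟨by simp [hr2, k10, hL1.D]; ring, ?_⟩
    have hrec3 := hrec2.trans hadv
    rcases lt_or_ge (X.cap (e + 1))
      (numPos (X.adv (e + 1) (recAt X.C s (lo + j * (X.C * X.C)))).ag X.C) with hn | hn
    · obtain ⟨l11, l9, l10, l12⟩ := hno hn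
      refine ⟨N', by simp [l11], Sieve.congr_arr (hS.drop hX hlow l9 l10 l12 fun h => ?_) rfl⟩
      omega
    · obtain ⟨hnew, hold⟩ := hyes hn
      rcases Nat.eq_zero_or_pos (s1.arr 12 (s.reg 6 + keyAt X.C X.M s2
        (lo + N * (X.C * X.C) + N' * (X.C * X.C)))) with h0 | h0
      · obtain ⟨l11, l9, l10, l12⟩ := hnew h0
        exact ⟨N' + 1, by simp [l11]; ring,
          Sieve.congr_arr (hS.append hX h hj hlow hn hrec3 l9 l10 h0 l12) rfl⟩
      · obtain ⟨i, hi, hpi⟩ := hS.of_ne_zero _ (Nat.le_add_right _ _) h0.ne'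
        have hx := hS.key i hi
        rw [← hpi] at hx
        obtain ⟨l11, l12, hle, hlt⟩ := hold _ (hx ▸ h0.ne') hx
        -- An occupied table entry belongs to a record with the same key, which therefore agrees
        -- with the new one.
        have hagree := (Small.agree ((hS.good i hi).small hX) (hsm hrec2)
          (Nat.add_left_cancel hpi).symm).trans hrec3
        refine ⟨N', by simp [l11], Sieve.congr_arr (s₁ := s2) ?_ rfl⟩
        rcases le_or_gt (s.arr 9 (lo + j * (X.C * X.C)) +
          X.gain (e + 1) (recAt X.C s (lo + j * (X.C * X.C))))
          (s1.arr 9 (lo + N * (X.C * X.C) + i * (X.C * X.C))) with hv | hv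
        · obtain ⟨l9, l10⟩ := hle hv
          exact hS.drop hX hlow l9 l10 l12 fun _ => ⟨i, hi, hagree, hv⟩
        · obtain ⟨l9, l10⟩ := hlt hv
          exact hS.improve hX h hj hlow hn hi hagree l9 l10 hv l12
  · rintro s1 ⟨hr1, -⟩ ⟨k10, -⟩
    simp [RProg.wregs, advRecP_wregs, advP_wregs, keyP_wregs] at hr1
    simp [RExpr.eval, k10, hr1, h9]
  · rintro t s1 ⟨hr1, -⟩ ⟨ht, k10, N', k11, hS⟩
    simp [RProg.wregs, advRecP_wregs, advP_wregs, keyP_wregs] at hr1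
    constructor
    · simp [RExpr.cost] at ht ⊢
      have : (N + 1) * (1305 * (X.C * X.C) + 1 + 1 + 1) + 16 ≤ (N + 1) * (1340 * (X.C * X.C)) := by
        nlinarith [Nat.mul_le_mul_left (N + 1) hD]
      omega
    refine ⟨N', by simp [RExpr.eval, hr1, h9], by simp [RExpr.eval, k11],
      Level.congr_arr (hS.level hX h (by omega)) rfl, fun p hp => ?_⟩
    simp [RExpr.eval, hr1, hL.step] at hp
    by_contra hp0
    obtain ⟨i, hi, hpi⟩ := hS.of_ne_zero p (by omega) hp0
    -- Keys stay below `M ^ (C + C + C * C)`, so raising the offset by this amount leads to an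
    -- untouched part of the table, and nothing has to be cleared.
    have := ((hS.good i hi).small hX).keyAt_lt
    omega

end Road

/-! ### The lists for all items -/

/-- Add the agents whose intervals begin at item `reg 7`. -/
def addLevelP : RProg :=
  12 ::= lit 0 ;;
  whileLt (var 12) (var 1) (
    ifLe (get 1 (var 12)) (var 7)
      (ifLe (var 7) (get 1 (var 12)) (ifLe (lit 1) (get 3 (var 12)) addAgentP skip) skip) skip ;;
    12 ::= var 12 +ᵣ lit 1)

theorem addLevelP_wregs : addLevelP.wregs = [12] ++ (addAgentP.wregs ++ [] ++ [] ++ [] ++ [12]) :=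
  rfl

theorem addLevelP_warrs : addLevelP.warrs = addAgentP.warrs ++ [] ++ [] ++ [] ++ [] := rfl

/-- The optimal records at the end. -/
def levelsP : RProg :=
  8 ::= lit 0 ;; 9 ::= var 4 ;; 6 ::= lit 0 ;; 7 ::= lit 0 ;;
  whileLt (var 7) (var 0) (addLevelP ;; 7 ::= var 7 +ᵣ lit 1 ;; advLevelP)

theorem levelsP_wregs : levelsP.wregs =
    [8, 9, 6, 7] ++ (addLevelP.wregs ++ ([7] ++ advLevelP.wregs)) := rfl

theorem levelsP_warrs : levelsP.warrs = addLevelP.warrs ++ ([] ++ advLevelP.warrs) := rfl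

namespace Road

variable {X : Road}

theorem addLevelP_spec {s : State} (hX : X.Roomy) (hL : Loaded X s) {e lo N R : ℕ}
    (h : X.Level s e 0 lo N) (h7 : s.reg 7 = e) (h8 : s.reg 8 = lo)
    (h9 : s.reg 9 = lo + N * (X.C * X.C))
    (hR : ∀ s k N, X.Level s e k lo N → N ≤ R) :
    Wp addLevelP s fun t s' => t ≤ (X.m + 2) * ((R + 1) * (1350 * (X.C * X.C))) ∧
      ∃ N', s'.reg 9 = lo + N' * (X.C * X.C) ∧ X.Level s' e X.m lo N' := by
  have hD : 1 ≤ X.C * X.C := Nat.mul_le_mul hX.one_le hX.one_le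
  simp only [addLevelP, wp_seq, wp_set]
  refine (wp_while (fun k s' => s'.reg 12 = k ∧
    ∃ N', s'.reg 9 = lo + N' * (X.C * X.C) ∧ X.Level s' e k lo N') X.m
    ((R + 1) * (1320 * (X.C * X.C)) + 16) ?_ ?_ ?_).imp ?_
  · exact ⟨rfl, N, by simp [h9], h.congr_arr rfl⟩
  · rintro k s1 hk hs1 ⟨k12, N', k9, hlev⟩
    have hL1 : Loaded X s1 := (hL.same (s' := s.setReg 12 (eval s (lit 0))) (R := [12]) (A := [])
      ⟨fun x hx => by simp at hx; simp [hx], fun _ _ => rfl⟩ (by simp) (by simp)).same hs1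
      (by simp [RProg.wregs, addAgentP_wregs, addRecP_wregs])
      (by simp [RProg.warrs, addAgentP_warrs, addRecP_warrs])
    obtain ⟨hr1, -⟩ := hs1
    simp [RProg.wregs, addAgentP_wregs, addRecP_wregs] at hr1
    have e7 : s1.reg 7 = e := by simp [hr1, h7]
    have e8 : s1.reg 8 = lo := by simp [hr1, h8]
    refine ⟨by simp [RExpr.eval, k12, hL1.m, hk], ?_⟩
    have hpos : 1 ≤ (R + 1) * (1320 * (X.C * X.C)) := Nat.mul_pos (by omega) (by omega)
    have hskip (hk' : ¬ (X.fst k = e ∧ 1 ≤ X.val k)) :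
        ∃ N', s1.reg 9 = lo + N' * (X.C * X.C) ∧ X.Level s1 e (k + 1) lo N' :=
      ⟨N', k9, hlev.skip hk'⟩
    simp only [wp_seq, wp_set, wp_ifLe, wp_skip]
    simp only [RExpr.eval, k12, hL1.fst, hL1.val, e7]
    refine ⟨fun h1 => ⟨fun h2 => ⟨fun h3 => ?_, fun h3 => ?_⟩, fun h2 => ?_⟩, fun h1 => ?_⟩
    · refine (addAgentP_spec hX hL1 hlev (by omega) hk h3 e7 e8 k9 k12).imp ?_
      rintro t s2 ⟨hr2, -⟩ ⟨ht, N2, l9, hlev2⟩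
      simp [addAgentP_wregs, addRecP_wregs] at hr2
      refine ⟨?_, by simp [hr2, k12], N2, by simpa using l9, hlev2.congr_arr rfl⟩
      have := Nat.mul_le_mul_right (1320 * (X.C * X.C)) (Nat.succ_le_succ (hR _ _ _ hlev))
      simp [RExpr.cost] at this ⊢
      omega
    · obtain ⟨N2, l9, hlev2⟩ := hskip (by omega)
      exact ⟨by simp [RExpr.cost]; try omega, by simp, N2, by simpa using l9, hlev2.congr_arr rfl⟩
    · obtain ⟨N2, l9, hlev2⟩ := hskip (by omega)
      exact ⟨by simp [RExpr.cost]; try omega, by simp, N2, by simpa using l9, hlev2.congr_arr rfl⟩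
    · obtain ⟨N2, l9, hlev2⟩ := hskip (by omega)
      exact ⟨by simp [RExpr.cost]; try omega, by simp, N2, by simpa using l9, hlev2.congr_arr rfl⟩
  · rintro s1 ⟨hr1, -⟩ ⟨k12, -⟩
    simp [RProg.wregs, addAgentP_wregs, addRecP_wregs] at hr1
    simp [RExpr.eval, k12, hr1, hL.m]
  · rintro t s1 - ⟨ht, -, hN⟩
    refine ⟨?_, hN⟩
    simp [RExpr.cost] at ht ⊢
    nlinarith [Nat.mul_le_mul_left (R + 1) hD, Nat.mul_le_mul_left (X.m * (R + 1)) hD]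

/-- Zeroed memory already contains the empty record at position 0. -/
theorem level_init {s : State} (h6 : s.arr 6 = 0) (h7 : s.arr 7 = 0) (h8 : s.arr 8 = 0)
    (h9 : s.arr 9 = 0) : X.Level s 0 0 0 1 := by
  have hrec (W : Finset ℕ) : (recAt X.C s 0).Agree X.C (X.run W 0 0).1 :=
    ⟨fun x _ => by simp [recAt, h6, run, addTo, start],
      fun x _ => by simp [recAt, h7, run, addTo, start],
      fun x _ y _ => by simp [recAt, h8, run, addTo, start]⟩
  refine ⟨fun j hj => ?_, fun W _ => ⟨0, by simp, ?_, by simp [run, addTo, start]⟩, by omega⟩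
  · obtain rfl : j = 0 := by omega
    refine ⟨∅, by simp, ⟨by simp, by simp, by simp⟩, by simpa using hrec ∅, ?_, trivial⟩
    simp [h9, run, addTo, start]
  · simpa using hrec W

/-- The outcome at the end: the record of a set of winners of maximal worth. -/
theorem Level.exists_max {s : State} {lo N : ℕ} (h : X.Level s X.n 0 lo N) (hX : X.Roomy) :
    ∃ W, X.Feasible W ∧ (∀ W', X.Feasible W' → X.worth W' ≤ X.worth W) ∧
      X.Chain s W lo X.n (s.arr 10 lo) := by
  -- No agent wants item `n`, so all records are empty and, without repetitions, there is only one.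
  -- Completeness then compares its value with every feasible set.
  have hzero {j : ℕ} (hj : j < N) : (recAt X.C s (lo + j * (X.C * X.C))).Agree X.C ⟨0, 0, 0⟩ := by
    obtain ⟨W, h1, -, h2⟩ := (h.good j hj).describes hX
    have hag : ∀ x < X.C, (recAt X.C s (lo + j * (X.C * X.C))).ag x = 0 := fun x hx => by
      by_contra h0
      obtain ⟨i, hi⟩ := Nat.exists_eq_succ_of_ne_zero h0
      obtain ⟨h3, -, h4⟩ := Finset.mem_filter.1 (h2.mem x hx i hi)
      have := hX.lt i (h1.lt i h3)
      omega
    exact ⟨hag, fun x hx => h2.g_zero x hx (hag x hx), fun x hx => h2.f_zero x hx (hag x hx)⟩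
  obtain ⟨W, -, h2, -, h4, h5⟩ := h.good 0 h.pos
  rw [zero_mul, add_zero] at h4 h5
  have hW := h2.feasible
  refine ⟨W, hW, fun W' hW' => ?_, h5⟩
  obtain ⟨j, hj, -, h6⟩ := h.complete W' hW'
  rw [h.inj j hj 0 h.pos ((hzero hj).trans (hzero h.pos).symm), zero_mul, add_zero, h4,
    run_snd_eq_worth hX.toValid (hW'.fits hX _), run_snd_eq_worth hX.toValid (hW.fits hX _)] at h6
  exact h6

theorem levelsP_spec {s : State} (hX : X.Roomy) (hL : Loaded X s) (h6 : s.arr 6 = 0)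
    (h7 : s.arr 7 = 0) (h8 : s.arr 8 = 0) (h9 : s.arr 9 = 0) (h12 : s.arr 12 = 0) {R : ℕ}
    (hR : ∀ s e k lo N, X.Level s e k lo N → N ≤ R) :
    Wp levelsP s fun t s' => t ≤ (X.n + 1) * ((X.m + 4) * ((R + 1) * (1350 * (X.C * X.C)))) ∧
      s'.reg 7 = X.n ∧ ∃ W, X.Feasible W ∧ (∀ W', X.Feasible W' → X.worth W' ≤ X.worth W) ∧
        X.Chain s' W (s'.reg 8) X.n (s'.arr 10 (s'.reg 8)) := by
  have hD : 1 ≤ X.C * X.C := Nat.mul_le_mul hX.one_le hX.one_le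
  simp only [levelsP, wp_seq, wp_set]
  set s0 := (((s.setReg 8 (eval s (lit 0))).setReg 9
      (eval (s.setReg 8 (eval s (lit 0))) (var 4))).setReg 6
      (eval ((s.setReg 8 (eval s (lit 0))).setReg 9
        (eval (s.setReg 8 (eval s (lit 0))) (var 4))) (lit 0))).setReg 7
      (eval (((s.setReg 8 (eval s (lit 0))).setReg 9
      (eval (s.setReg 8 (eval s (lit 0))) (var 4))).setReg 6
      (eval ((s.setReg 8 (eval s (lit 0))).setReg 9
        (eval (s.setReg 8 (eval s (lit 0))) (var 4))) (lit 0))) (lit 0)) with hs0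
  have hL0 : Loaded X s0 := hL.same (R := [8, 9, 6, 7]) (A := [])
      ⟨fun x hx => by simp at hx; simp [hs0, hx], fun _ _ => rfl⟩ (by simp) (by simp)
  refine (wp_while (fun e s' => s'.reg 7 = e ∧ ∃ lo N, s'.reg 8 = lo ∧
    s'.reg 9 = lo + N * (X.C * X.C) ∧ X.Level s' e 0 lo N ∧
    ∀ p, s'.reg 6 ≤ p → s'.arr 12 p = 0) X.n
    ((X.m + 3) * ((R + 1) * (1350 * (X.C * X.C))) + 4) ?_ ?_ ?_).imp ?_
  · refine ⟨by simp [hs0, RExpr.eval], 0, 1, by simp [hs0, RExpr.eval],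
      by simp [hs0, RExpr.eval, hL.D], level_init h6 h7 h8 h9, fun p _ => ?_⟩
    exact congrFun h12 p
  · rintro e s1 he hs1 ⟨k7, lo, N, k8, k9, hlev, k12⟩
    have hL1 : Loaded X s1 := hL0.same hs1
      (by simp [RProg.wregs, addLevelP_wregs, addAgentP_wregs, addRecP_wregs, advLevelP_wregs,
        advRecP_wregs, advP_wregs, keyP_wregs])
      (by simp [RProg.warrs, addLevelP_warrs, addAgentP_warrs, addRecP_warrs, advLevelP_warrs,
        advRecP_warrs, advP_warrs])
    refine ⟨by simp [RExpr.eval, k7, hL1.n, he], ?_⟩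
    simp only [wp_seq, wp_set]
    refine (addLevelP_spec hX hL1 hlev k7 k8 k9 fun s k N => hR s e k lo N).imp ?_
    rintro t2 s2 hs2 ⟨ht2, N2, l9, hlev2⟩
    have hL2 : Loaded X (s2.setReg 7 (eval s2 (var 7 +ᵣ lit 1))) := (hL1.same hs2
      (by simp [addLevelP_wregs, addAgentP_wregs, addRecP_wregs])
      (by simp [addLevelP_warrs, addAgentP_warrs, addRecP_warrs])).same (R := [7]) (A := [])
      ⟨fun x hx => by simp at hx; simp [hx], fun _ _ => rfl⟩ (by simp) (by simp)
    obtain ⟨hr2, ha2⟩ := hs2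
    simp [addLevelP_wregs, addAgentP_wregs, addRecP_wregs] at hr2
    simp [addLevelP_warrs, addAgentP_warrs, addRecP_warrs] at ha2
    refine (advLevelP_spec hX hL2 (hlev2.congr_arr rfl) he (by simp [RExpr.eval, hr2, k7])
      (by simp [hr2, k8]) (by simp [l9]) (fun p hp => ?_)).imp ?_
    · simp [hr2] at hp
      simp [ha2, k12 p hp]
    rintro t3 s3 ⟨hr3, -⟩ ⟨ht3, N3, m8, m9, hlev3, m12⟩
    simp [advLevelP_wregs, advRecP_wregs, advP_wregs, keyP_wregs] at hr3
    refine ⟨?_, by simp [hr3, RExpr.eval, hr2, k7], _, N3, m8, m9, hlev3, m12⟩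
    have h1 := hR _ _ _ _ _ hlev2
    have h2 := Nat.mul_le_mul (Nat.succ_le_succ h1)
      (Nat.mul_le_mul_right (X.C * X.C) (show 1340 ≤ 1350 by omega))
    simp only [RExpr.cost, Nat.succ_eq_add_one] at h2 ⊢
    rw [show X.m + 3 = (X.m + 2) + 1 by ring, add_mul (X.m + 2) 1, one_mul]
    omega
  · rintro s1 hs1 ⟨k7, -⟩
    have hL1 : Loaded X s1 := hL0.same hs1
      (by simp [RProg.wregs, addLevelP_wregs, addAgentP_wregs, addRecP_wregs, advLevelP_wregs,
        advRecP_wregs, advP_wregs, keyP_wregs])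
      (by simp [RProg.warrs, addLevelP_warrs, addAgentP_warrs, addRecP_warrs, advLevelP_warrs,
        advRecP_warrs, advP_warrs])
    simp [RExpr.eval, k7, hL1.n]
  · rintro t s1 - ⟨ht, k7, lo, N, k8, k9, hlev, -⟩
    refine ⟨?_, k7, k8 ▸ hlev.exists_max hX⟩
    simp [RExpr.cost] at ht ⊢
    nlinarith [Nat.mul_le_mul_left (R + 1) hD, Nat.mul_le_mul_left (X.n * (R + 1)) hD]

end Road

/-! ### Reading off the winners and the prices -/

/-- Output the winners of the record at `reg 10` whose last item is `reg 7`. -/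
def outP : RProg :=
  13 ::= lit 0 ;; 17 ::= var 10 ;;
  whileLt (var 13) (var 2) (
    15 ::= get 6 (var 10 +ᵣ var 13) ;;
    ifLe (lit 1) (var 15)
      (ifLe (get 2 (var 15 -ᵣ lit 1)) (var 7)
        (ifLe (var 7) (get 2 (var 15 -ᵣ lit 1))
          (rowMinP ;; put 4 (var 15 -ᵣ lit 1) (lit 1) ;; put 5 (var 15 -ᵣ lit 1) (var 16))
          skip) skip) skip ;;
    17 ::= var 17 +ᵣ var 2 ;;
    13 ::= var 13 +ᵣ lit 1)

theorem outP_wregs : outP.wregs = [13, 17, 15, 16, 14, 23, 16, 14, 17, 13] := rfl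

theorem outP_warrs : outP.warrs = [4, 5] := rfl

/-- Follow the predecessors of the record at `reg 8`. -/
def walkP : RProg :=
  10 ::= get 10 (var 8) ;;
  whileLt (lit 0) (var 7) (
    7 ::= var 7 -ᵣ lit 1 ;;
    outP ;;
    10 ::= get 10 (var 10))

namespace Road

variable {X : Road}

variable (X) in
/-- The winners with property `P` have been written to the output, with their prices. -/
structure Written (s : State) (W : Finset ℕ) (P : ℕ → Prop) : Prop where
  iff : ∀ i, s.arr 4 i ≠ 0 ↔ i ∈ W ∧ P i
  eq : ∀ i ∈ W, P i → s.arr 5 i = X.price W (X.seg i)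

theorem Written.congr {s s' : State} {W : Finset ℕ} {P P' : ℕ → Prop} (h : X.Written s W P)
    (h4 : s'.arr 4 = s.arr 4) (h5 : s'.arr 5 = s.arr 5) (hP : ∀ i ∈ W, P' i ↔ P i) :
    X.Written s' W P' := by
  refine ⟨fun i => ?_, fun i hi hp => ?_⟩
  · rw [h4, h.iff]
    exact and_congr_right fun hi => (hP i hi).symm
  · rw [h5, h.eq i hi ((hP i hi).1 hp)]

theorem Written.put {s s' : State} {W : Finset ℕ} {P P' : ℕ → Prop} (h : X.Written s W P)
    {k : ℕ} (hk : k ∈ W) (hkP : P' k) (h4 : s'.arr 4 = Function.update (s.arr 4) k 1)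
    (h5 : s'.arr 5 = Function.update (s.arr 5) k (X.price W (X.seg k)))
    (hP : ∀ i ∈ W, i ≠ k → (P' i ↔ P i)) : X.Written s' W P' := by
  refine ⟨fun i => ?_, fun i hi hp => ?_⟩
  · by_cases hik : i = k
    · rw [hik, h4, Function.update_self]
      simp [hk, hkP]
    · rw [h4, Function.update_of_ne hik, h.iff]
      exact and_congr_right fun hi => (hP i hi hik).symm
  · by_cases hik : i = k
    · rw [hik, h5, Function.update_self]
    · rw [h5, Function.update_of_ne hik, h.eq i hi ((hP i hi hik).1 hp)]

/-- At the last item of a winner, with all agents there decided, her prefix is her whole interval;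
the slot price is then her payment. -/
theorem outP_spec {s : State} (hX : X.Roomy) (hL : Loaded X s) {W : Finset ℕ}
    (hW : X.Feasible W) {e b : ℕ} (h7 : s.reg 7 = e) (h10 : s.reg 10 = b)
    (hrec : (recAt X.C s b).Agree X.C (X.run W e X.m).1)
    (hwr : X.Written s W fun i => e + 1 ≤ X.lst i) :
    Wp outP s fun t s' => t ≤ 500 * (X.C * X.C) ∧ X.Written s' W fun i => e ≤ X.lst i := by
  have hd := (describes_run hX.toValid (hW.fits hX e) X.m).agree hrec
  have hC := hX.one_le
  have hCC : X.C ≤ X.C * X.C := Nat.le_mul_of_pos_left _ hC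
  simp only [outP, wp_seq, wp_set]
  refine (wp_while (fun x s' => s'.reg 13 = x ∧ s'.reg 17 = b + x * X.C ∧ X.Written s' W fun i =>
    e + 1 ≤ X.lst i ∨ X.lst i = e ∧ ∃ y < x, (recAt X.C s b).ag y = i + 1) X.C
    (30 * (X.C + 1) + 60) ?_ ?_ ?_).imp ?_
  · exact ⟨rfl, by simp [RExpr.eval, h10], hwr.congr rfl rfl (by simp)⟩
  · rintro x s1 hx ⟨hr, ha⟩ ⟨h13, h17, hw⟩
    simp [RProg.wregs, RProg.warrs, rowMinP_wregs, rowMinP_warrs] at hr ha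
    have hag : s1.arr 6 (b + x) = (recAt X.C s b).ag x := by rw [ha 6 (by simp) (by simp)]; rfl
    refine ⟨by simp [RExpr.eval, hr, h13, hL.C, hx], ?_⟩
    have hstep {s' : State} (h4 : s'.arr 4 = s1.arr 4) (h5 : s'.arr 5 = s1.arr 5)
        (hn : ∀ i, (recAt X.C s b).ag x = i + 1 → X.lst i ≠ e) : X.Written s' W fun i =>
          e + 1 ≤ X.lst i ∨ X.lst i = e ∧ ∃ y < x + 1, (recAt X.C s b).ag y = i + 1 := by
      refine hw.congr h4 h5 fun i _ => or_congr_right (and_congr_right fun hi => ⟨?_, ?_⟩)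
      · rintro ⟨y, hy, hyi⟩
        rcases (Nat.lt_succ_iff.1 hy).lt_or_eq with hy | rfl
        · exact ⟨y, hy, hyi⟩
        · exact absurd hi (hn i hyi)
      · rintro ⟨y, hy, hyi⟩
        exact ⟨y, by omega, hyi⟩
    simp only [wp_seq, wp_set, wp_put, wp_ifLe, wp_skip]
    refine ⟨fun h1 => ⟨fun h2 => ⟨fun h3 => ?_, fun h3 => ?_⟩, fun h2 => ?_⟩, fun h1 => ?_⟩
    · simp [RExpr.eval, hr, ha, h13, h10, h7, hag, hL.lst] at h1 h2 h3
      obtain ⟨k, hk⟩ := Nat.exists_eq_succ_of_ne_zero (Nat.one_le_iff_ne_zero.1 h1)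
      rw [hk] at h2 h3
      simp at h2 h3
      refine (rowMinP_spec _).imp ?_
      rintro t s2 ⟨hr2, ha2⟩ ⟨ht, h16⟩
      simp [rowMinP_wregs, rowMinP_warrs] at hr2 ha2
      have hkW : k ∈ W := (Finset.mem_filter.1 (hd.mem x hx k hk)).1
      have h16' : s2.reg 16 = X.price W (X.seg k) := by
        have h := hd.slotPrice_eq hX.toValid hW.lt hx hk
        rw [show Finset.Ico (X.fst k) (e + 1) = X.seg k by
          ext z
          simp [seg]
          omega, min_eq_right (price_seg_le hkW)] at h
        rw [← h, h16]
        simp [RExpr.eval, hr, h13, h10, hag, ha, hL.val, h17, hL.C, Road.slotPrice]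
        refine rowMin_congr fun t _ => ?_
        simp [recAt, add_assoc]
      simp [hr, hL.C] at ht
      refine ⟨?_, ?_, ?_, hw.put hkW (Or.inr ⟨by omega, x, by omega, hk⟩) ?_ ?_ fun i hi hik => ?_⟩
      · simp [RExpr.cost]
        omega
      · simp [RExpr.eval, hr2, h13]
      · simp [RExpr.eval, hr2, hr, h17, hL.C]
        ring
      · simp [RExpr.eval, hr2, ha2, hr, h13, h10, hag, hk]
      · simp [RExpr.eval, hr2, ha2, hr, h13, h10, hag, hk, h16']
      · refine or_congr_right (and_congr_right fun hi => ⟨?_, ?_⟩)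
        · rintro ⟨y, hy, hyi⟩
          rcases (Nat.lt_succ_iff.1 hy).lt_or_eq with hy | rfl
          · exact ⟨y, hy, hyi⟩
          · omega
        · rintro ⟨y, hy, hyi⟩
          exact ⟨y, by omega, hyi⟩
    all_goals
      refine ⟨by simp [RExpr.cost]; try omega, by simp [RExpr.eval, h13], ?_,
        hstep rfl rfl fun i hi => ?_⟩
      · simp [RExpr.eval, hr, h17, hL.C]
        ring
    · simp [RExpr.eval, hr, ha, h13, h10, h7, hag, hL.lst, hi] at h3
      omega
    · simp [RExpr.eval, hr, ha, h13, h10, h7, hag, hL.lst, hi] at h2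
      omega
    · simp [RExpr.eval, hr, h13, h10, hag, hi] at h1
  · rintro s1 ⟨hr, ha⟩ ⟨h13, -⟩
    simp [RProg.wregs, RProg.warrs, rowMinP_wregs, rowMinP_warrs] at hr ha
    simp [RExpr.eval, hr, h13, hL.C]
  · rintro t s1 - ⟨ht, -, -, hw⟩
    refine ⟨?_, hw.congr rfl rfl fun i hi => ?_⟩
    · simp [RExpr.cost] at ht ⊢
      nlinarith
    · constructor
      · intro hei
        rcases hei.lt_or_eq with hei | hei
        · exact Or.inl hei
        · have hdec : X.Decided e X.m i := by
            have := hX.le i (hW.lt i hi)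
            have := hW.lt i hi
            unfold Decided
            omega
          obtain ⟨y, hy, hyi⟩ := hd.surj i (Finset.mem_filter.2 ⟨hi, hdec, hei.le⟩)
          exact Or.inr ⟨hei.symm, y, hy, hyi⟩
      · rintro (h | h) <;> omega

/-- The walk visits one record per item, from item `n - 1` down to 0, so it meets every winner at
her last item. -/
theorem walkP_spec {s : State} (hX : X.Roomy) (hL : Loaded X s) {W : Finset ℕ}
    (hW : X.Feasible W) (h7 : s.reg 7 = X.n)
    (hc : X.Chain s W (s.reg 8) X.n (s.arr 10 (s.reg 8))) (h4 : s.arr 4 = 0) :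
    Wp walkP s fun t s' => t ≤ (X.n + 1) * (530 * (X.C * X.C)) ∧ X.Written s' W fun _ => True := by
  have hD : 1 ≤ X.C * X.C := Nat.mul_le_mul hX.one_le hX.one_le
  simp only [walkP, wp_seq, wp_set]
  refine (wp_while (fun j s' => s'.reg 7 = X.n - j ∧ X.Chain s' W (s.reg 8) (X.n - j) (s'.reg 10) ∧
    X.Written s' W fun i => X.n - j ≤ X.lst i) X.n (500 * (X.C * X.C) + 10) ?_ ?_ ?_).imp ?_
  · refine ⟨by simp [h7], ?_, fun i => ?_, fun i hi hp => ?_⟩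
    · have : (s.setReg 10 (eval s (get 10 (var 8)))).reg 10 = s.arr 10 (s.reg 8) := by
        simp [RExpr.eval]
      rw [this]
      exact hc.congr_arr rfl
    · simp [h4]
      intro hi
      exact hX.lt i (hW.lt i hi)
    · have := hX.lt i (hW.lt i hi)
      omega
  · rintro j s1 hj hs1 ⟨k7, hc1, hw1⟩
    obtain ⟨e, he⟩ : ∃ e, X.n - j = e + 1 := ⟨X.n - j - 1, by omega⟩
    have he' : X.n - (j + 1) = e := by omega
    rw [he] at k7 hc1 hw1
    rw [he']
    refine ⟨by simp [RExpr.eval, k7], ?_⟩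
    have hL1 : Loaded X s1 := (hL.same (s' := s.setReg 10 (eval s (get 10 (var 8)))) (R := [10])
      (A := []) ⟨fun x hx => by simp at hx; simp [hx], fun _ _ => rfl⟩ (by simp) (by simp)).same hs1
      (by simp [RProg.wregs, outP_wregs]) (by simp [RProg.warrs, outP_warrs])
    simp only [wp_seq, wp_set]
    have hL2 : Loaded X (s1.setReg 7 (eval s1 (var 7 -ᵣ lit 1))) := hL1.same (R := [7])
      (A := []) ⟨fun x hx => by simp at hx; simp [hx], fun _ _ => rfl⟩ (by simp) (by simp)
    obtain ⟨-, hc2, hc3⟩ := hc1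
    refine (outP_spec hX hL2 hW (e := e) (b := s1.reg 10) (by simp [RExpr.eval, k7]) (by simp)
      hc2 (hw1.congr rfl rfl fun i _ => Iff.rfl)).imp ?_
    rintro t s2 ⟨hr2, ha2⟩ ⟨ht, hw2⟩
    simp [outP_wregs, outP_warrs] at hr2 ha2
    refine ⟨by simp [RExpr.cost]; omega, by simp [RExpr.eval, hr2, k7], ?_,
      hw2.congr rfl rfl fun i _ => Iff.rfl⟩
    have : (s2.setReg 10 (eval s2 (get 10 (var 10)))).reg 10 = s1.arr 10 (s1.reg 10) := by
      simp [RExpr.eval, hr2, ha2]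
    rw [this]
    exact hc3.below hX le_rfl fun b h1 h2 p _ => by
      simp [ha2 b (by omega) (by omega)]
  · rintro s1 - ⟨k7, -⟩
    simp [RExpr.eval, k7]
  · rintro t s1 - ⟨ht, -, -, hw⟩
    refine ⟨?_, hw.congr rfl rfl (by simp)⟩
    simp [RExpr.cost] at ht ⊢
    nlinarith [Nat.mul_le_mul_left (X.n + 1) hD]

end Road

/-! ### Preparations -/

/-- The number of slots. -/
def slotsP : RProg :=
  2 ::= lit 1 ;; 10 ::= lit 0 ;;
  whileLt (var 10) (var 0) (
    13 ::= var 1 -ᵣ (var 1 -ᵣ get 0 (var 10)) ;;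
    ifLe (var 13) (var 2) skip (2 ::= var 13) ;;
    10 ::= var 10 +ᵣ lit 1)

theorem slotsP_wregs : slotsP.wregs = [2, 10, 13, 2, 10] := rfl

theorem slotsP_warrs : slotsP.warrs = [] := rfl

/-- Minimality bounds the number of slots both by `C` and by `m`; the second bound is what
`succ_pow_le` needs. -/
theorem slotsP_spec (s : State) : Wp slotsP s fun t s' => t ≤ (s.reg 0 + 1) * 40 ∧
    1 ≤ s'.reg 2 ∧ (∀ x < s.reg 0, min (s.arr 0 x) (s.reg 1) ≤ s'.reg 2) ∧
    ∀ c, 1 ≤ c → (∀ x < s.reg 0, min (s.arr 0 x) (s.reg 1) ≤ c) → s'.reg 2 ≤ c := by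
  simp only [slotsP, wp_seq, wp_set]
  refine (wp_while (fun j s' => s'.reg 10 = j ∧ 1 ≤ s'.reg 2 ∧
    (∀ x < j, min (s.arr 0 x) (s.reg 1) ≤ s'.reg 2) ∧
    ∀ c, 1 ≤ c → (∀ x < s.reg 0, min (s.arr 0 x) (s.reg 1) ≤ c) → s'.reg 2 ≤ c) (s.reg 0) 20
    ?_ ?_ ?_).imp ?_
  · exact ⟨rfl, le_rfl, fun x hx => absurd hx (by omega), fun c hc _ => hc⟩
  · rintro j s1 hj ⟨hr, ha⟩ ⟨h10, h1, hge, hle⟩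
    simp [RProg.wregs, RProg.warrs] at hr ha
    simp only [wp_seq, wp_set, wp_ifLe, wp_skip]
    simp only [RExpr.eval, RExpr.cost, h10, State.setReg_reg, ha]
    simp [hr, hj]
    refine ⟨fun h => ⟨h1, fun x hx => ?_, by simpa using hle⟩,
      fun h => ⟨by omega, fun x hx => ?_, ?_⟩⟩
    · rcases hx.lt_or_eq with hx | rfl
      · have := hge x hx
        omega
      · omega
    · rcases hx.lt_or_eq with hx | rfl
      · have := hge x hx
        omega
      · omega
    · intro c _ hc
      have := hc j hj
      omega
  · rintro s1 ⟨hr, ha⟩ ⟨h10, -⟩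
    simp [RProg.wregs, RProg.warrs] at hr ha
    simp [RExpr.eval, hr, h10]
  · rintro t s1 - ⟨ht, -, h⟩
    simp [RExpr.cost] at ht ⊢
    exact ⟨by omega, by simpa using h⟩

/-- The base: a number that exceeds the sum of the valuations. -/
def baseP : RProg :=
  3 ::= var 1 +ᵣ lit 1 ;; 10 ::= lit 0 ;;
  whileLt (var 10) (var 1) (
    3 ::= var 3 +ᵣ get 3 (var 10) ;;
    10 ::= var 10 +ᵣ lit 1)

theorem baseP_spec (s : State) : Wp baseP s fun t s' => t ≤ (s.reg 1 + 1) * 40 ∧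
    s'.reg 3 = s.reg 1 + 1 + ∑ i ∈ Finset.range (s.reg 1), s.arr 3 i := by
  simp only [baseP, wp_seq, wp_set]
  refine (wp_while (fun j s' => s'.reg 10 = j ∧
    s'.reg 3 = s.reg 1 + 1 + ∑ i ∈ Finset.range j, s.arr 3 i) (s.reg 1) 20 ?_ ?_ ?_).imp ?_
  · simp [RExpr.eval]
  · rintro j s1 hj ⟨hr, ha⟩ ⟨h10, h3⟩
    simp [RProg.wregs, RProg.warrs] at hr ha
    simp [wp_seq, wp_set, RExpr.eval, RExpr.cost, h10, h3, hr, ha, hj, Finset.sum_range_succ]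
    ring
  · rintro s1 ⟨hr, ha⟩ ⟨h10, -⟩
    simp [RProg.wregs, RProg.warrs] at hr ha
    simp [RExpr.eval, hr, h10]
  · rintro t s1 - ⟨ht, -, h⟩
    simp [RExpr.cost] at ht ⊢
    exact ⟨by omega, h⟩

/-- The size of a record. -/
def sizeP : RProg :=
  4 ::= lit 0 ;; 10 ::= lit 0 ;;
  whileLt (var 10) (var 2) (
    4 ::= var 4 +ᵣ var 2 ;;
    10 ::= var 10 +ᵣ lit 1)

theorem sizeP_spec (s : State) : Wp sizeP s fun t s' => t ≤ (s.reg 2 + 1) * 40 ∧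
    s'.reg 4 = s.reg 2 * s.reg 2 := by
  simp only [sizeP, wp_seq, wp_set]
  refine (wp_while (fun j s' => s'.reg 10 = j ∧ s'.reg 4 = j * s.reg 2) (s.reg 2) 20
    ?_ ?_ ?_).imp ?_
  · simp [RExpr.eval]
  · rintro j s1 hj ⟨hr, ha⟩ ⟨h10, h4⟩
    simp [RProg.wregs, RProg.warrs] at hr ha
    simp [wp_seq, wp_set, RExpr.eval, RExpr.cost, h10, h4, hr, hj]
    ring
  · rintro s1 ⟨hr, ha⟩ ⟨h10, -⟩
    simp [RProg.wregs, RProg.warrs] at hr ha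
    simp [RExpr.eval, hr, h10]
  · rintro t s1 - ⟨ht, -, h⟩
    simp [RExpr.cost] at ht ⊢
    exact ⟨by omega, h⟩

/-- One row of the table of the products of digits with powers of the base. -/
def tableRowP : RProg :=
  15 ::= lit 0 ;; 16 ::= lit 0 ;;
  whileLt (var 15) (var 3) (
    put 11 (var 10) (var 16) ;;
    16 ::= var 16 +ᵣ var 5 ;;
    10 ::= var 10 +ᵣ lit 1 ;;
    15 ::= var 15 +ᵣ lit 1)

theorem tableRowP_spec {s : State} {M q : ℕ} (h3 : s.reg 3 = M) (h5 : s.reg 5 = M ^ q)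
    (h10 : s.reg 10 = q * M) (h11 : ∀ p < q * M, s.arr 11 p = p % M * M ^ (p / M)) :
    Wp tableRowP s fun t s' => t ≤ (M + 1) * 40 ∧ s'.reg 16 = M ^ (q + 1) ∧
      s'.reg 10 = (q + 1) * M ∧ ∀ p < (q + 1) * M, s'.arr 11 p = p % M * M ^ (p / M) := by
  simp only [tableRowP, wp_seq, wp_set]
  refine (wp_while (fun d s' => s'.reg 15 = d ∧ s'.reg 16 = d * M ^ q ∧ s'.reg 10 = q * M + d ∧
    ∀ p < q * M + d, s'.arr 11 p = p % M * M ^ (p / M)) M 20 ?_ ?_ ?_).imp ?_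
  · simpa [RExpr.eval, h10] using h11
  · rintro d s1 hd ⟨hr, ha⟩ ⟨k15, k16, k10, k11⟩
    simp [RProg.wregs, RProg.warrs] at hr ha
    simp [wp_seq, wp_set, wp_put, RExpr.eval, RExpr.cost, k15, k16, k10, hr, hd, h3, h5]
    refine ⟨by ring, by ring, fun p hp => ?_⟩
    by_cases hpd : p = q * M + d
    · have h1 : (q * M + d) % M = d := by
        rw [mul_comm, Nat.mul_add_mod, Nat.mod_eq_of_lt hd]
      have h2 : (q * M + d) / M = q := by
        rw [mul_comm, Nat.mul_add_div (by omega), Nat.div_eq_of_lt hd, add_zero]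
      rw [hpd, Function.update_self, h1, h2]
    · rw [Function.update_of_ne hpd]
      exact k11 p (by omega)
  · rintro s1 ⟨hr, ha⟩ ⟨k15, -⟩
    simp [RProg.wregs, RProg.warrs] at hr ha
    simp [RExpr.eval, hr, k15, h3]
  · rintro t s1 - ⟨ht, -, k16, k10, k11⟩
    simp [RExpr.cost] at ht ⊢
    refine ⟨by omega, by rw [k16]; ring, by rw [k10]; ring, fun p hp => k11 p ?_⟩
    rwa [add_mul, one_mul] at hp

/-- The table of the products of digits with powers of the base. -/
def tableP : RProg :=
  14 ::= var 2 +ᵣ var 2 +ᵣ var 4 ;; 5 ::= lit 1 ;; 13 ::= lit 0 ;; 10 ::= lit 0 ;;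
  whileLt (var 13) (var 14) (
    tableRowP ;;
    5 ::= var 16 ;;
    13 ::= var 13 +ᵣ lit 1)

/-- The rows lie one after another, so position `p` holds `p % M * M ^ (p / M)`. Each row is built
by repeated addition and ends with the next power; the last power is the size of the key space. -/
theorem tableP_spec {s : State} {L M : ℕ} (h3 : s.reg 3 = M)
    (hL : L = s.reg 2 + s.reg 2 + s.reg 4) :
    Wp tableP s fun t s' => t ≤ (L + 1) * ((M + 2) * 40) ∧ s'.reg 5 = M ^ L ∧
      ∀ q < L, ∀ d < M, s'.arr 11 (q * M + d) = d * M ^ q := by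
  simp only [tableP, wp_seq, wp_set]
  refine (wp_while (fun q s' => s'.reg 13 = q ∧ s'.reg 5 = M ^ q ∧ s'.reg 10 = q * M ∧
    ∀ p < q * M, s'.arr 11 p = p % M * M ^ (p / M)) L ((M + 1) * 40 + 6) ?_ ?_ ?_).imp ?_
  · simp [RExpr.eval]
  · rintro q s1 hq ⟨hr, ha⟩ ⟨k13, k5, k10, k11⟩
    simp [RProg.wregs, RProg.warrs, tableRowP] at hr ha
    refine ⟨by simp [RExpr.eval, k13, hr, ← hL, hq], ?_⟩
    simp only [wp_seq, wp_set]
    refine (tableRowP_spec (M := M) (by simp [hr, h3]) k5 k10 k11).imp ?_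
    rintro t s2 ⟨hr2, -⟩ ⟨ht, l16, l10, l11⟩
    simp [RProg.wregs, tableRowP] at hr2
    simp [RExpr.eval, RExpr.cost, l16, l10, hr2, k13]
    exact ⟨by omega, l11⟩
  · rintro s1 ⟨hr, ha⟩ ⟨k13, -⟩
    simp [RProg.wregs, RProg.warrs, tableRowP] at hr ha
    simp [RExpr.eval, hr, k13, ← hL]
  · rintro t s1 - ⟨ht, -, k5, -, k11⟩
    refine ⟨?_, k5, fun q hq d hd => ?_⟩
    · simp [RExpr.cost] at ht ⊢
      nlinarith
    · have h1 : (q * M + d) % M = d := by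
        rw [mul_comm, Nat.mul_add_mod, Nat.mod_eq_of_lt hd]
      have h2 : (q * M + d) / M = q := by
        rw [mul_comm, Nat.mul_add_div (by omega), Nat.div_eq_of_lt hd, add_zero]
      have := Nat.mul_le_mul_right M (Nat.succ_le_of_lt hq)
      rw [Nat.succ_mul] at this
      rw [k11 _ (by omega), h1, h2]

/-- The program for the highway problem. -/
def highwayP : RProg := slotsP ;; baseP ;; sizeP ;; tableP ;; levelsP ;; walkP

/-! ### The running time -/

/-- For `c ≤ m` the factor `(1 + 1 / m) ^ c` is at most the number `e`, which is below 3. -/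
theorem succ_pow_le {m c : ℕ} (hm : 1 ≤ m) (hc : c ≤ m) : (m + 1) ^ c ≤ 3 * m ^ c := by
  have hm0 : (0 : ℝ) < m := by exact_mod_cast hm
  have h1 : (1 + 1 / (m : ℝ)) ^ c ≤ 3 := by
    have h2 : 1 + 1 / (m : ℝ) ≤ Real.exp (1 / m) := by
      rw [add_comm]
      exact Real.add_one_le_exp _
    have h3 : (c : ℝ) * (1 / m) ≤ 1 := by
      rw [mul_one_div, div_le_one hm0]
      exact_mod_cast hc
    calc (1 + 1 / (m : ℝ)) ^ c ≤ Real.exp (1 / m) ^ c :=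
          pow_le_pow_left₀ (by positivity) h2 c
      _ = Real.exp (c * (1 / m)) := (Real.exp_nat_mul _ _).symm
      _ ≤ Real.exp 1 := Real.exp_le_exp.2 h3
      _ ≤ 3 := by linarith [Real.exp_one_lt_d9]
  have h4 : ((m : ℝ) + 1) ^ c ≤ 3 * m ^ c := by
    rw [show (m : ℝ) + 1 = (1 + 1 / m) * m by field_simp, mul_pow]
    exact mul_le_mul_of_nonneg_right h1 (by positivity)
  exact_mod_cast h4

/-- From `c = 3` on, `m * c * c ≤ m ^ 3 ≤ m ^ c`; the constant 4 is needed for `c = 2`. -/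
theorem mul_sq_mul_pow_le {m c : ℕ} (hm : 1 ≤ m) (hc : c ≤ m) (hc1 : 1 ≤ c) :
    m * (c * c * m ^ c) ≤ 4 * m ^ (2 * c) := by
  suffices m * (c * c) ≤ 4 * m ^ c by
    calc m * (c * c * m ^ c) = m * (c * c) * m ^ c := by ring
      _ ≤ 4 * m ^ c * m ^ c := Nat.mul_le_mul_right _ this
      _ = 4 * m ^ (2 * c) := by ring
  rcases le_or_gt c 2 with h | h
  · interval_cases c
    · rw [pow_one]
      omega
    · nlinarith
  · calc m * (c * c) ≤ m * (m * m) := Nat.mul_le_mul_left _ (Nat.mul_le_mul hc hc)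
      _ = m ^ 3 := by ring
      _ ≤ m ^ c := Nat.pow_le_pow_right hm h
      _ ≤ 4 * m ^ c := by omega

/-- The number of records, times the size of a record and the number of agents. -/
theorem mul_card_records_le {m c C B : ℕ} (hm : 1 ≤ m) (hc : c ≤ m) (hc1 : 1 ≤ c) (hcC : c ≤ C)
    (hB : 1 ≤ B) : m * (c * c * ((m + 1) ^ c * (B ^ c * (B ^ c) ^ c))) ≤
      12 * (m ^ (2 * C) * B ^ (2 * C ^ 2)) := by
  -- The exponent is `c + c * c`, at most `2 * C ^ 2` since `1 ≤ c ≤ C`.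
  have h1 : B ^ c * (B ^ c) ^ c ≤ B ^ (2 * C ^ 2) := by
    rw [← pow_mul, ← pow_add]
    exact Nat.pow_le_pow_right hB (by nlinarith [Nat.mul_le_mul hcC hcC])
  have h2 : m * (c * c * (m + 1) ^ c) ≤ 12 * m ^ (2 * C) := by
    calc m * (c * c * (m + 1) ^ c) ≤ m * (c * c * (3 * m ^ c)) := by
          gcongr
          exact succ_pow_le hm hc
      _ = 3 * (m * (c * c * m ^ c)) := by ring
      _ ≤ 3 * (4 * m ^ (2 * c)) := Nat.mul_le_mul_left _ (mul_sq_mul_pow_le hm hc hc1)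
      _ = 12 * m ^ (2 * c) := by ring
      _ ≤ 12 * m ^ (2 * C) := by
          gcongr
  calc m * (c * c * ((m + 1) ^ c * (B ^ c * (B ^ c) ^ c)))
      = m * (c * c * (m + 1) ^ c) * (B ^ c * (B ^ c) ^ c) := by ring
    _ ≤ 12 * m ^ (2 * C) * B ^ (2 * C ^ 2) := Nat.mul_le_mul h2 h1
    _ = 12 * (m ^ (2 * C) * B ^ (2 * C ^ 2)) := by ring

/-- The total time in terms of the number `R` of records. -/
theorem time_le {n m c M R B : ℕ} (hn : 1 ≤ n) (hm : 1 ≤ m) (hc : 1 ≤ c) (hB : B ≤ R)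
    (hR : 1 ≤ R) (hM : M ≤ m + 1 + m * B) :
    (n + 1) * 40 + ((m + 1) * 40 + ((c + 1) * 40 + ((c + c + c * c + 1) * ((M + 2) * 40) +
      ((n + 1) * ((m + 4) * ((R + 1) * (1350 * (c * c)))) + (n + 1) * (530 * (c * c)))))) ≤
      40000 * (n * (m * (c * c * R))) := by
  have hD : c ≤ c * c := Nat.le_mul_of_pos_left _ hc
  generalize c * c = D at hD ⊢
  have hD1 : 1 ≤ D := hc.trans hD
  have hDR : D ≤ D * R := Nat.le_mul_of_pos_right _ hR
  have hmDR : D * R ≤ m * (D * R) := Nat.le_mul_of_pos_left _ hm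
  have hQ : m * (D * R) ≤ n * (m * (D * R)) := Nat.le_mul_of_pos_left _ hn
  have hmQ : m ≤ m * (D * R) := Nat.le_mul_of_pos_right _ (by omega)
  have hnQ : n ≤ n * (m * (D * R)) := Nat.le_mul_of_pos_right _ (by omega)
  -- The table has a number of entries proportional to `M`, which is of order `m * B`; it is
  -- absorbed because there are at least `B` records in the bound `R`.
  have h1 : (c + c + D + 1) * ((M + 2) * 40) ≤ 800 * (m * (D * R)) := by
    have hmR : m ≤ m * R := Nat.le_mul_of_pos_right _ hR
    have hmB : m * B ≤ m * R := Nat.mul_le_mul_left _ hB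
    calc (c + c + D + 1) * ((M + 2) * 40) ≤ (4 * D) * ((5 * (m * R)) * 40) :=
          Nat.mul_le_mul (by omega) (Nat.mul_le_mul_right _ (by omega))
      _ = 800 * (m * (D * R)) := by ring
  have h2 : (n + 1) * ((m + 4) * ((R + 1) * (1350 * D))) ≤ 27000 * (n * (m * (D * R))) := by
    calc (n + 1) * ((m + 4) * ((R + 1) * (1350 * D)))
        ≤ (2 * n) * ((5 * m) * ((2 * R) * (1350 * D))) := by
          gcongr <;> omega
      _ = 27000 * (n * (m * (D * R))) := by ring
  have h3 : (n + 1) * (530 * D) ≤ 1060 * (n * (m * (D * R))) := by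
    calc (n + 1) * (530 * D) ≤ (2 * n) * (530 * (m * (D * R))) := by
          gcongr <;> omega
      _ = 1060 * (n * (m * (D * R))) := by ring
  omega

/-! ### The complete program on an instance -/

namespace Highway

variable {n m : ℕ} (I : Highway n m)

theorem road_roomy {c M : ℕ} (hM : m + ∑ i ∈ Finset.range m, toArray I.val i < M) (hc : 1 ≤ c)
    (hcap : ∀ x < n, min (toArray I.cap x) m ≤ c) : (I.road c M).Roomy := by
  refine ⟨⟨fun i hi => ?_, fun i hi => ?_, hM⟩, hc, hcap⟩
  · have hi' : i < m := hi
    simpa [road, toArray, hi'] using I.first_le_last ⟨i, hi'⟩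
  · have hi' : i < m := hi
    simp [road, toArray, hi']

/-- The constant is the product of 40000 from `time_le` and 12 from `mul_card_records_le`. -/
theorem highwayP_spec {B C : ℕ} (hm : 1 ≤ m) (hB : 1 ≤ B) (hC : 1 ≤ C)
    (hcap : ∀ e, I.cap e ≤ C) (hval : ∀ i, I.val i ≤ B) :
    Wp highwayP I.input fun t s => t ≤ 480000 * (m ^ (2 * C) * B ^ (2 * C ^ 2) * n) ∧
      I.OutputOptimal s := by
  -- An agent has a first item, so the road is not empty.
  have hn : 1 ≤ n := Nat.one_le_iff_ne_zero.2 fun h => by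
    subst h
    exact (I.first ⟨0, hm⟩).elim0
  have hcapC (x : ℕ) : toArray I.cap x ≤ C := by
    unfold toArray
    split_ifs
    · exact hcap _
    · omega
  have hvalB (i : ℕ) : toArray I.val i ≤ B := by
    unfold toArray
    split_ifs
    · exact hval _
    · omega
  simp only [highwayP, wp_seq]
  refine (slotsP_spec _).imp ?_
  rintro t1 s1 ⟨hr1, ha1⟩ ⟨ht1, hc1, hge, hle⟩
  simp [slotsP_wregs, slotsP_warrs] at hr1 ha1
  change t1 ≤ (n + 1) * 40 at ht1
  change ∀ x < n, min (toArray I.cap x) m ≤ _ at hge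
  change ∀ c, 1 ≤ c → (∀ x < n, min (toArray I.cap x) m ≤ c) → _ at hle
  obtain ⟨c, hc⟩ : ∃ c, s1.reg 2 = c := ⟨_, rfl⟩
  rw [hc] at hc1 hge hle
  have hcC : c ≤ C := hle C hC fun x _ => (min_le_left _ _).trans (hcapC x)
  have hcm : c ≤ m := hle m hm fun x _ => min_le_right _ _
  refine (baseP_spec _).imp ?_
  rintro t2 s2 ⟨hr2, ha2⟩ ⟨ht2, k3⟩
  simp [baseP, RProg.wregs, RProg.warrs] at hr2 ha2
  have e1 : s1.reg 1 = m := by simp [hr1, input]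
  rw [ha1, e1] at k3
  rw [e1] at ht2
  change s2.reg 3 = m + 1 + ∑ i ∈ Finset.range m, toArray I.val i at k3
  obtain ⟨M, hM⟩ : ∃ M, s2.reg 3 = M := ⟨_, rfl⟩
  rw [hM] at k3
  have hMB : M ≤ m + 1 + m * B := by
    have : ∑ i ∈ Finset.range m, toArray I.val i ≤ m * B :=
      (Finset.sum_le_card_nsmul _ _ B fun i _ => hvalB i).trans_eq (by simp)
    omega
  have hX := I.road_roomy (c := c) (M := M) (by omega) hc1 hge
  refine (sizeP_spec _).imp ?_
  rintro t3 s3 ⟨hr3, ha3⟩ ⟨ht3, k4⟩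
  simp [sizeP, RProg.wregs, RProg.warrs] at hr3 ha3
  have e2 : s2.reg 2 = c := by simp [hr2, hc]
  rw [e2] at ht3 k4
  refine (tableP_spec (M := M) (L := c + c + c * c) (by simp [hr3, hM])
    (by simp [hr3, hr2, hc, k4])).imp ?_
  rintro t4 s4 ⟨hr4, ha4⟩ ⟨ht4, k5, k11⟩
  simp [tableP, tableRowP, RProg.wregs, RProg.warrs] at hr4 ha4
  have hL : Loaded (I.road c M) s4 := by
    refine ⟨?_, ?_, ?_, ?_, ?_, k5, ?_, ?_, ?_, ?_, k11⟩
    · simp [hr4, hr3, hr2, hr1, input, road]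
    · simp [hr4, hr3, hr2, hr1, input, road]
    · simp [hr4, hr3, hr2, hc, road]
    · simp [hr4, hr3, hM, road]
    · simp [hr4, k4, road]
    all_goals simp [ha4, ha3, ha2, ha1, input, road]
  have hzero {b : ℕ} (hb : b ≠ 11) (hb3 : 4 ≤ b) : s4.arr b = 0 := by
    rw [ha4 b hb, ha3, ha2, ha1]
    obtain ⟨a, rfl⟩ := Nat.exists_eq_add_of_le' hb3
    rfl
  obtain ⟨R, hR⟩ : ∃ R, R = (m + 1) ^ c * (B ^ c * (B ^ c) ^ c) := ⟨_, rfl⟩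
  refine (Road.levelsP_spec (R := R) hX hL (hzero (by omega) (by omega))
    (hzero (by omega) (by omega)) (hzero (by omega) (by omega)) (hzero (by omega) (by omega))
    (hzero (by omega) (by omega)) fun s e k lo N h => ?_).imp ?_
  · rw [hR]
    exact h.card_le hX hB fun i _ => hvalB i
  rintro t5 s5 hs5 ⟨ht5, k7, W, hW, hmax, hchain⟩
  have hL5 := hL.same hs5
    (by simp [levelsP_wregs, addLevelP_wregs, addAgentP_wregs, addRecP_wregs, advLevelP_wregs,
      advRecP_wregs, advP_wregs, keyP_wregs])
    (by simp [levelsP_warrs, addLevelP_warrs, addAgentP_warrs, addRecP_warrs, advLevelP_warrs,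
      advRecP_warrs, advP_warrs])
  refine (Road.walkP_spec hX hL5 hW k7 hchain ?_).imp ?_
  · rw [hs5.2 4 (by simp [levelsP_warrs, addLevelP_warrs, addAgentP_warrs, addRecP_warrs,
      advLevelP_warrs, advRecP_warrs, advP_warrs])]
    exact hzero (by omega) le_rfl
  rintro t6 s6 - ⟨ht6, hw⟩
  change t5 ≤ (n + 1) * ((m + 4) * ((R + 1) * (1350 * (c * c)))) at ht5
  change t6 ≤ (n + 1) * (530 * (c * c)) at ht6
  constructor
  · have h1 : 1 ≤ (m + 1) ^ c := Nat.one_le_pow _ _ (by omega)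
    have h2 : 1 ≤ (B ^ c) ^ c := Nat.one_le_pow _ _ (Nat.one_le_pow _ _ hB)
    have hBR : B ≤ R := by
      rw [hR]
      calc B = B ^ 1 := (pow_one B).symm
        _ ≤ B ^ c := Nat.pow_le_pow_right hB hc1
        _ ≤ B ^ c * (B ^ c) ^ c := Nat.le_mul_of_pos_right _ h2
        _ ≤ _ := Nat.le_mul_of_pos_left _ h1
    have h3 := mul_card_records_le hm hcm hc1 hcC hB
    rw [← hR] at h3
    have h4 := time_le hn hm hc1 hBR (hB.trans hBR) hMB
    calc _ ≤ 40000 * (n * (m * (c * c * R))) := by omega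
      _ ≤ 40000 * (n * (12 * (m ^ (2 * C) * B ^ (2 * C ^ 2)))) := by gcongr
      _ = _ := by ring
  · exact outputOptimal_of_worth_max (by omega) hW hmax
      (fun i _ => (hw.iff i).trans (and_iff_left trivial)) fun i hi => hw.eq i hi trivial

end Highway

end HighwayPricing

theorem theoremp :
    ∃ (P : HighwayPricing.RProg) (K : ℕ),
      ∀ (n m B C : ℕ) (I : HighwayPricing.Highway n m),
        1 ≤ m → 1 ≤ B → 1 ≤ C →
        (∀ e, I.cap e ≤ C) → (∀ i, I.val i ≤ B) →
        ∃ (t : ℕ) (s : HighwayPricing.State),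
          HighwayPricing.Run P I.input t s ∧
          t ≤ K * (m ^ (2 * C) * B ^ (2 * C ^ 2) * n) ∧
          I.OutputOptimal s :=
  ⟨HighwayPricing.highwayP, 480000, fun _ _ _ _ I hm hB hC hcap hval =>
    I.highwayP_spec hm hB hC hcap hval⟩
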